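/- Let $\Omega=(a,b)\times(c,d)$, $T>0$, $1<\alpha,\beta\le 2$, and consider $$\partial_t u=K_1^+\,{}_aD_x^\alpha u+K_2^+\,{}_xD_b^\alpha u+K_1^-\,{}_cD_y^\beta u+K_2^-\,{}_yD_d^\beta u+f\quad\text{in }\Omega\times(0,T],\tag{1}$$ $u=u_0$ in $\Omega$ at $t=0$, $u=\varphi$ on $\partial\Omega\times[0,T]$, with left and right Riemann–Liouville derivatives, constants $K_i^\pm\ge0$, $(K_1^\pm)^2+(K_2^\pm)^2\ne0$, $f$ continuous on $\overline\Omega\times[0,T]$, and $\varphi=0$ on the side $x=a$, $x=b$, $y=c$, $y=d$ whenever $K_1^+\neq0$, $K_2^+\ne0$, $K_1^-\ne0$, $K_2^-\ne0$, respectively (call these sides active). Discretization. Let $(p,q)=(1,0)$ or $(1,-1)$ and $g_k^{(\alpha)}=(-1)^k\binom{\alpha}{k}$. For $(1,0)$ put $w_0^{(\alpha)}=\frac\alpha2g_0^{(\alpha)}$, $w_k^{(\alpha)}=\frac\alpha2 g_k^{(\alpha)}+\frac{2-\alpha}2g_{k-1}^{(\alpha)}$ for $k\ge1$, and $c^\alpha=\frac{7\alpha-3\alpha^2}{24}$;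 for $(1,-1)$ put $w_k^{(\alpha)}=\frac{2+\alpha}4g_k^{(\alpha)}$ for $k=0,1$, $w_k^{(\alpha)}=\frac{2+\alpha}4g_k^{(\alpha)}+\frac{2-\alpha}4g_{k-2}^{(\alpha)}$ for $k\ge2$, and $c^\alpha=\frac{\alpha-3\alpha^2+12}{24}$. On a grid with $h=(b-a)/N_x=(d-c)/N_y$, $\tau=T/M$, $x_i=a+ih$, $y_j=c+jh$, $t_n=n\tau$, let $$\mathcal C_xv_{i,j}=v_{i,j}+c^\alpha(v_{i-1,j}-2v_{i,j}+v_{i+1,j}),\qquad \delta_x^\alpha v_{i,j}=\frac{K_1^+}{h^\alpha}\sum_{k=0}^{i+1}w_k^{(\alpha)}v_{i-k+1,j}+\frac{K_2^+}{h^\alpha}\sum_{k=0}^{N_x-i+1}w_k^{(\alpha)}v_{i+k-1,j},$$ and let $\mathcal C_y,\delta_y^\beta$ be the analogous operators in $y$, with $\beta,K_1^-,K_2^-,N_y$. Let $f^{n+1/2}_{i,j}=f(x_i,y_j,\frac{t_n+t_{n+1}}2)$. Scheme (A) is, at all interior grid points and for $0\le n<M$, $$\Big(\mathcal C_x-\frac\tau2\delta_x^\alpha\Big)\Big(\mathcal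 C_y-\frac\tau2\delta_y^\beta\Big)U^{n+1}_{i,j}=\Big(\mathcal C_x+\frac\tau2\delta_x^\alpha\Big)\Big(\mathcal C_y+\frac\tau2\delta_y^\beta\Big)U^{n}_{i,j}+\tau\,\mathcal C_x\mathcal C_yf^{n+1/2}_{i,j},$$ and scheme (B) is the same with the additional term $\frac{\tau^3}{4}\delta_x^\alpha\delta_y^\beta f^{n+1/2}_{i,j}$ on the right; both with $U^0=u_0$ at interior grid points and $U^n=\varphi(\cdot,t_n)$ at boundary grid points, $0\le n\le M$. Smoothness. A function on $\overline\Omega\times[0,T]$ is called admissibly $C^k$ if it is the restriction of a $C^k$ function on $\mathbb R^3$ that vanishes beyond each active side (e.g. for $x\le a$, $y\in[c,d]$, $t\in[0,T]$ if $x=a$ is active), i.e. if it is $C^k$ up to the boundary and remains so when extended by zero across the active sides. Theorem. Let $u$ be a solution of (1) that is admissibly $C^7$. Assume $1<\alpha,\beta<2$ if $(p,q)=(1,0)$, and $\frac{1+\sqrt{73}}6<\alpha,\beta<2$ if $(p,q)=(1,-1)$. Then there is a constant $C>0$, independent of $h$, $\tau$ and $n$, such that for all positive integers $N_x,N_y,M$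 with $(b-a)/N_x=(d-c)/N_y$ the solution $U$ of scheme (A) satisfies $$\Big(h^2\sum_{i=1}^{N_x-1}\sum_{j=1}^{N_y-1}\big(u(x_i,y_j,t_n)-U^n_{i,j}\big)^2\Big)^{1/2}\le C(\tau^2+h^3),\qquad 1\le n\le M.$$ If moreover the source $f$, to which scheme (B) applies $\delta_x^\alpha\delta_y^\beta$, is admissibly $C^4$, the same holds for the solution of scheme (B). -/

import Mathlib

noncomputable section

namespace FracDiff

/-! ## Riemann-Liouville derivatives -/

/-- Left Riemann-Liouville derivative of order `α` on `(a, ·)`, with `n = ⌈α⌉`. -/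
def leftRL (a α : ℝ) (v : ℝ → ℝ) (x : ℝ) : ℝ :=
  if α = (⌈α⌉₊ : ℝ) then iteratedDeriv ⌈α⌉₊ v x
  else 1 / Real.Gamma ((⌈α⌉₊ : ℝ) - α) *
    iteratedDeriv ⌈α⌉₊ (fun z => ∫ ξ in a..z, v ξ / (z - ξ) ^ (α - (⌈α⌉₊ : ℝ) + 1)) x

/-- Right Riemann-Liouville derivative of order `α` on `(·, b)`, with `n = ⌈α⌉`. -/
def rightRL (b α : ℝ) (v : ℝ → ℝ) (x : ℝ) : ℝ :=
  if α = (⌈α⌉₊ : ℝ) then (-1) ^ ⌈α⌉₊ * iteratedDeriv ⌈α⌉₊ v x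
  else (-1) ^ ⌈α⌉₊ / Real.Gamma ((⌈α⌉₊ : ℝ) - α) *
    iteratedDeriv ⌈α⌉₊ (fun z => ∫ ξ in z..b, v ξ / (ξ - z) ^ (α - (⌈α⌉₊ : ℝ) + 1)) x

/-! ## The initial-boundary value problem -/

/-- Data of the two-sided space fractional diffusion problem on `(a, b) × (c, d) × (0, T]`.
`K1x`, `K2x` are the coefficients of the left and right derivatives in `x`,
`K1y`, `K2y` those in `y`. -/
structure Problem where
  (a b c d T : ℝ)
  (α β : ℝ)
  (K1x K2x K1y K2y : ℝ)
  /-- source term -/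
  f : ℝ → ℝ → ℝ → ℝ
  /-- initial value -/
  u₀ : ℝ → ℝ → ℝ
  /-- boundary value -/
  φ : ℝ → ℝ → ℝ → ℝ
  hab : a < b
  hcd : c < d
  hT : 0 < T
  hα : 1 < α ∧ α ≤ 2
  hβ : 1 < β ∧ β ≤ 2
  hK1x : 0 ≤ K1x
  hK2x : 0 ≤ K2x
  hK1y : 0 ≤ K1y
  hK2y : 0 ≤ K2y
  hKx : K1x ^ 2 + K2x ^ 2 ≠ 0
  hKy : K1y ^ 2 + K2y ^ 2 ≠ 0
  hφa : K1x ≠ 0 → ∀ y ∈ Set.Icc c d, ∀ t ∈ Set.Icc 0 T, φ a y t = 0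
  hφb : K2x ≠ 0 → ∀ y ∈ Set.Icc c d, ∀ t ∈ Set.Icc 0 T, φ b y t = 0
  hφc : K1y ≠ 0 → ∀ x ∈ Set.Icc a b, ∀ t ∈ Set.Icc 0 T, φ x c t = 0
  hφd : K2y ≠ 0 → ∀ x ∈ Set.Icc a b, ∀ t ∈ Set.Icc 0 T, φ x d t = 0
  /-- the source is continuous up to the boundary, so that its values at boundary grid points,
  which the schemes use, are those determined by the equation -/
  hf : ContinuousOn (fun z : ℝ × ℝ × ℝ => f z.1 z.2.1 z.2.2)
    (Set.Icc a b ×ˢ Set.Icc c d ×ˢ Set.Icc 0 T)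

namespace Problem

/-- `u` solves the initial-boundary value problem. -/
structure IsSolution (P : Problem) (u : ℝ → ℝ → ℝ → ℝ) : Prop where
  equation : ∀ x ∈ Set.Ioo P.a P.b, ∀ y ∈ Set.Ioo P.c P.d, ∀ t ∈ Set.Ioc 0 P.T,
    HasDerivWithinAt (fun s => u x y s)
      ((P.K1x * leftRL P.a P.α (fun ξ => u ξ y t) x
          + P.K2x * rightRL P.b P.α (fun ξ => u ξ y t) x)
        + (P.K1y * leftRL P.c P.β (fun η => u x η t) y
          + P.K2y * rightRL P.d P.β (fun η => u x η t) y)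
        + P.f x y t)
      (Set.Icc 0 P.T) t
  initial : ∀ x ∈ Set.Ioo P.a P.b, ∀ y ∈ Set.Ioo P.c P.d, u x y 0 = P.u₀ x y
  boundary : ∀ x ∈ Set.Icc P.a P.b, ∀ y ∈ Set.Icc P.c P.d, ∀ t ∈ Set.Icc 0 P.T,
    (x = P.a ∨ x = P.b ∨ y = P.c ∨ y = P.d) → u x y t = P.φ x y t

/-- `g` is of class `C^k` on the closed space-time cylinder, and stays of class `C^k` when it is
extended by zero across each side from which a Riemann-Liouville derivative with nonzero
coefficient starts (`x = a` if `K1x ≠ 0`, `x = b` if `K2x ≠ 0`, `y = c` if `K1y ≠ 0`,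
`y = d` if `K2y ≠ 0`). -/
def SmoothOfOrder (P : Problem) (k : ℕ) (g : ℝ → ℝ → ℝ → ℝ) : Prop :=
  ∃ G : ℝ × ℝ × ℝ → ℝ, ContDiff ℝ k G ∧
    (∀ x ∈ Set.Icc P.a P.b, ∀ y ∈ Set.Icc P.c P.d, ∀ t ∈ Set.Icc 0 P.T,
      G (x, y, t) = g x y t) ∧
    (P.K1x ≠ 0 → ∀ x ≤ P.a, ∀ y ∈ Set.Icc P.c P.d, ∀ t ∈ Set.Icc 0 P.T, G (x, y, t) = 0) ∧
    (P.K2x ≠ 0 → ∀ x ≥ P.b, ∀ y ∈ Set.Icc P.c P.d, ∀ t ∈ Set.Icc 0 P.T, G (x, y, t) = 0) ∧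
    (P.K1y ≠ 0 → ∀ x ∈ Set.Icc P.a P.b, ∀ y ≤ P.c, ∀ t ∈ Set.Icc 0 P.T, G (x, y, t) = 0) ∧
    (P.K2y ≠ 0 → ∀ x ∈ Set.Icc P.a P.b, ∀ y ≥ P.d, ∀ t ∈ Set.Icc 0 P.T, G (x, y, t) = 0)

end Problem

/-! ## Difference operators -/

/-- The two admissible pairs of shifts `(p, q)`: `(1, 0)` and `(1, -1)`. -/
inductive Shifts
  | oneZero
  | oneNegOne

/-- Grünwald coefficients `(-1)^k * binom(α, k)`, the power series coefficients of `(1 - z)^α`. -/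
def grunwald (α : ℝ) (k : ℕ) : ℝ := (-1) ^ k * Ring.choose α k

/-- Weights of the weighted and shifted Grünwald difference operators. -/
def weight : Shifts → ℝ → ℕ → ℝ
  | .oneZero, α, 0 => α / 2 * grunwald α 0
  | .oneZero, α, k + 1 => α / 2 * grunwald α (k + 1) + (2 - α) / 2 * grunwald α k
  | .oneNegOne, α, 0 => (2 + α) / 4 * grunwald α 0
  | .oneNegOne, α, 1 => (2 + α) / 4 * grunwald α 1
  | .oneNegOne, α, k + 2 => (2 + α) / 4 * grunwald α (k + 2) + (2 - α) / 4 * grunwald α k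

/-- The coefficient `c_{p,q,2}` of the compact operator. -/
def compactCoeff : Shifts → ℝ → ℝ
  | .oneZero, α => (7 * α - 3 * α ^ 2) / 24
  | .oneNegOne, α => (α - 3 * α ^ 2 + 12) / 24

/-- Left weighted and shifted Grünwald difference of `v` at the grid point of index `i ≥ 1`. -/
def leftWSGD (s : Shifts) (α h : ℝ) (v : ℕ → ℝ) (i : ℕ) : ℝ :=
  1 / h ^ α * ∑ k ∈ Finset.range (i + 2), weight s α k * v (i + 1 - k)

/-- Right weighted and shifted Grünwald difference of `v` at the grid point of index
`1 ≤ i ≤ N - 1`, on the grid with indices `0, …, N`. -/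
def rightWSGD (s : Shifts) (α h : ℝ) (N : ℕ) (v : ℕ → ℝ) (i : ℕ) : ℝ :=
  1 / h ^ α * ∑ k ∈ Finset.range (N - i + 2), weight s α k * v (i + k - 1)

/-- Second order central difference at an index `i ≥ 1`. -/
def centralDiff (h : ℝ) (v : ℕ → ℝ) (i : ℕ) : ℝ :=
  (v (i - 1) - 2 * v i + v (i + 1)) / h ^ 2

/-- The compact operator `1 + c_{p,q,2} h² δ²` in one variable. -/
def compactOp (s : Shifts) (α h : ℝ) (v : ℕ → ℝ) (i : ℕ) : ℝ :=
  v i + compactCoeff s α * h ^ 2 * centralDiff h v i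

/-- Grid functions; the first index belongs to `x`, the second one to `y`. -/
abbrev Grid := ℕ → ℕ → ℝ

namespace Problem

/-- The operator `𝒞_x`. -/
def Cx (P : Problem) (s : Shifts) (h : ℝ) (v : Grid) : Grid := fun i j =>
  compactOp s P.α h (fun i' => v i' j) i

/-- The operator `𝒞_y`. -/
def Cy (P : Problem) (s : Shifts) (h : ℝ) (v : Grid) : Grid := fun i j =>
  compactOp s P.β h (fun j' => v i j') j

/-- The operator `δ_x^α`. -/
def δx (P : Problem) (s : Shifts) (h : ℝ) (Nx : ℕ) (v : Grid) : Grid := fun i j =>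
  P.K1x * leftWSGD s P.α h (fun i' => v i' j) i
    + P.K2x * rightWSGD s P.α h Nx (fun i' => v i' j) i

/-- The operator `δ_y^β`. -/
def δy (P : Problem) (s : Shifts) (h : ℝ) (Ny : ℕ) (v : Grid) : Grid := fun i j =>
  P.K1y * leftWSGD s P.β h (fun j' => v i j') j
    + P.K2y * rightWSGD s P.β h Ny (fun j' => v i j') j

/-- The operator `(𝒞_x + r δ_x^α)(𝒞_y + r δ_y^β)`. -/
def factorOp (P : Problem) (s : Shifts) (h r : ℝ) (Nx Ny : ℕ) (v : Grid) : Grid :=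
  let w : Grid := P.Cy s h v + r • P.δy s h Ny v
  P.Cx s h w + r • P.δx s h Nx w

/-! ## Grids and schemes -/

/-- Grid point `x_i = a + i h`. -/
def gridX (P : Problem) (h : ℝ) (i : ℕ) : ℝ := P.a + i * h

/-- Grid point `y_j = c + j h`. -/
def gridY (P : Problem) (h : ℝ) (j : ℕ) : ℝ := P.c + j * h

/-- Values at time `t` of a space-time function on the grid. -/
def sample (P : Problem) (h : ℝ) (g : ℝ → ℝ → ℝ → ℝ) (t : ℝ) : Grid := fun i j =>
  g (P.gridX h i) (P.gridY h j) t

/-- The grid function `f^{n+1/2}`. -/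
def sourceMid (P : Problem) (h τ : ℝ) (n : ℕ) : Grid :=
  P.sample h P.f (((n : ℝ) * τ + ((n : ℝ) + 1) * τ) / 2)

end Problem

/-- The compact scheme (`factorized`) and the variant with the additional term
`(τ³/4) δ_x^α δ_y^β f^{n+1/2}` on the right-hand side (`corrected`). -/
inductive Scheme
  | factorized
  | corrected

namespace Problem

/-- The source contribution on the right-hand side of the scheme at step `n`. -/
def schemeSource (P : Problem) (S : Scheme) (s : Shifts) (h τ : ℝ) (Nx Ny n : ℕ) : Grid :=
  match S with
  | .factorized => τ • P.Cx s h (P.Cy s h (P.sourceMid h τ n))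
  | .corrected => τ • P.Cx s h (P.Cy s h (P.sourceMid h τ n))
      + (τ ^ 3 / 4) • P.δx s h Nx (P.δy s h Ny (P.sourceMid h τ n))

/-- `U n i j` is the solution of the scheme `S` with space step `h`, `Nx` and `Ny` space
intervals, time step `τ` and `M` time steps. -/
structure IsSchemeSolution (P : Problem) (S : Scheme) (s : Shifts) (h τ : ℝ) (Nx Ny M : ℕ)
    (U : ℕ → Grid) : Prop where
  initial : ∀ i ∈ Set.Ioo 0 Nx, ∀ j ∈ Set.Ioo 0 Ny, U 0 i j = P.u₀ (P.gridX h i) (P.gridY h j)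
  boundary : ∀ n ≤ M, ∀ i ≤ Nx, ∀ j ≤ Ny, (i = 0 ∨ i = Nx ∨ j = 0 ∨ j = Ny) →
    U n i j = P.sample h P.φ ((n : ℝ) * τ) i j
  step : ∀ n < M, ∀ i ∈ Set.Ioo 0 Nx, ∀ j ∈ Set.Ioo 0 Ny,
    P.factorOp s h (-(τ / 2)) Nx Ny (U (n + 1)) i j
      = P.factorOp s h (τ / 2) Nx Ny (U n) i j + P.schemeSource S s h τ Nx Ny n i j

end Problem

/-- The discrete `L²` norm over the interior grid points. -/
def gridNorm (h : ℝ) (Nx Ny : ℕ) (v : Grid) : ℝ :=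
  Real.sqrt (h ^ 2 * ∑ i ∈ Finset.Ico 1 Nx, ∑ j ∈ Finset.Ico 1 Ny, v i j ^ 2)

/-- Ranges of the orders `α`, `β` for each choice of shifts. -/
def Shifts.Admissible : Shifts → ℝ → Prop
  | .oneZero, α => 1 < α ∧ α < 2
  | .oneNegOne, α => (1 + Real.sqrt 73) / 6 < α ∧ α < 2

/-- Convergence of a scheme with order two in time and three in space, uniformly over all grids
with equal space steps in both directions. -/
def Problem.ConvergesTwoThree (P : Problem) (S : Scheme) (s : Shifts)
    (u : ℝ → ℝ → ℝ → ℝ) : Prop :=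
  ∃ C > 0, ∀ Nx Ny M : ℕ, 0 < Nx → 0 < Ny → 0 < M → ∀ h τ : ℝ,
    h = (P.b - P.a) / Nx → h = (P.d - P.c) / Ny → τ = P.T / M →
    ∀ U : ℕ → Grid, P.IsSchemeSolution S s h τ Nx Ny M U →
      ∀ n, 1 ≤ n → n ≤ M →
        gridNorm h Nx Ny (P.sample h u ((n : ℝ) * τ) - U n) ≤ C * (τ ^ 2 + h ^ 3)

end FracDiff

end

/-!
The proof is stability plus consistency: the residual left by the exact solution in one step of the
scheme is `O(τ (τ² + h³))`, and the error accumulated over `M = T / τ` steps is bounded by a constant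
times `M` times the residual.

*Stability* (`factorized_stability`). On interior grid functions, written as matrices `V`, a step is
`(Cx - r Ax) V' (Cy - r Ay)ᵀ = (Cx + r Ax) V (Cy + r Ay)ᵀ + R` with `r = τ / 2`. The compact matrices
`Cx`, `Cy` are symmetric with lower bound `1 - 4 c > 0`, which is what the admissible ranges of the
orders guarantee (`Shifts.Admissible.compactCoeff_lt`), and the difference matrices `Ax`, `Ay` are
dissipative. Conjugation with `√Cx`, `√Cy` makes the step a two-sided multiplication by Cayley
transforms of dissipative matrices, hence a contraction of the Frobenius norm. Dissipativity is proved
without Fourier analysis (`sum_mul_leftWSGD_nonpos`): the quadratic form is a combination of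
autocorrelation defects `ρ₀ - ρₘ ≥ 0`, with nonnegative weights except possibly `w₃`, which is
absorbed through `ρ₀ - ρ₂ ≤ 4 (ρ₀ - ρ₁)`.

*Consistency in space* (`exists_consistency_line`). A compactly supported `C⁷` function is a
superposition of exponentials `exp (z x)` over `Re z = 1` with density `O(|z|⁻⁷)`. On each exponential
the difference operator, the fractional derivative and the compact operator act by multiplication, and
the comparison reduces to the symbol estimate `|P(w) - w^α Q(w)| ≤ C |w|^(α + 3)` in a strip
`0 < Re w ≤ H` (`exists_norm_symbol_sub_le`); the value of `c^α` is the one that makes the Taylor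
expansions agree. The decay of the density is enough to integrate `|z|^(α + 3)` with an
explicit dependence on the seventh derivative. A cutoff beyond the far end, where a one-sided operator
does not look, and a reflection transfer the result to the interval (`exists_twoSided_consistency`).

*The equation on the closed cylinder.* For functions vanishing beyond the active sides the
Riemann-Liouville derivatives are fractional integrals of order `2 - α` of second derivatives
(`twoSided_riemannLiouville`). These are continuous up to the boundary, so the equation holds at the
boundary grid points, at which the compact operators evaluate the source
(`equation_on_closed_cylinder`), and they commute with differences in time, so that the Crank-Nicolson
error is `O(τ³)` per step.

*The splitting error* is `(τ² / 4) δx δy` applied to the increment of the solution over one step. It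
is `O(τ³)` because a difference operator is bounded by second derivatives alone
(`abs_leftWSGD_le`, `exists_abs_mixed_le`): two summations by parts turn the Grünwald coefficients of
order `α` into those of order `α - 2`, which are nonnegative with sums growing like `N ^ (2 - α)`. The
same bound, applied to the source, shows that the additional term of the corrected scheme is harmless.
-/

noncomputable section

namespace FracDiff

open Finset

/-! ### Grünwald coefficients -/

theorem grunwald_zero (α : ℝ) : grunwald α 0 = 1 := by simp [grunwald]

theorem grunwald_succ (α : ℝ) (k : ℕ) :
    grunwald α (k + 1) = grunwald α k * ((k - α) / (k + 1)) := by
  have h1 : (k.factorial : ℝ) ≠ 0 := by exact_mod_cast Nat.factorial_ne_zero k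
  have h2 : (k : ℝ) + 1 ≠ 0 := by positivity
  unfold grunwald
  rw [Ring.choose_eq_smul, Ring.choose_eq_smul, descPochhammer_succ_right,
    Polynomial.smeval_mul, Nat.factorial_succ]
  simp only [Polynomial.smeval_sub, Polynomial.smeval_X, Polynomial.smeval_natCast, pow_one,
    pow_zero, smul_eq_mul, nsmul_eq_mul]
  push_cast
  field_simp
  ring

theorem grunwald_one (α : ℝ) : grunwald α 1 = -α := by
  have := grunwald_succ α 0
  simpa [grunwald_zero] using this

theorem grunwald_two (α : ℝ) : grunwald α 2 = α * (α - 1) / 2 := by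
  rw [grunwald_succ, grunwald_one]; push_cast; ring

theorem grunwald_three (α : ℝ) : grunwald α 3 = α * (α - 1) * (2 - α) / 6 := by
  rw [grunwald_succ, grunwald_two]; push_cast; ring

/-- Pascal's rule for the Grünwald coefficients. -/
theorem grunwald_pascal (α : ℝ) (k : ℕ) :
    grunwald α (k + 1) = grunwald (α - 1) (k + 1) - grunwald (α - 1) k := by
  have h := Ring.choose_succ_succ (α - 1) k
  rw [sub_add_cancel] at h
  unfold grunwald
  rw [h, pow_succ]
  ring

theorem sum_grunwald (α : ℝ) (n : ℕ) :
    ∑ k ∈ range (n + 1), grunwald α k = grunwald (α - 1) n := by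
  induction n with
  | zero => simp [grunwald_zero]
  | succ n ih => rw [sum_range_succ, ih, grunwald_pascal]; ring

theorem grunwald_nonneg_of_nonpos {γ : ℝ} (hγ : γ ≤ 0) (k : ℕ) : 0 ≤ grunwald γ k := by
  induction k with
  | zero => simp [grunwald_zero]
  | succ k ih =>
    rw [grunwald_succ]
    exact mul_nonneg ih (div_nonneg (by have : (0 : ℝ) ≤ k := k.cast_nonneg
                                        linarith) (by positivity))

theorem grunwald_nonneg {α : ℝ} (h1 : 1 ≤ α) (h2 : α ≤ 2) (k : ℕ) (hk : 2 ≤ k) :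
    0 ≤ grunwald α k := by
  induction k, hk using Nat.le_induction with
  | base => rw [grunwald_two]; nlinarith
  | succ k hk ih =>
    rw [grunwald_succ]
    have : (2 : ℝ) ≤ k := by exact_mod_cast hk
    exact mul_nonneg ih (div_nonneg (by linarith) (by positivity))

theorem grunwald_nonpos {γ : ℝ} (h1 : 0 ≤ γ) (h2 : γ ≤ 1) (k : ℕ) (hk : 1 ≤ k) :
    grunwald γ k ≤ 0 := by
  induction k, hk using Nat.le_induction with
  | base => rw [grunwald_one]; linarith
  | succ k hk ih =>
    rw [grunwald_succ]
    have : (1 : ℝ) ≤ k := by exact_mod_cast hk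
    exact mul_nonpos_of_nonpos_of_nonneg ih (div_nonneg (by linarith) (by positivity))

theorem sum_grunwald_nonpos {α : ℝ} (h1 : 1 ≤ α) (h2 : α ≤ 2) (n : ℕ) (hn : 1 ≤ n) :
    ∑ k ∈ range (n + 1), grunwald α k ≤ 0 := by
  rw [sum_grunwald]
  exact grunwald_nonpos (by linarith) (by linarith) n hn

/-- The coefficients `g_m` of order `-1-γ`, `0 ≤ γ ≤ 1`, grow at most like `m ^ γ`. -/
theorem grunwald_le_rpow {γ : ℝ} (h0 : 0 ≤ γ) (h1 : γ ≤ 1) (m : ℕ) (hm : 1 ≤ m) :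
    grunwald (-1 - γ) m ≤ 2 * (m : ℝ) ^ γ := by
  induction m, hm using Nat.le_induction with
  | base => rw [grunwald_one]; simp; linarith
  | succ m hm ih =>
    have hm' : (1 : ℝ) ≤ m := by exact_mod_cast hm
    -- Bernoulli inequality for exponents in `[0, 1]`
    have hb : ((m : ℝ) / (m + 1)) ^ γ ≤ 1 - γ / (m + 1) := by
      have := rpow_one_add_le_one_add_mul_self (s := -1 / ((m : ℝ) + 1)) (p := γ)
        (by rw [le_div_iff₀ (by positivity)]; linarith) h0 h1
      have e1 : 1 + -1 / ((m : ℝ) + 1) = m / (m + 1) := by field_simp; ring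
      rw [e1] at this
      linarith [show γ * (-1 / ((m : ℝ) + 1)) = -(γ / (m + 1)) by ring]
    rw [Real.div_rpow (by positivity) (by positivity), div_le_iff₀ (by positivity)] at hb
    rw [grunwald_succ]
    have e2 : ((m : ℝ) - (-1 - γ)) / (m + 1) = 1 + γ / (m + 1) := by field_simp; ring
    rw [e2]
    have hx : 0 ≤ γ / ((m : ℝ) + 1) := by positivity
    set x := γ / ((m : ℝ) + 1)
    have hp : 0 ≤ ((m : ℝ) + 1) ^ γ := by positivity
    push_cast
    calc grunwald (-1 - γ) m * (1 + x) ≤ 2 * (m : ℝ) ^ γ * (1 + x) := by gcongr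
      _ ≤ 2 * ((1 - x) * ((m : ℝ) + 1) ^ γ) * (1 + x) := by gcongr
      _ = 2 * ((m : ℝ) + 1) ^ γ - 2 * ((m : ℝ) + 1) ^ γ * x ^ 2 := by ring
      _ ≤ 2 * ((m : ℝ) + 1) ^ γ := by nlinarith [mul_nonneg hp (sq_nonneg x)]

/-! ### Weights -/

/-- The coefficient of the unshifted Grünwald series in the weights. -/
def Shifts.lead : Shifts → ℝ → ℝ
  | .oneZero, α => α / 2
  | .oneNegOne, α => (2 + α) / 4

/-- The coefficient of the delayed Grünwald series in the weights. -/
def Shifts.tail : Shifts → ℝ → ℝ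
  | .oneZero, α => (2 - α) / 2
  | .oneNegOne, α => (2 - α) / 4

/-- The delay `p - q` between the two Grünwald series in the weights. -/
def Shifts.delay : Shifts → ℕ
  | .oneZero => 1
  | .oneNegOne => 2

theorem Shifts.one_le_delay (s : Shifts) : 1 ≤ s.delay := by cases s <;> simp [Shifts.delay]

theorem Shifts.delay_le_two (s : Shifts) : s.delay ≤ 2 := by cases s <;> simp [Shifts.delay]

theorem weight_eq (s : Shifts) (α : ℝ) (k : ℕ) :
    weight s α k = s.lead α * grunwald α k +
      if s.delay ≤ k then s.tail α * grunwald α (k - s.delay) else 0 := by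
  cases s
  · rcases k with _ | k <;> simp [weight, Shifts.lead, Shifts.tail, Shifts.delay]
  · rcases k with _ | _ | k <;> simp [weight, Shifts.lead, Shifts.tail, Shifts.delay]

theorem lead_nonneg (s : Shifts) {α : ℝ} (h1 : 1 ≤ α) : 0 ≤ s.lead α := by
  cases s <;> simp only [Shifts.lead] <;> linarith

theorem tail_nonneg (s : Shifts) {α : ℝ} (h2 : α ≤ 2) : 0 ≤ s.tail α := by
  cases s <;> simp only [Shifts.tail] <;> linarith

/-- Weighted sums split into two Grünwald sums. -/
theorem sum_weight_mul (s : Shifts) (α : ℝ) (f : ℕ → ℝ) (n : ℕ) (hn : s.delay ≤ n) :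
    ∑ k ∈ range n, weight s α k * f k =
      s.lead α * ∑ k ∈ range n, grunwald α k * f k
        + s.tail α * ∑ k ∈ range (n - s.delay), grunwald α k * f (k + s.delay) := by
  obtain ⟨m, rfl⟩ := Nat.exists_eq_add_of_le hn
  simp only [weight_eq, add_mul, sum_add_distrib, mul_sum, mul_assoc]
  congr 1
  rw [sum_range_add]
  have hz : ∑ x ∈ range s.delay,
      (if s.delay ≤ x then s.tail α * grunwald α (x - s.delay) else 0) * f x = 0 := by
    refine sum_eq_zero fun x hx => ?_
    rw [mem_range] at hx
    rw [if_neg (by omega), zero_mul]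
  rw [hz, zero_add, Nat.add_sub_cancel_left]
  refine sum_congr rfl fun x _ => ?_
  rw [if_pos (by omega), Nat.add_sub_cancel_left, add_comm s.delay x, mul_assoc]

theorem sum_weight_nonpos (s : Shifts) {α : ℝ} (h1 : 1 ≤ α) (h2 : α ≤ 2) (n : ℕ) :
    ∑ k ∈ range (n + 4), weight s α k ≤ 0 := by
  have h := sum_weight_mul s α (fun _ => 1) (n + 4) (by have := s.delay_le_two; omega)
  simp only [mul_one] at h
  rw [h]
  obtain ⟨m, hm⟩ : ∃ m, n + 4 - s.delay = m + 1 + 1 :=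
    ⟨n + 4 - s.delay - 2, by have := s.delay_le_two; omega⟩
  rw [hm]
  have a1 := sum_grunwald_nonpos h1 h2 (n + 3) (by omega)
  have a2 := sum_grunwald_nonpos h1 h2 (m + 1) (by omega)
  have := mul_nonpos_of_nonneg_of_nonpos (lead_nonneg s h1) a1
  have := mul_nonpos_of_nonneg_of_nonpos (tail_nonneg s h2) a2
  linarith

theorem weight_nonneg (s : Shifts) {α : ℝ} (h1 : 1 ≤ α) (h2 : α ≤ 2) (k : ℕ) :
    0 ≤ weight s α (k + 4) := by
  rw [weight_eq]
  have := s.delay_le_two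
  rw [if_pos (by omega)]
  exact add_nonneg (mul_nonneg (lead_nonneg s h1) (grunwald_nonneg h1 h2 _ (by omega)))
    (mul_nonneg (tail_nonneg s h2) (grunwald_nonneg h1 h2 _ (by omega)))

theorem weight_zero_add_two_nonneg (s : Shifts) {α : ℝ} (h1 : 1 ≤ α) :
    0 ≤ weight s α 0 + weight s α 2 := by
  cases s
  · simp only [weight, Nat.reduceAdd, grunwald_zero, grunwald_one, grunwald_two]
    nlinarith [mul_nonneg (sub_nonneg.2 h1) (sub_nonneg.2 h1),
      mul_nonneg (mul_nonneg (by linarith : 0 ≤ α) (sub_nonneg.2 h1)) (by linarith : 0 ≤ α + 2)]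
  · simp only [weight, Nat.reduceAdd, grunwald_zero, grunwald_two]
    nlinarith [mul_nonneg (mul_nonneg (by linarith : 0 ≤ α) (sub_nonneg.2 h1))
      (by linarith : 0 ≤ α + 2)]

/-- The weight `w₃` may be negative; this is the bound that keeps the quadratic form of the
weights nonpositive. -/
theorem weight_zero_add_two_add_three_nonneg (s : Shifts) {α : ℝ} (h1 : 1 ≤ α) (h2 : α ≤ 2) :
    0 ≤ weight s α 0 + weight s α 2 + 4 * weight s α 3 := by
  have p := mul_nonneg (by linarith : 0 ≤ α) (sub_nonneg.2 h1)
  have q := mul_nonneg (sub_nonneg.2 h2) (sub_nonneg.2 h1)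
  cases s
  · have h := weight_zero_add_two_nonneg .oneZero h1
    have h3 : 0 ≤ weight .oneZero α 3 := by
      simp only [weight, Nat.reduceAdd, grunwald_two, grunwald_three]
      nlinarith [mul_nonneg p (sub_nonneg.2 h2), mul_nonneg (mul_nonneg p (sub_nonneg.2 h2))
        (by linarith : 0 ≤ α)]
    linarith
  · simp only [weight, Nat.reduceAdd, grunwald_zero, grunwald_one, grunwald_two, grunwald_three]
    nlinarith [mul_nonneg p (sub_nonneg.2 h2), mul_nonneg (mul_nonneg p (sub_nonneg.2 h2))
        (by linarith : 0 ≤ α), mul_nonneg p p, mul_nonneg q q, mul_nonneg p q,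
        mul_nonneg p (sub_nonneg.2 h1), mul_nonneg q (sub_nonneg.2 h1),
        mul_nonneg q (sub_nonneg.2 h2)]

/-! ### Boundedness of the difference operators -/

/-- Backward difference of a sequence extended by zero to negative indices. -/
def backwardDiff (v : ℕ → ℝ) : ℕ → ℝ
  | 0 => v 0
  | j + 1 => v (j + 1) - v j

/-- Summation by parts: one difference is moved from the coefficients to the sequence. -/
theorem sum_grunwald_mul_eq (α : ℝ) (v : ℕ → ℝ) (m : ℕ) :
    ∑ k ∈ range (m + 1), grunwald α k * v (m - k) =
      ∑ k ∈ range (m + 1), grunwald (α - 1) k * backwardDiff v (m - k) := by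
  have h1 : ∑ k ∈ range (m + 1), grunwald (α - 1) k * backwardDiff v (m - k) =
      ∑ k ∈ range (m + 1), grunwald (α - 1) k * v (m - k)
        - ∑ k ∈ range m, grunwald (α - 1) k * v (m - (k + 1)) := by
    rw [sum_range_succ, sum_range_succ _ m, Nat.sub_self, add_sub_right_comm, ← sum_sub_distrib]
    congr 1
    refine sum_congr rfl fun k hk => ?_
    rw [mem_range] at hk
    obtain ⟨j, rfl⟩ := Nat.exists_eq_add_of_lt hk
    rw [show k + j + 1 - k = j + 1 by omega, show k + j + 1 - (k + 1) = j by omega]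
    simp only [backwardDiff]
    ring
  rw [h1, sum_range_succ', sum_range_succ' _ m, grunwald_zero, grunwald_zero]
  simp only [grunwald_pascal α, sub_mul, sum_sub_distrib]
  ring

/-- Unshifted Grünwald sums are bounded by second differences. -/
theorem abs_sum_grunwald_mul_le {α D : ℝ} (h1 : 1 ≤ α) (h2 : α ≤ 2) (v : ℕ → ℝ) (N : ℕ)
    (hv0 : v 0 = 0) (hv1 : |v 1| ≤ D)
    (hv : ∀ j, j + 2 ≤ N → |v (j + 2) - 2 * v (j + 1) + v j| ≤ D) (m : ℕ) (hm : m ≤ N) :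
    |∑ k ∈ range (m + 1), grunwald α k * v (m - k)| ≤ 2 * (N : ℝ) ^ (2 - α) * D := by
  have hD : 0 ≤ D := (abs_nonneg _).trans hv1
  rcases Nat.eq_zero_or_pos m with rfl | hm0
  · simp only [zero_add, range_one, sum_singleton, Nat.sub_zero, hv0, mul_zero, abs_zero]
    positivity
  -- order `α` on `v` becomes order `α - 2` on second differences, and those coefficients are nonnegative
  rw [sum_grunwald_mul_eq, sum_grunwald_mul_eq]
  have hd : ∀ j ≤ N, |backwardDiff (backwardDiff v) j| ≤ D := by
    intro j hj
    rcases j with _ | _ | j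
    · simpa [backwardDiff, hv0] using hD
    · simpa [backwardDiff, hv0] using hv1
    · simp only [backwardDiff]
      rw [show v (j + 1 + 1) - v (j + 1) - (v (j + 1) - v j)
        = v (j + 2) - 2 * v (j + 1) + v j by ring]
      exact hv j hj
  have hg : ∀ k, 0 ≤ grunwald (α - 1 - 1) k := grunwald_nonneg_of_nonpos (by linarith)
  calc |∑ k ∈ range (m + 1), grunwald (α - 1 - 1) k * backwardDiff (backwardDiff v) (m - k)|
      ≤ ∑ k ∈ range (m + 1), |grunwald (α - 1 - 1) k * backwardDiff (backwardDiff v) (m - k)| :=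
        abs_sum_le_sum_abs _ _
    _ ≤ ∑ k ∈ range (m + 1), grunwald (α - 1 - 1) k * D := by
        refine sum_le_sum fun k _ => ?_
        rw [abs_mul, abs_of_nonneg (hg k)]
        exact mul_le_mul_of_nonneg_left (hd _ (by omega)) (hg k)
    _ = grunwald (-1 - (2 - α)) m * D := by
        rw [← sum_mul, sum_grunwald]; congr 2; ring
    _ ≤ 2 * (m : ℝ) ^ (2 - α) * D := by
        gcongr
        exact grunwald_le_rpow (by linarith) (by linarith) m hm0
    _ ≤ 2 * (N : ℝ) ^ (2 - α) * D := by
        have : (m : ℝ) ≤ N := by exact_mod_cast hm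
        gcongr

theorem lead_add_tail (s : Shifts) {α : ℝ} : s.lead α + s.tail α = 1 := by
  cases s <;> simp only [Shifts.lead, Shifts.tail] <;> ring

/-- A left difference of order `α` is bounded by second differences, provided that the sequence
extended by zero also has small second differences across the left end. -/
theorem abs_leftWSGD_le (s : Shifts) {α D h : ℝ} (h1 : 1 ≤ α) (h2 : α ≤ 2) (hh : 0 < h)
    (v : ℕ → ℝ) (N : ℕ) (hv0 : v 0 = 0) (hv1 : |v 1| ≤ D)
    (hv : ∀ j, j + 2 ≤ N → |v (j + 2) - 2 * v (j + 1) + v j| ≤ D) (i : ℕ) (hi1 : 1 ≤ i)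
    (hi : i < N) :
    |leftWSGD s α h v i| ≤ 2 * (N * h) ^ (2 - α) * (D / h ^ 2) := by
  have hd := s.delay_le_two
  have hd1 := s.one_le_delay
  have key := abs_sum_grunwald_mul_le h1 h2 v N hv0 hv1 hv
  unfold leftWSGD
  rw [sum_weight_mul s α (fun k => v (i + 1 - k)) (i + 2) (by omega)]
  have e : ∑ k ∈ range (i + 2 - s.delay), grunwald α k * v (i + 1 - (k + s.delay)) =
      ∑ k ∈ range (i + 1 - s.delay + 1), grunwald α k * v (i + 1 - s.delay - k) := by
    rw [show i + 1 - s.delay + 1 = i + 2 - s.delay by omega]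
    exact sum_congr rfl fun k _ => by rw [show i + 1 - (k + s.delay) = i + 1 - s.delay - k by omega]
  rw [e]
  have a1 := key (i + 1) (by omega)
  have a2 := key (i + 1 - s.delay) (by omega)
  rw [show i + 1 + 1 = i + 2 from rfl] at a1
  set X := ∑ k ∈ range (i + 2), grunwald α k * v (i + 1 - k)
  set Y := ∑ k ∈ range (i + 1 - s.delay + 1), grunwald α k * v (i + 1 - s.delay - k)
  have hl := lead_nonneg s h1
  have ht := tail_nonneg s h2
  have hB : |s.lead α * X + s.tail α * Y| ≤ 2 * (N : ℝ) ^ (2 - α) * D := by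
    calc |s.lead α * X + s.tail α * Y| ≤ s.lead α * |X| + s.tail α * |Y| := by
          refine (abs_add_le _ _).trans ?_
          rw [abs_mul, abs_mul, abs_of_nonneg hl, abs_of_nonneg ht]
      _ ≤ s.lead α * (2 * (N : ℝ) ^ (2 - α) * D) + s.tail α * (2 * (N : ℝ) ^ (2 - α) * D) := by
          gcongr
      _ = 2 * (N : ℝ) ^ (2 - α) * D := by rw [← add_mul, lead_add_tail, one_mul]
  have hpos : 0 < h ^ α := Real.rpow_pos_of_pos hh _
  rw [abs_mul, abs_of_pos (by positivity : 0 < 1 / h ^ α), Real.mul_rpow (by positivity) hh.le,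
    Real.rpow_sub hh, Real.rpow_two]
  calc 1 / h ^ α * |s.lead α * X + s.tail α * Y| ≤ 1 / h ^ α * (2 * (N : ℝ) ^ (2 - α) * D) := by
        gcongr
    _ = _ := by field_simp

/-- Reflecting the grid turns right differences into left ones. -/
theorem rightWSGD_eq_leftWSGD (s : Shifts) (α h : ℝ) (N : ℕ) (v : ℕ → ℝ) (i : ℕ) (hi1 : 1 ≤ i)
    (hi : i < N) :
    rightWSGD s α h N v i = leftWSGD s α h (fun m => v (N - m)) (N - i) := by
  unfold rightWSGD leftWSGD
  congr 1
  refine sum_congr rfl fun k hk => ?_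
  rw [mem_range] at hk
  simp only [show N - (N - i + 1 - k) = i + k - 1 by omega]

/-! ### Quadratic forms of Toeplitz type -/

/-- Autocorrelation of a two-sided sequence. -/
def autocorr (v : ℤ → ℝ) (m : ℤ) : ℝ := ∑' i, v i * v (i + m)

section

variable {v : ℤ → ℝ}

theorem summable_mul_shift (hv : v.support.Finite) (m n : ℤ) :
    Summable fun i => v (i + n) * v (i + m) := by
  refine summable_of_hasFiniteSupport ((hv.image (fun i => i - n)).subset fun i hi => ?_)
  rw [Function.mem_support] at hi
  exact ⟨i + n, left_ne_zero_of_mul hi, by simp⟩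

theorem tsum_mul_shift (n m : ℤ) : ∑' i, v (i + n) * v (i + m) = autocorr v (m - n) := by
  unfold autocorr
  rw [← (Equiv.addRight n).tsum_eq fun i => v i * v (i + (m - n))]
  refine tsum_congr fun i => ?_
  simp only [Equiv.coe_addRight]
  congr 2
  ring

theorem autocorr_neg (m : ℤ) : autocorr v (-m) = autocorr v m := by
  have := tsum_mul_shift (v := v) m 0
  simp only [zero_sub, add_zero] at this
  rw [← this]
  exact tsum_congr fun i => mul_comm _ _

theorem tsum_sub_shift_sq (hv : v.support.Finite) (n m : ℤ) :
    ∑' i, (v (i + n) - v (i + m)) ^ 2 = 2 * (autocorr v 0 - autocorr v (m - n)) := by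
  have e : ∀ i, (v (i + n) - v (i + m)) ^ 2
      = v (i + n) * v (i + n) + v (i + m) * v (i + m) - 2 * (v (i + n) * v (i + m)) :=
    fun i => by ring
  simp only [e]
  rw [((summable_mul_shift hv n n).add (summable_mul_shift hv m m)).tsum_sub
    ((summable_mul_shift hv m n).mul_left 2),
    (summable_mul_shift hv n n).tsum_add (summable_mul_shift hv m m), tsum_mul_left,
    tsum_mul_shift, tsum_mul_shift, tsum_mul_shift]
  simp only [sub_self]
  ring

theorem autocorr_le (hv : v.support.Finite) (m : ℤ) : autocorr v m ≤ autocorr v 0 := by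
  have h := tsum_sub_shift_sq hv 0 m
  have : 0 ≤ ∑' i, (v (i + 0) - v (i + m)) ^ 2 := tsum_nonneg fun i => sq_nonneg _
  rw [sub_zero] at h
  linarith

theorem neg_autocorr_le (hv : v.support.Finite) (m : ℤ) : -autocorr v m ≤ autocorr v 0 := by
  have e : ∀ i, (v (i + 0) + v (i + m)) ^ 2
      = v (i + 0) * v (i + 0) + v (i + m) * v (i + m) + 2 * (v (i + 0) * v (i + m)) :=
    fun i => by ring
  have h : 0 ≤ ∑' i, (v (i + 0) + v (i + m)) ^ 2 := tsum_nonneg fun i => sq_nonneg _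
  simp only [e] at h
  rw [((summable_mul_shift hv 0 0).add (summable_mul_shift hv m m)).tsum_add
    ((summable_mul_shift hv m 0).mul_left 2),
    (summable_mul_shift hv 0 0).tsum_add (summable_mul_shift hv m m), tsum_mul_left,
    tsum_mul_shift, tsum_mul_shift, tsum_mul_shift] at h
  simp only [sub_self, sub_zero] at h
  linarith

theorem summable_sub_shift_sq (hv : v.support.Finite) (n m : ℤ) :
    Summable fun i => (v (i + n) - v (i + m)) ^ 2 := by
  have e : (fun i => (v (i + n) - v (i + m)) ^ 2)
      = fun i => v (i + n) * v (i + n) + v (i + m) * v (i + m) - 2 * (v (i + n) * v (i + m)) :=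
    funext fun i => by ring
  rw [e]
  exact ((summable_mul_shift hv n n).add (summable_mul_shift hv m m)).sub
    ((summable_mul_shift hv m n).mul_left 2)

/-- Differences over two steps are controlled by differences over one step. -/
theorem autocorr_sub_two_le (hv : v.support.Finite) :
    autocorr v 0 - autocorr v 2 ≤ 4 * (autocorr v 0 - autocorr v 1) := by
  have h02 := tsum_sub_shift_sq hv 0 2
  have h01 := tsum_sub_shift_sq hv 0 1
  have h12 := tsum_sub_shift_sq hv 1 2
  norm_num only at h02 h01 h12
  have h : ∑' i, (v (i + 0) - v (i + 2)) ^ 2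
      ≤ ∑' i, (2 * (v (i + 0) - v (i + 1)) ^ 2 + 2 * (v (i + 1) - v (i + 2)) ^ 2) := by
    refine Summable.tsum_le_tsum (fun i => ?_) (summable_sub_shift_sq hv 0 2)
      (((summable_sub_shift_sq hv 0 1).mul_left 2).add ((summable_sub_shift_sq hv 1 2).mul_left 2))
    nlinarith [sq_nonneg (v (i + 0) - 2 * v (i + 1) + v (i + 2))]
  rw [((summable_sub_shift_sq hv 0 1).mul_left 2).tsum_add
    ((summable_sub_shift_sq hv 1 2).mul_left 2), tsum_mul_left, tsum_mul_left] at h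
  simp only [add_zero] at h h01 h02 h12
  linarith

end

/-- The two-sided extension by zero of a sequence with `v 0 = 0`. -/
def zeroExtend (v : ℕ → ℝ) : ℤ → ℝ := fun i => v i.toNat

theorem zeroExtend_support_subset {v : ℕ → ℝ} {N : ℕ} (hv0 : v 0 = 0) (hv : ∀ i, N ≤ i → v i = 0) :
    (zeroExtend v).support ⊆ ((Ico 1 N).map Nat.castEmbedding : Finset ℤ) := by
  intro i hi
  rw [Function.mem_support, zeroExtend] at hi
  simp only [coe_map, Set.mem_image, coe_Ico, Set.mem_Ico]
  refine ⟨i.toNat, ⟨?_, ?_⟩, ?_⟩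
  · by_contra h
    exact hi (by rw [show i.toNat = 0 by omega, hv0])
  · by_contra h
    exact hi (hv _ (by omega))
  · have : i.toNat ≠ 0 := fun h => hi (by rw [h, hv0])
    simp; omega

theorem zeroExtend_support_finite {v : ℕ → ℝ} {N : ℕ} (hv0 : v 0 = 0)
    (hv : ∀ i, N ≤ i → v i = 0) : (zeroExtend v).support.Finite :=
  (Finset.finite_toSet _).subset (zeroExtend_support_subset hv0 hv)

theorem sum_mul_zeroExtend {v : ℕ → ℝ} {N : ℕ} (hv0 : v 0 = 0) (hv : ∀ i, N ≤ i → v i = 0)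
    (m : ℤ) : ∑ i ∈ Ico 1 N, v i * zeroExtend v (i + m) = autocorr (zeroExtend v) m := by
  unfold autocorr
  rw [tsum_eq_sum (s := (Ico 1 N).map Nat.castEmbedding), sum_map]
  · exact sum_congr rfl fun i _ => by simp [zeroExtend]
  · intro i hi
    have : zeroExtend v i = 0 := by
      by_contra h
      exact hi (by exact_mod_cast zeroExtend_support_subset hv0 hv h)
    rw [this, zero_mul]

/-- The quadratic form of the weights is nonpositive. -/
theorem sum_mul_leftWSGD_nonpos (s : Shifts) {α h : ℝ} (h1 : 1 ≤ α) (h2 : α ≤ 2) (hh : 0 < h)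
    {v : ℕ → ℝ} {N : ℕ} (hv0 : v 0 = 0) (hv : ∀ i, N ≤ i → v i = 0) :
    ∑ i ∈ Ico 1 N, v i * leftWSGD s α h v i ≤ 0 := by
  set V := zeroExtend v with hV
  have hfin : V.support.Finite := zeroExtend_support_finite hv0 hv
  have e1 : ∑ i ∈ Ico 1 N, v i * leftWSGD s α h v i
      = 1 / h ^ α * ∑ k ∈ range (N + 4), weight s α k * autocorr V (1 - k) := by
    have : ∀ k : ℕ, weight s α k * autocorr V (1 - k)
        = ∑ i ∈ Ico 1 N, v i * (weight s α k * V (i + (1 - k))) := by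
      intro k
      rw [← sum_mul_zeroExtend hv0 hv, mul_sum]
      exact sum_congr rfl fun i _ => by ring
    simp only [this]
    rw [sum_comm, mul_sum]
    refine sum_congr rfl fun i hi => ?_
    rw [mem_Ico] at hi
    unfold leftWSGD
    rw [mul_left_comm]
    congr 1
    rw [mul_sum]
    symm
    rw [← sum_subset (range_subset_range.2 (by omega : i + 2 ≤ N + 4))]
    · refine sum_congr rfl fun k hk => ?_
      rw [mem_range] at hk
      rw [hV, zeroExtend, show ((i : ℤ) + (1 - k)).toNat = i + 1 - k by omega]
    · intro k _ hk
      rw [mem_range] at hk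
      rw [hV, zeroExtend, show ((i : ℤ) + (1 - k)).toNat = 0 by omega, hv0, mul_zero, mul_zero]
  -- the weights `w₀` and `w₂` belong to the same autocorrelation, at distance one
  have e2 : ∑ k ∈ range (N + 4), weight s α k * autocorr V (1 - k)
      = (∑ k ∈ range (N + 4), weight s α k) * autocorr V 0
        - (weight s α 0 + weight s α 2) * (autocorr V 0 - autocorr V 1)
        - weight s α 3 * (autocorr V 0 - autocorr V 2)
        - ∑ k ∈ range N, weight s α (k + 4) * (autocorr V 0 - autocorr V (k + 3)) := by
    have a1 : autocorr V (-1) = autocorr V 1 := autocorr_neg 1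
    have a2 : autocorr V (-2) = autocorr V 2 := autocorr_neg 2
    have a3 : ∀ k : ℕ, autocorr V (1 - ((k + 4 : ℕ) : ℤ)) = autocorr V (k + 3) := by
      intro k
      rw [← autocorr_neg]
      congr 1
    rw [add_comm N 4, sum_range_add, sum_range_add]
    simp only [add_comm 4, a3, mul_sub, sum_sub_distrib, ← sum_mul]
    simp only [sum_range_succ, range_zero, sum_empty]
    norm_num only
    rw [a1, a2]
    ring
  have hR0 : 0 ≤ autocorr V 0 := tsum_nonneg fun i => by
    rw [add_zero]; exact mul_self_nonneg _
  have hD1 := sub_nonneg.2 (autocorr_le hfin 1)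
  have hD2 := sub_nonneg.2 (autocorr_le hfin 2)
  have hD := autocorr_sub_two_le hfin
  have b1 := mul_nonpos_of_nonpos_of_nonneg (sum_weight_nonpos s h1 h2 N) hR0
  have b2 : 0 ≤ ∑ k ∈ range N, weight s α (k + 4) * (autocorr V 0 - autocorr V (k + 3)) :=
    sum_nonneg fun k _ => mul_nonneg (weight_nonneg s h1 h2 k) (sub_nonneg.2 (autocorr_le hfin _))
  have b3 : 0 ≤ (weight s α 0 + weight s α 2) * (autocorr V 0 - autocorr V 1)
      + weight s α 3 * (autocorr V 0 - autocorr V 2) := by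
    have w0 := weight_zero_add_two_nonneg s h1
    have w3 := weight_zero_add_two_add_three_nonneg s h1 h2
    rcases le_total 0 (weight s α 3) with h3 | h3
    · positivity
    -- a negative `w₃` is absorbed, since the defect at distance two is at most four times that at
    -- distance one
    · nlinarith
  rw [e1, e2]
  exact mul_nonpos_of_nonneg_of_nonpos (by positivity) (by linarith)

/-- The compact operator is positive definite as long as its coefficient lies in `[0, 1/4)`. -/
theorem sum_mul_compactOp_ge (s : Shifts) {α h : ℝ} (hc : 0 ≤ compactCoeff s α) (hh : 0 < h)
    {v : ℕ → ℝ} {N : ℕ} (hv0 : v 0 = 0) (hv : ∀ i, N ≤ i → v i = 0) :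
    (1 - 4 * compactCoeff s α) * ∑ i ∈ Ico 1 N, v i ^ 2
      ≤ ∑ i ∈ Ico 1 N, v i * compactOp s α h v i := by
  have hfin := zeroExtend_support_finite hv0 hv
  have e0 := sum_mul_zeroExtend hv0 hv 0
  have e1 := sum_mul_zeroExtend hv0 hv 1
  have e2 := sum_mul_zeroExtend hv0 hv (-1)
  rw [autocorr_neg] at e2
  have s0 : ∑ i ∈ Ico 1 N, v i ^ 2 = autocorr (zeroExtend v) 0 := by
    rw [← e0]
    exact sum_congr rfl fun i _ => by simp [zeroExtend]; ring
  have s1 : ∑ i ∈ Ico 1 N, v i * compactOp s α h v i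
      = autocorr (zeroExtend v) 0 + compactCoeff s α *
        (autocorr (zeroExtend v) 1 - 2 * autocorr (zeroExtend v) 0 + autocorr (zeroExtend v) 1) := by
    rw [← s0]
    nth_rewrite 1 [← e2]
    rw [← e1, mul_sum, ← sum_sub_distrib, ← sum_add_distrib, mul_sum, ← sum_add_distrib]
    refine sum_congr rfl fun i hi => ?_
    rw [mem_Ico] at hi
    unfold compactOp centralDiff zeroExtend
    rw [show ((i : ℤ) + -1).toNat = i - 1 by omega, show ((i : ℤ) + 1).toNat = i + 1 by omega]
    field_simp
  rw [s0, s1]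
  nlinarith [neg_autocorr_le hfin 1]

/-! ### Stability of factorized Crank-Nicolson steps -/

section Stability

open Matrix

attribute [local instance] Matrix.frobeniusNormedAddCommGroup

variable {ι κ : Type*} [Fintype ι] [Fintype κ]

theorem frobenius_norm_sq (X : Matrix ι κ ℝ) : ‖X‖ ^ 2 = ∑ i, ∑ j, X i j ^ 2 := by
  rw [Matrix.frobenius_norm_def, ← Real.sqrt_eq_rpow, Real.sq_sqrt (by positivity)]
  simp

theorem frobenius_norm_mul_le {A : Matrix ι ι ℝ} {c : ℝ} (hc : 0 ≤ c)
    (hA : ∀ x, (A *ᵥ x) ⬝ᵥ (A *ᵥ x) ≤ c ^ 2 * (x ⬝ᵥ x)) (X : Matrix ι κ ℝ) :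
    ‖A * X‖ ≤ c * ‖X‖ := by
  refine abs_le_of_sq_le_sq' ?_ (by positivity) |>.2
  rw [mul_pow, frobenius_norm_sq, frobenius_norm_sq, sum_comm, sum_comm (γ := ι), mul_sum]
  refine sum_le_sum fun j _ => ?_
  have := hA fun i => X i j
  simpa [dotProduct, sq, Matrix.mul_apply, mulVec] using this

theorem frobenius_norm_mul_transpose_le {A : Matrix κ κ ℝ} {c : ℝ} (hc : 0 ≤ c)
    (hA : ∀ x, (A *ᵥ x) ⬝ᵥ (A *ᵥ x) ≤ c ^ 2 * (x ⬝ᵥ x)) (X : Matrix ι κ ℝ) :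
    ‖X * Aᵀ‖ ≤ c * ‖X‖ := by
  have := frobenius_norm_mul_le hc hA Xᵀ
  rwa [Matrix.frobenius_norm_transpose, ← Matrix.frobenius_norm_transpose, Matrix.transpose_mul,
    Matrix.transpose_transpose] at this

theorem conjugate_factors {T S C K P : Matrix ι ι ℝ} {T' S' D K' P' : Matrix κ κ ℝ}
    {V : Matrix ι κ ℝ} (h : T * C = K * S) (h' : Dᵀ * T' = S' * K'ᵀ) :
    P * (T * (C * V * Dᵀ) * T') * P'ᵀ = P * K * (S * V * S') * (P' * K')ᵀ := by
  have e : P * (T * (C * V * Dᵀ) * T') * P'ᵀ = P * (T * C) * V * (Dᵀ * T') * P'ᵀ := by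
    simp only [Matrix.mul_assoc]
  rw [e, h, h', Matrix.transpose_mul]
  simp only [Matrix.mul_assoc]

variable [DecidableEq ι] [DecidableEq κ]

/-- A symmetric matrix bounded below by `γ` has a symmetric square root, whose inverse `T` is bounded by
`1 / √γ`. -/
theorem exists_symmetric_sqrt {C : Matrix ι ι ℝ} {γ : ℝ} (hγ : 0 < γ) (hCs : Cᵀ = C)
    (hC : ∀ x, γ * (x ⬝ᵥ x) ≤ x ⬝ᵥ (C *ᵥ x)) :
    ∃ S T : Matrix ι ι ℝ, Sᵀ = S ∧ Tᵀ = T ∧ S * T = 1 ∧ T * S = 1 ∧ S * S = C ∧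
      ∀ x, (T *ᵥ x) ⬝ᵥ (T *ᵥ x) ≤ ((√γ)⁻¹) ^ 2 * (x ⬝ᵥ x) := by
  open scoped MatrixOrder in
  have hpd : C.PosDef := by
    refine Matrix.PosDef.of_dotProduct_mulVec_pos ?_ fun x hx => ?_
    · rw [Matrix.IsHermitian, Matrix.conjTranspose_eq_transpose_of_trivial, hCs]
    · rw [star_trivial]
      refine lt_of_lt_of_le (mul_pos hγ ?_) (hC x)
      exact lt_of_le_of_ne (Finset.sum_nonneg fun i _ => mul_self_nonneg _)
        (Ne.symm (by rwa [Ne, dotProduct_self_eq_zero]))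
  open scoped MatrixOrder in
  have hnn : 0 ≤ C := Matrix.nonneg_iff_posSemidef.2 hpd.posSemidef
  open scoped MatrixOrder in
  obtain ⟨S, hS, hSS⟩ : ∃ S : Matrix ι ι ℝ, Sᵀ = S ∧ S * S = C := by
    refine ⟨CFC.sqrt C, ?_, CFC.sqrt_mul_sqrt_self C⟩
    have := (Matrix.nonneg_iff_posSemidef.1 (CFC.sqrt_nonneg C)).isHermitian
    rwa [Matrix.IsHermitian, Matrix.conjTranspose_eq_transpose_of_trivial] at this
  have hdet : IsUnit S.det := by
    have h1 := (Matrix.isUnit_iff_isUnit_det C).1 hpd.isUnit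
    rw [← hSS, Matrix.det_mul] at h1
    exact isUnit_of_mul_isUnit_left h1
  refine ⟨S, S⁻¹, hS, ?_, Matrix.mul_nonsing_inv _ hdet, Matrix.nonsing_inv_mul _ hdet, hSS, ?_⟩
  · rw [Matrix.transpose_nonsing_inv, hS]
  · intro x
    have h := hC (S⁻¹ *ᵥ x)
    have e : S⁻¹ *ᵥ x ⬝ᵥ (C *ᵥ (S⁻¹ *ᵥ x)) = x ⬝ᵥ x := by
      rw [← hSS, ← Matrix.mulVec_mulVec, Matrix.dotProduct_mulVec, ← Matrix.mulVec_transpose, hS,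
        Matrix.mulVec_mulVec, Matrix.mul_nonsing_inv _ hdet, Matrix.one_mulVec]
    rw [e] at h
    rw [inv_pow, Real.sq_sqrt hγ.le, inv_mul_eq_div, le_div_iff₀ hγ, mul_comm]
    exact h

/-- For a dissipative `B` and `r ≥ 0`, the inverse of `1 - r B` and the Cayley transform
`(1 - r B)⁻¹ (1 + r B)` are contractions. -/
theorem exists_cayley {B : Matrix ι ι ℝ} (hB : ∀ x, x ⬝ᵥ (B *ᵥ x) ≤ 0) {r : ℝ} (hr : 0 ≤ r) :
    ∃ P : Matrix ι ι ℝ, P * (1 - r • B) = 1 ∧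
      (∀ x, (P *ᵥ x) ⬝ᵥ (P *ᵥ x) ≤ 1 ^ 2 * (x ⬝ᵥ x)) ∧
      ∀ x, ((P * (1 + r • B)) *ᵥ x) ⬝ᵥ ((P * (1 + r • B)) *ᵥ x) ≤ 1 ^ 2 * (x ⬝ᵥ x) := by
  have e1 : ∀ x, ((1 - r • B) *ᵥ x) ⬝ᵥ ((1 - r • B) *ᵥ x)
      = x ⬝ᵥ x - 2 * r * (x ⬝ᵥ (B *ᵥ x)) + r ^ 2 * ((B *ᵥ x) ⬝ᵥ (B *ᵥ x)) := by
    intro x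
    rw [Matrix.sub_mulVec, Matrix.one_mulVec, Matrix.smul_mulVec]
    simp only [sub_dotProduct, dotProduct_sub, smul_dotProduct, dotProduct_smul, smul_eq_mul,
      dotProduct_comm (B *ᵥ x) x]
    ring
  have e2 : ∀ x, ((1 + r • B) *ᵥ x) ⬝ᵥ ((1 + r • B) *ᵥ x)
      = x ⬝ᵥ x + 2 * r * (x ⬝ᵥ (B *ᵥ x)) + r ^ 2 * ((B *ᵥ x) ⬝ᵥ (B *ᵥ x)) := by
    intro x
    rw [Matrix.add_mulVec, Matrix.one_mulVec, Matrix.smul_mulVec]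
    simp only [add_dotProduct, dotProduct_add, smul_dotProduct, dotProduct_smul, smul_eq_mul,
      dotProduct_comm (B *ᵥ x) x]
    ring
  have hsq : ∀ x : ι → ℝ, 0 ≤ x ⬝ᵥ x := fun x => Finset.sum_nonneg fun i _ => mul_self_nonneg _
  -- `1 - r B` expands lengths, which gives injectivity and the bound of the inverse
  have hle : ∀ x, x ⬝ᵥ x ≤ ((1 - r • B) *ᵥ x) ⬝ᵥ ((1 - r • B) *ᵥ x) := by
    intro x
    rw [e1]
    nlinarith [mul_nonneg hr (neg_nonneg.2 (hB x)), mul_nonneg (sq_nonneg r) (hsq (B *ᵥ x))]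
  have hinj : Function.Injective (1 - r • B).mulVec := by
    intro x y hxy
    have h := hle (x - y)
    rw [Matrix.mulVec_sub, hxy, sub_self, zero_dotProduct] at h
    exact sub_eq_zero.1 (dotProduct_self_eq_zero.1 (le_antisymm h (hsq _)))
  have hdet : IsUnit (1 - r • B).det :=
    (Matrix.isUnit_iff_isUnit_det _).1 (Matrix.mulVec_injective_iff_isUnit.1 hinj)
  refine ⟨(1 - r • B)⁻¹, Matrix.nonsing_inv_mul _ hdet, fun x => ?_, fun x => ?_⟩
  · have h := hle ((1 - r • B)⁻¹ *ᵥ x)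
    rw [Matrix.mulVec_mulVec, Matrix.mul_nonsing_inv _ hdet, Matrix.one_mulVec] at h
    simpa using h
  · have hcomm : (1 - r • B)⁻¹ * (1 + r • B) = (1 + r • B) * (1 - r • B)⁻¹ := by
      have h : (1 + r • B) * (1 - r • B) = (1 - r • B) * (1 + r • B) := by
        simp only [add_mul, mul_sub, sub_mul, mul_add, one_mul, mul_one]
        abel
      calc (1 - r • B)⁻¹ * (1 + r • B)
          = (1 - r • B)⁻¹ * ((1 + r • B) * (1 - r • B)) * (1 - r • B)⁻¹ := by
            rw [mul_assoc, mul_assoc, Matrix.mul_nonsing_inv _ hdet, mul_one]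
        _ = (1 + r • B) * (1 - r • B)⁻¹ := by
            rw [h, ← mul_assoc, Matrix.nonsing_inv_mul _ hdet, one_mul]
    have h1 := e1 ((1 - r • B)⁻¹ *ᵥ x)
    have h2 := e2 ((1 - r • B)⁻¹ *ᵥ x)
    rw [Matrix.mulVec_mulVec, Matrix.mul_nonsing_inv _ hdet, Matrix.one_mulVec] at h1
    rw [Matrix.mulVec_mulVec, ← hcomm] at h2
    nlinarith [mul_nonneg hr (neg_nonneg.2 (hB ((1 - r • B)⁻¹ *ᵥ x)))]

/-- Unconditional stability of the factorized scheme
`(Cx - r Ax) V' (Cy - r Ay)ᵀ = (Cx + r Ax) V (Cy + r Ay)ᵀ + R` with positive definite `Cx`, `Cy`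
and dissipative `Ax`, `Ay`. Neither pair is assumed to commute: conjugating with the square roots
of `Cx` and `Cy` turns the step into a product of Cayley transforms, which are contractions. -/
theorem factorized_stability {Cx Ax : Matrix ι ι ℝ} {Cy Ay : Matrix κ κ ℝ} {γx γy r ρ : ℝ}
    (hγx : 0 < γx) (hγy : 0 < γy) (hr : 0 ≤ r) (hCxs : Cxᵀ = Cx) (hCys : Cyᵀ = Cy)
    (hCx : ∀ x, γx * (x ⬝ᵥ x) ≤ x ⬝ᵥ (Cx *ᵥ x)) (hCy : ∀ x, γy * (x ⬝ᵥ x) ≤ x ⬝ᵥ (Cy *ᵥ x))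
    (hAx : ∀ x, x ⬝ᵥ (Ax *ᵥ x) ≤ 0) (hAy : ∀ x, x ⬝ᵥ (Ay *ᵥ x) ≤ 0) (M : ℕ)
    (V R : ℕ → Matrix ι κ ℝ) (hV0 : V 0 = 0) (hR : ∀ n < M, ‖R n‖ ≤ ρ)
    (hstep : ∀ n < M, (Cx - r • Ax) * V (n + 1) * (Cy - r • Ay)ᵀ
      = (Cx + r • Ax) * V n * (Cy + r • Ay)ᵀ + R n) :
    ∀ n ≤ M, ‖V n‖ ≤ (γx * γy)⁻¹ * (n * ρ) := by
  obtain ⟨S, T, hS, hT, hST, hTS, hSS, hTn⟩ := exists_symmetric_sqrt hγx hCxs hCx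
  obtain ⟨S', T', hS', hT', hST', hTS', hSS', hTn'⟩ := exists_symmetric_sqrt hγy hCys hCy
  have hB : ∀ x, x ⬝ᵥ ((T * Ax * T) *ᵥ x) ≤ 0 := fun x => by
    have := hAx (T *ᵥ x)
    rwa [dotProduct_comm, Matrix.dotProduct_mulVec, ← Matrix.mulVec_transpose, hT,
      dotProduct_comm, Matrix.mulVec_mulVec, Matrix.mulVec_mulVec] at this
  have hB' : ∀ x, x ⬝ᵥ ((T' * Ay * T') *ᵥ x) ≤ 0 := fun x => by
    have := hAy (T' *ᵥ x)
    rwa [dotProduct_comm, Matrix.dotProduct_mulVec, ← Matrix.mulVec_transpose, hT',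
      dotProduct_comm, Matrix.mulVec_mulVec, Matrix.mulVec_mulVec] at this
  obtain ⟨P, hP, hPn, hK⟩ := exists_cayley hB hr
  obtain ⟨P', hP', hPn', hK'⟩ := exists_cayley hB' hr
  have fac : ∀ q : ℝ, T * (Cx + q • Ax) = (1 + q • (T * Ax * T)) * S := by
    intro q
    rw [← hSS, Matrix.mul_add, Matrix.add_mul, ← Matrix.mul_assoc, hTS, Matrix.mul_smul,
      Matrix.smul_mul, Matrix.mul_assoc _ T S, hTS, Matrix.mul_one]
  have fac' : ∀ q : ℝ, (Cy + q • Ay)ᵀ * T' = S' * (1 + q • (T' * Ay * T'))ᵀ := by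
    intro q
    have h : T' * (Cy + q • Ay) = (1 + q • (T' * Ay * T')) * S' := by
      rw [← hSS', Matrix.mul_add, Matrix.add_mul, ← Matrix.mul_assoc, hTS', Matrix.mul_smul,
        Matrix.smul_mul, Matrix.mul_assoc _ T' S', hTS', Matrix.mul_one]
    have := congrArg Matrix.transpose h
    rwa [Matrix.transpose_mul, Matrix.transpose_mul, hT', hS'] at this
  have facn : T * (Cx - r • Ax) = (1 - r • (T * Ax * T)) * S := by
    have := fac (-r)
    rwa [neg_smul, neg_smul, ← sub_eq_add_neg, ← sub_eq_add_neg] at this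
  have facn' : (Cy - r • Ay)ᵀ * T' = S' * (1 - r • (T' * Ay * T'))ᵀ := by
    have := fac' (-r)
    rwa [neg_smul, neg_smul, ← sub_eq_add_neg, ← sub_eq_add_neg] at this
  -- the step in the variable `W = √Cx V √Cy`
  have hW : ∀ n < M, S * V (n + 1) * S'
      = (P * (1 + r • (T * Ax * T))) * (S * V n * S') * (P' * (1 + r • (T' * Ay * T')))ᵀ
        + P * (T * R n * T'ᵀ) * P'ᵀ := by
    intro n hn
    have h := congrArg (fun Z => P * (T * Z * T') * P'ᵀ) (hstep n hn)
    have hsplit : ∀ X Y : Matrix ι κ ℝ, P * (T * (X + Y) * T') * P'ᵀ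
        = P * (T * X * T') * P'ᵀ + P * (T * Y * T') * P'ᵀ := fun X Y => by
      simp only [Matrix.mul_add, Matrix.add_mul]
    rw [hsplit, conjugate_factors facn facn', conjugate_factors (fac r) (fac' r), hP, hP',
      Matrix.transpose_one, Matrix.one_mul, Matrix.mul_one] at h
    rw [h, hT']
  have hx0 : 0 ≤ (√γx)⁻¹ := by positivity
  have hy0 : 0 ≤ (√γy)⁻¹ := by positivity
  have hWn : ∀ n ≤ M, ‖S * V n * S'‖ ≤ (√γx)⁻¹ * (√γy)⁻¹ * (n * ρ) := by
    intro n
    induction n with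
    | zero => intro _; simp [hV0]
    | succ n ih =>
      intro hn
      rw [hW n (by omega)]
      refine (norm_add_le _ _).trans ?_
      have b1 : ‖(P * (1 + r • (T * Ax * T))) * (S * V n * S')
          * (P' * (1 + r • (T' * Ay * T')))ᵀ‖ ≤ 1 * (1 * ‖S * V n * S'‖) :=
        (frobenius_norm_mul_transpose_le zero_le_one hK' _).trans
          (mul_le_mul_of_nonneg_left (frobenius_norm_mul_le zero_le_one hK _) zero_le_one)
      have b2 : ‖P * (T * R n * T'ᵀ) * P'ᵀ‖ ≤ 1 * (1 * ((√γy)⁻¹ * ((√γx)⁻¹ * ‖R n‖))) :=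
        (frobenius_norm_mul_transpose_le zero_le_one hPn' _).trans
          (mul_le_mul_of_nonneg_left ((frobenius_norm_mul_le zero_le_one hPn _).trans
            (mul_le_mul_of_nonneg_left ((frobenius_norm_mul_transpose_le hy0 hTn' _).trans
              (mul_le_mul_of_nonneg_left (frobenius_norm_mul_le hx0 hTn _) hy0)) zero_le_one))
            zero_le_one)
      have b3 : (√γy)⁻¹ * ((√γx)⁻¹ * ‖R n‖) ≤ (√γy)⁻¹ * ((√γx)⁻¹ * ρ) :=
        mul_le_mul_of_nonneg_left (mul_le_mul_of_nonneg_left (hR n (by omega)) hx0) hy0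
      have := ih (by omega)
      push_cast
      linarith
  intro n hn
  have e : V n = T * (S * V n * S') * T'ᵀ := by
    rw [hT', Matrix.mul_assoc, Matrix.mul_assoc, hST', Matrix.mul_one, ← Matrix.mul_assoc, hTS,
      Matrix.one_mul]
  rw [e]
  calc ‖T * (S * V n * S') * T'ᵀ‖ ≤ (√γy)⁻¹ * ((√γx)⁻¹ * ‖S * V n * S'‖) :=
        (frobenius_norm_mul_transpose_le hy0 hTn' _).trans
          (mul_le_mul_of_nonneg_left (frobenius_norm_mul_le hx0 hTn _) hy0)
    _ ≤ (√γy)⁻¹ * ((√γx)⁻¹ * ((√γx)⁻¹ * (√γy)⁻¹ * (n * ρ))) := by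
        gcongr
        exact hWn n hn
    _ = ((√γx * √γx) * (√γy * √γy))⁻¹ * (n * ρ) := by rw [mul_inv, mul_inv, mul_inv]; ring
    _ = (γx * γy)⁻¹ * (n * ρ) := by rw [Real.mul_self_sqrt hγx.le, Real.mul_self_sqrt hγy.le]

end Stability

/-! ### Symbols of the difference operators -/

section Symbol

open Complex Asymptotics Filter Topology

theorem hasSum_grunwald (α : ℝ) {ζ : ℂ} (hζ : ‖ζ‖ < 1) :
    HasSum (fun k => (grunwald α k : ℂ) * ζ ^ k) ((1 - ζ) ^ (α : ℂ)) := by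
  have h := (one_add_cpow_hasFPowerSeriesOnBall_zero (a := (α : ℂ))).hasSum (y := -ζ)
    (by simpa [← ofReal_norm] using hζ)
  rw [zero_add, ← sub_eq_add_neg] at h
  refine h.congr_fun fun k => ?_
  rw [binomialSeries_apply, List.ofFn_const, List.prod_replicate, ← ofReal_choose, smul_eq_mul,
    neg_pow, grunwald]
  push_cast
  ring

theorem hasSum_weight (s : Shifts) (α : ℝ) {ζ : ℂ} (hζ : ‖ζ‖ < 1) :
    HasSum (fun k => (weight s α k : ℂ) * ζ ^ k)
      ((1 - ζ) ^ (α : ℂ) * (s.lead α + s.tail α * ζ ^ s.delay)) := by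
  have h := hasSum_grunwald α hζ
  have h2 : HasSum (fun k => if s.delay ≤ k then
      (s.tail α : ℂ) * (grunwald α (k - s.delay) * ζ ^ k) else 0)
      (s.tail α * ζ ^ s.delay * (1 - ζ) ^ (α : ℂ)) := by
    have h3 : HasSum (fun k => if s.delay ≤ k + s.delay then
        (s.tail α : ℂ) * (grunwald α (k + s.delay - s.delay) * ζ ^ (k + s.delay)) else 0)
        (s.tail α * ζ ^ s.delay * (1 - ζ) ^ (α : ℂ)) := by
      refine (h.mul_left (s.tail α * ζ ^ s.delay : ℂ)).congr_fun fun k => ?_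
      rw [if_pos (by omega), Nat.add_sub_cancel, pow_add]
      ring
    have h4 := (hasSum_nat_add_iff (f := fun k => if s.delay ≤ k then
      (s.tail α : ℂ) * (grunwald α (k - s.delay) * ζ ^ k) else 0) s.delay).1 h3
    rwa [sum_eq_zero (fun i hi => by rw [mem_range] at hi; rw [if_neg (by omega)]), add_zero] at h4
  have h5 := (h.mul_left (s.lead α : ℂ)).add h2
  rw [show (1 - ζ) ^ (α : ℂ) * (s.lead α + s.tail α * ζ ^ s.delay)
    = s.lead α * (1 - ζ) ^ (α : ℂ) + s.tail α * ζ ^ s.delay * (1 - ζ) ^ (α : ℂ) by ring]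
  refine h5.congr_fun fun k => ?_
  rw [weight_eq]
  split_ifs <;> push_cast <;> ring

/-- The function `f` has the Taylor expansion `a + b w + c w ^ 2 + O(w ^ 3)` as `w → 0`. -/
def HasExpansion (f : ℂ → ℂ) (a b c : ℂ) : Prop :=
  (fun w => f w - (a + b * w + c * w ^ 2)) =O[𝓝[≠] 0] fun w => w ^ 3

theorem isBigO_pow_of_le {m n : ℕ} (h : m ≤ n) :
    (fun w : ℂ => w ^ n) =O[𝓝[≠] 0] fun w => w ^ m :=
  IsBigO.of_bound 1 (by
    have : Tendsto (fun w : ℂ => ‖w‖) (𝓝[≠] 0) (𝓝 0) := by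
      simpa using (continuous_norm.tendsto (0 : ℂ)).mono_left nhdsWithin_le_nhds
    filter_upwards [this.eventually (gt_mem_nhds zero_lt_one)] with w hw
    rw [one_mul, norm_pow, norm_pow]
    exact pow_le_pow_of_le_one (norm_nonneg _) hw.le h)

theorem HasExpansion.isBigO_one {f : ℂ → ℂ} {a b c : ℂ} (h : HasExpansion f a b c) :
    f =O[𝓝[≠] 0] fun _ => (1 : ℂ) := by
  have h1 : (fun w : ℂ => a + b * w + c * w ^ 2) =O[𝓝[≠] 0] fun _ => (1 : ℂ) := by
    have : ContinuousAt (fun w : ℂ => a + b * w + c * w ^ 2) 0 := by fun_prop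
    exact (this.tendsto.mono_left nhdsWithin_le_nhds).isBigO_one ℂ
  have h2 := IsBigO.trans h (isBigO_pow_of_le (Nat.zero_le 3))
  simp only [pow_zero] at h2
  exact (h2.add h1).congr_left fun w => by ring

theorem HasExpansion.add {f g : ℂ → ℂ} {a b c a' b' c' : ℂ} (hf : HasExpansion f a b c)
    (hg : HasExpansion g a' b' c') :
    HasExpansion (fun w => f w + g w) (a + a') (b + b') (c + c') :=
  (IsBigO.add hf hg).congr_left fun w => by ring

theorem HasExpansion.const_mul {f : ℂ → ℂ} {a b c : ℂ} (k : ℂ) (hf : HasExpansion f a b c) :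
    HasExpansion (fun w => k * f w) (k * a) (k * b) (k * c) :=
  (IsBigO.const_mul_left hf k).congr_left fun w => by ring

theorem HasExpansion.const (k : ℂ) : HasExpansion (fun _ => k) k 0 0 := by
  have : HasExpansion (fun _ => k) k 0 0 ↔ (fun _ : ℂ => (0 : ℂ)) =O[𝓝[≠] 0] fun w => w ^ 3 := by
    simp [HasExpansion]
  exact this.2 (isBigO_zero _ _)

theorem HasExpansion.mul {f g : ℂ → ℂ} {a b c a' b' c' : ℂ} (hf : HasExpansion f a b c)
    (hg : HasExpansion g a' b' c') :
    HasExpansion (fun w => f w * g w) (a * a') (a * b' + b * a') (a * c' + b * b' + c * a') := by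
  have hp : (fun w : ℂ => a + b * w + c * w ^ 2) =O[𝓝[≠] 0] fun _ => (1 : ℂ) := by
    have : ContinuousAt (fun w : ℂ => a + b * w + c * w ^ 2) 0 := by fun_prop
    exact (this.tendsto.mono_left nhdsWithin_le_nhds).isBigO_one ℂ
  have hr : (fun w : ℂ => w ^ 3 * (b * c' + c * b' + c * c' * w)) =O[𝓝[≠] 0] fun w => w ^ 3 := by
    have : ContinuousAt (fun w : ℂ => b * c' + c * b' + c * c' * w) 0 := by fun_prop
    simpa using (isBigO_refl (fun w : ℂ => w ^ 3) _).mul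
      ((this.tendsto.mono_left nhdsWithin_le_nhds).isBigO_one ℂ)
  have h1 := IsBigO.mul hf hg.isBigO_one
  have h2 := IsBigO.mul hp hg
  simp only [mul_one, one_mul] at h1 h2
  exact ((h1.add h2).add hr).congr_left fun w => by ring

theorem HasExpansion.congr {f : ℂ → ℂ} {a b c a' b' c' : ℂ} (hf : HasExpansion f a b c)
    (ha : a = a') (hb : b = b') (hc : c = c') : HasExpansion f a' b' c' := by
  subst ha hb hc; exact hf

theorem hasExpansion_exp_mul (k : ℂ) : HasExpansion (fun w => exp (k * w)) 1 k (k ^ 2 / 2) := by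
  have h := exp_sub_sum_range_isBigO_pow 3
  have ht : Tendsto (fun w : ℂ => k * w) (𝓝[≠] 0) (𝓝 0) := by
    have : ContinuousAt (fun w : ℂ => k * w) 0 := by fun_prop
    simpa using this.tendsto.mono_left nhdsWithin_le_nhds
  have h0 : (fun w : ℂ => (k * w) ^ 3) =O[𝓝[≠] 0] fun w => w ^ 3 := by
    simp only [mul_pow]
    exact (isBigO_refl _ _).const_mul_left _
  have h1 := (h.comp_tendsto ht).trans h0
  refine h1.congr_left fun w => ?_
  simp only [Function.comp_def, sum_range_succ, range_zero, sum_empty, Nat.factorial]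
  push_cast
  ring

theorem hasExpansion_one_sub_exp_div :
    HasExpansion (fun w => (1 - exp (-w)) / w) 1 (-1 / 2) (1 / 6) := by
  have h := exp_sub_sum_range_isBigO_pow 4
  have ht : Tendsto (fun w : ℂ => -w) (𝓝[≠] 0) (𝓝 0) := by
    have : ContinuousAt (fun w : ℂ => -w) 0 := by fun_prop
    simpa using this.tendsto.mono_left nhdsWithin_le_nhds
  have h1 := (h.comp_tendsto ht).mul (isBigO_refl (fun w : ℂ => -w⁻¹) (𝓝[≠] 0))
  have hne : ∀ᶠ w : ℂ in 𝓝[≠] 0, w ≠ 0 := eventually_mem_nhdsWithin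
  refine h1.congr' (hne.mono fun w hw => ?_) (hne.mono fun w hw => ?_) |>.trans
    (isBigO_refl (fun w : ℂ => w ^ 3) (𝓝[≠] 0)).neg_left
  · simp only [Function.comp_def, sum_range_succ, range_zero, sum_empty, Nat.factorial]
    push_cast
    field_simp
    ring
  · simp only [Function.comp_def]
    field_simp

theorem HasExpansion.one_add_cpow {f : ℂ → ℂ} {b c : ℂ} (hf : HasExpansion f 1 b c) (α : ℂ) :
    HasExpansion (fun w => f w ^ α) 1 (α * b) (α * c + α * (α - 1) / 2 * b ^ 2) := by
  have h := (one_add_cpow_hasFPowerSeriesAt_zero (a := α)).isBigO_sub_partialSum_pow 3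
  have hε : HasExpansion (fun w => f w + -1) 0 b c := by
    simpa using hf.add (HasExpansion.const (-1))
  have hεO : (fun w => f w + -1) =O[𝓝[≠] 0] fun w => w := by
    have h1 := IsBigO.trans hε (isBigO_pow_of_le (m := 1) (n := 3) (by norm_num))
    simp only [pow_one] at h1
    have h2 : (fun w : ℂ => w * (b + c * w)) =O[𝓝[≠] 0] fun w => w := by
      have : ContinuousAt (fun w : ℂ => b + c * w) 0 := by fun_prop
      simpa using (isBigO_refl (fun w : ℂ => w) _).mul
        ((this.tendsto.mono_left nhdsWithin_le_nhds).isBigO_one ℂ)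
    exact (h1.add h2).congr_left fun w => by ring
  have ht : Tendsto (fun w => f w + -1) (𝓝[≠] 0) (𝓝 0) :=
    hεO.trans_tendsto (tendsto_id.mono_left nhdsWithin_le_nhds)
  have h1 := (h.comp_tendsto ht).trans (hεO.norm_left.pow 3)
  have h2 : HasExpansion (fun w => f w ^ α
      - (1 + α * (f w + -1) + α * (α - 1) / 2 * ((f w + -1) * (f w + -1)))) 0 0 0 := by
    refine h1.congr_left fun w => ?_
    have c2 : Ring.choose α 2 = α * (α - 1) / 2 := by
      rw [Ring.choose_eq_smul]
      simp [descPochhammer_succ_right, Polynomial.smeval_mul, Polynomial.smeval_sub]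
      ring
    simp only [Function.comp_def, FormalMultilinearSeries.partialSum, sum_range_succ, range_zero,
      sum_empty, binomialSeries_apply, List.ofFn_const, List.prod_replicate, Ring.choose_zero_right,
      Ring.choose_one_right, c2, smul_eq_mul]
    ring_nf
  have h3 := h2.add (((HasExpansion.const 1).add (hε.const_mul α)).add
    ((hε.mul hε).const_mul (α * (α - 1) / 2)))
  simp only [sub_add_cancel] at h3
  exact h3.congr (by ring) (by ring) (by ring)

/-- The symbol of the left difference operator, with `w = z h`: applied to `exp (z x)`, the
operator multiplies it by `h ^ (-α)` times this value. -/
def symbol (s : Shifts) (α : ℝ) (w : ℂ) : ℂ :=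
  exp w * ((1 - exp (-w)) ^ (α : ℂ) * (s.lead α + s.tail α * exp (-w) ^ s.delay))

/-- The symbol of the compact operator. -/
def compactSymbol (s : Shifts) (α : ℝ) (w : ℂ) : ℂ :=
  1 + compactCoeff s α * (exp w - 2 + exp (-w))

/-- The choice of `c^α` is what makes the quotient of the symbols exact up to third order. -/
theorem isBigO_symbol_sub (s : Shifts) (α : ℝ) :
    (fun w => exp w * (((1 - exp (-w)) / w) ^ (α : ℂ) *
      (s.lead α + s.tail α * exp (-w) ^ s.delay)) - compactSymbol s α w)
      =O[𝓝[≠] 0] fun w => w ^ 3 := by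
  have hw : HasExpansion (fun w => exp w) 1 1 (1 / 2) := by
    simpa using hasExpansion_exp_mul 1
  have hn : HasExpansion (fun w => exp (-w)) 1 (-1) (1 / 2) := by
    simpa using hasExpansion_exp_mul (-1)
  have hd : HasExpansion (fun w => exp (-w) ^ s.delay) 1 (-s.delay) (s.delay ^ 2 / 2) := by
    have h := hasExpansion_exp_mul (-(s.delay : ℂ))
    have e : (fun w => exp (-(s.delay : ℂ) * w)) = fun w => exp (-w) ^ s.delay := by
      funext w; rw [← exp_nat_mul]; ring_nf
    rw [e] at h
    exact h.congr rfl rfl (by ring)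
  have hc : HasExpansion (compactSymbol s α) 1 0 (compactCoeff s α) := by
    have := (HasExpansion.const 1).add
      (((hw.add (HasExpansion.const (-2))).add hn).const_mul (compactCoeff s α : ℂ))
    refine (this.congr (a' := 1) (b' := 0) (c' := compactCoeff s α)
      (by ring) (by ring) (by ring)).congr_left fun w => ?_
    simp only [compactSymbol]; ring
  have hφ := hasExpansion_one_sub_exp_div.one_add_cpow (α : ℂ)
  have hm := hw.mul (hφ.mul ((HasExpansion.const (s.lead α : ℂ)).add
    (hd.const_mul (s.tail α : ℂ))))
  have hfin := hm.add (hc.const_mul (-1))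
  have h0 : HasExpansion (fun w => exp w * (((1 - exp (-w)) / w) ^ (α : ℂ) *
      (s.lead α + s.tail α * exp (-w) ^ s.delay)) + -1 * compactSymbol s α w) 0 0 0 := by
    -- the coefficients of orders zero, one and two vanish
    refine hfin.congr ?_ ?_ ?_ <;> cases s <;>
      simp only [Shifts.lead, Shifts.tail, Shifts.delay, compactCoeff] <;> push_cast <;> ring
  exact h0.congr_left fun w => by ring

/-- Principal powers are not multiplicative in general; here both arguments lie in the right half plane. -/
theorem one_sub_exp_neg_cpow (α : ℝ) {w : ℂ} (hw : 0 < w.re) :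
    (1 - exp (-w)) ^ (α : ℂ) = w ^ (α : ℂ) * ((1 - exp (-w)) / w) ^ (α : ℂ) := by
  have hw0 : w ≠ 0 := fun h => by simp [h] at hw
  have hlt : ‖exp (-w)‖ < 1 := by rw [norm_exp, neg_re]; simpa using hw
  have hre : 0 < (1 - exp (-w)).re := by
    have := (abs_le.1 (abs_re_le_norm (exp (-w)))).2
    simp only [sub_re, one_re]; linarith
  have hx0 : 1 - exp (-w) ≠ 0 := fun h => by simp [h] at hre
  have a1 := abs_lt.1 (abs_arg_lt_pi_div_two_iff.2 (Or.inl hre))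
  have a2 := abs_lt.1 (abs_arg_lt_pi_div_two_iff.2 (Or.inl hw))
  have hlog : log ((1 - exp (-w)) / w) = log (1 - exp (-w)) - log w := by
    have e : (1 - exp (-w)) / w = exp (log (1 - exp (-w)) - log w) := by
      rw [exp_sub, exp_log hx0, exp_log hw0]
    rw [e]
    refine log_exp ?_ ?_ <;> simp only [sub_im, log_im] <;> linarith [a1.1, a1.2, a2.1, a2.2]
  rw [cpow_def_of_ne_zero hx0, cpow_def_of_ne_zero hw0, cpow_def_of_ne_zero (div_ne_zero hx0 hw0),
    hlog, ← exp_add]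
  congr 1
  ring

/-- The symbol estimate behind third order consistency. -/
theorem exists_norm_symbol_sub_le (s : Shifts) {α : ℝ} (h1 : 1 ≤ α) (h2 : α ≤ 2) (H : ℝ) :
    ∃ C, 0 ≤ C ∧ ∀ w : ℂ, 0 < w.re → w.re ≤ H →
      ‖symbol s α w - w ^ (α : ℂ) * compactSymbol s α w‖ ≤ C * ‖w‖ ^ (α + 3) := by
  obtain ⟨K, hK0, hK⟩ := (isBigO_symbol_sub s α).exists_pos
  rw [IsBigOWith_def, eventually_nhdsWithin_iff, Metric.eventually_nhds_iff] at hK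
  obtain ⟨δ, hδ, hK⟩ := hK
  set c := |compactCoeff s α| with hc
  set K2 := 1 + c * (Real.exp H + 3) with hK2
  set K1 := Real.exp H * 4 with hK1
  have hc0 : 0 ≤ c := abs_nonneg _
  have hK20 : 0 ≤ K2 := by positivity
  refine ⟨K + K1 / δ ^ (α + 3) + K2 / δ ^ (3 : ℝ), by positivity, fun w hw hwH => ?_⟩
  have hw0 : w ≠ 0 := fun h => by simp [h] at hw
  have hn : 0 < ‖w‖ := norm_pos_iff.2 hw0
  -- near zero the Taylor expansions agree; away from zero each symbol is bounded separately
  rcases lt_or_ge ‖w‖ δ with hlt | hge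
  · have h := hK (by simpa using hlt) hw0
    have e : symbol s α w - w ^ (α : ℂ) * compactSymbol s α w = w ^ (α : ℂ) *
        (exp w * (((1 - exp (-w)) / w) ^ (α : ℂ) *
          (s.lead α + s.tail α * exp (-w) ^ s.delay)) - compactSymbol s α w) := by
      rw [symbol, one_sub_exp_neg_cpow α hw]; ring
    rw [e, norm_mul, norm_cpow_real]
    calc ‖w‖ ^ α * _ ≤ ‖w‖ ^ α * (K * ‖w ^ 3‖) := by gcongr
      _ = K * ‖w‖ ^ (α + 3) := by
        rw [norm_pow, Real.rpow_add hn, show (3 : ℝ) = ((3 : ℕ) : ℝ) by norm_num,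
          Real.rpow_natCast]
        ring
      _ ≤ _ := by
        gcongr
        rw [add_assoc]
        exact le_add_of_nonneg_right (by positivity)
  · have hexp : ‖exp w‖ ≤ Real.exp H := by rw [norm_exp]; exact Real.exp_le_exp.2 hwH
    have hexpn : ‖exp (-w)‖ ≤ 1 := by
      rw [norm_exp, neg_re, Real.exp_le_one_iff]; linarith
    have b1 : ‖symbol s α w‖ ≤ K1 := by
      have t1 : ‖(1 - exp (-w)) ^ (α : ℂ)‖ ≤ 4 := by
        rw [norm_cpow_real]
        have : ‖1 - exp (-w)‖ ≤ 2 := by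
          refine (norm_sub_le _ _).trans ?_
          rw [norm_one]; linarith
        calc ‖1 - exp (-w)‖ ^ α ≤ 2 ^ α := by gcongr
          _ ≤ 2 ^ (2 : ℝ) := Real.rpow_le_rpow_of_exponent_le (by norm_num) h2
          _ = 4 := by norm_num
      have t2 : ‖(s.lead α + s.tail α * exp (-w) ^ s.delay : ℂ)‖ ≤ 1 := by
        refine (norm_add_le _ _).trans ?_
        rw [norm_mul, norm_pow, norm_real, norm_real, Real.norm_of_nonneg (lead_nonneg s h1),
          Real.norm_of_nonneg (tail_nonneg s h2), ← lead_add_tail s (α := α)]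
        have := mul_le_mul_of_nonneg_left (pow_le_one₀ (norm_nonneg (exp (-w))) hexpn
          (n := s.delay)) (tail_nonneg s h2)
        linarith
      rw [symbol, norm_mul, norm_mul]
      calc _ ≤ Real.exp H * (4 * 1) := by gcongr
        _ = K1 := by rw [hK1]; ring
    have b2 : ‖compactSymbol s α w‖ ≤ K2 := by
      rw [compactSymbol]
      refine (norm_add_le _ _).trans ?_
      rw [norm_one, norm_mul, norm_real, Real.norm_eq_abs, hK2]
      have : ‖exp w - 2 + exp (-w)‖ ≤ Real.exp H + 3 := by
        refine (norm_add_le _ _).trans ((add_le_add_left (norm_sub_le _ _) _).trans ?_)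
        rw [show ‖(2 : ℂ)‖ = 2 by simp]
        linarith
      gcongr
    have hq : 1 ≤ ‖w‖ / δ := (one_le_div hδ).2 hge
    calc ‖symbol s α w - w ^ (α : ℂ) * compactSymbol s α w‖
        ≤ ‖symbol s α w‖ + ‖w‖ ^ α * ‖compactSymbol s α w‖ := by
          refine (norm_sub_le _ _).trans ?_
          rw [norm_mul, norm_cpow_real]
      _ ≤ K1 * 1 + ‖w‖ ^ α * (K2 * 1) := by rw [mul_one, mul_one]; gcongr
      _ ≤ K1 * (‖w‖ / δ) ^ (α + 3) + ‖w‖ ^ α * (K2 * (‖w‖ / δ) ^ (3 : ℝ)) := by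
          have p1 : 1 ≤ (‖w‖ / δ) ^ (α + 3) := Real.one_le_rpow hq (by linarith)
          have p2 : 1 ≤ (‖w‖ / δ) ^ (3 : ℝ) := Real.one_le_rpow hq (by norm_num)
          gcongr
      _ = (K1 / δ ^ (α + 3) + K2 / δ ^ (3 : ℝ)) * ‖w‖ ^ (α + 3) := by
          rw [Real.div_rpow hn.le hδ.le, Real.div_rpow hn.le hδ.le, Real.rpow_add hn]
          ring
      _ ≤ _ := by
          gcongr
          linarith

end Symbol

/-! ### The Laplace transform of a power and the Bromwich representation -/

section Laplace

open Complex MeasureTheory Filter Topology FourierTransform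

theorem integrableOn_rpow_mul_exp_neg {a b : ℝ} (ha : -1 < a) (hb : 0 < b) :
    IntegrableOn (fun s : ℝ => s ^ a * Real.exp (-(b * s))) (Set.Ioi 0) := by
  simpa using integrableOn_rpow_mul_exp_neg_mul_rpow ha zero_lt_one hb

theorem aestronglyMeasurable_rpow_mul_cexp (a : ℝ) (z : ℂ) :
    AEStronglyMeasurable (fun s : ℝ => ((s ^ a : ℝ) : ℂ) * exp (-(z * s)))
      (volume.restrict (Set.Ioi 0)) := by
  refine ContinuousOn.aestronglyMeasurable ?_ measurableSet_Ioi
  refine ContinuousOn.mul (continuous_ofReal.comp_continuousOn fun s hs => ?_) (by fun_prop)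
  exact (Real.continuousAt_rpow_const _ _ (Or.inl (ne_of_gt hs))).continuousWithinAt

theorem norm_rpow_mul_cexp (a : ℝ) (z : ℂ) {s : ℝ} (hs : 0 < s) :
    ‖((s ^ a : ℝ) : ℂ) * exp (-(z * s))‖ = s ^ a * Real.exp (-(z.re * s)) := by
  rw [norm_mul, norm_real, Real.norm_of_nonneg (Real.rpow_nonneg hs.le _), norm_exp]
  simp

theorem integrableOn_rpow_mul_cexp_neg {a : ℝ} (ha : -1 < a) {z : ℂ} (hz : 0 < z.re) :
    IntegrableOn (fun s : ℝ => ((s ^ a : ℝ) : ℂ) * exp (-(z * s))) (Set.Ioi 0) := by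
  refine (integrableOn_rpow_mul_exp_neg ha hz).mono' (aestronglyMeasurable_rpow_mul_cexp a z) ?_
  filter_upwards [self_mem_ae_restrict measurableSet_Ioi] with s hs
  exact (norm_rpow_mul_cexp a z hs).le

/-- The Laplace transform of `s ^ (a - 1)` on the right half plane, by analytic continuation from
the positive axis. -/
theorem integral_rpow_mul_cexp_neg {a : ℝ} (ha : 0 < a) {z : ℂ} (hz : 0 < z.re) :
    ∫ s in Set.Ioi (0 : ℝ), ((s ^ (a - 1) : ℝ) : ℂ) * exp (-(z * s))
      = Real.Gamma a * z ^ (-(a : ℂ)) := by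
  set U : Set ℂ := {w | 0 < w.re}
  have hU : IsOpen U := isOpen_lt continuous_const continuous_re
  have hdiff : DifferentiableOn ℂ (fun w : ℂ =>
      ∫ s in Set.Ioi (0 : ℝ), ((s ^ (a - 1) : ℝ) : ℂ) * exp (-(w * s))) U := by
    intro w hw
    have hw : 0 < w.re := hw
    have hs : {y : ℂ | w.re / 2 < y.re} ∈ 𝓝 w :=
      (isOpen_lt continuous_const continuous_re).mem_nhds (by simp only [Set.mem_ofPred_eq]; linarith)
    refine (hasDerivAt_integral_of_dominated_loc_of_deriv_le hs
      (F' := fun y s => ((s ^ (a - 1) : ℝ) : ℂ) * (exp (-(y * s)) * -(s : ℂ)))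
      (bound := fun s => s ^ a * Real.exp (-(w.re / 2 * s)))
      (Eventually.of_forall fun y => aestronglyMeasurable_rpow_mul_cexp _ y)
      (integrableOn_rpow_mul_cexp_neg (by linarith) hw) ?_ ?_
      (integrableOn_rpow_mul_exp_neg (by linarith) (by linarith)) ?_).2.differentiableAt
      |>.differentiableWithinAt
    · have := (aestronglyMeasurable_rpow_mul_cexp (a - 1) w).mul
        (continuous_ofReal.neg.aestronglyMeasurable (μ := volume.restrict (Set.Ioi (0 : ℝ))))
      refine this.congr (Eventually.of_forall fun s => ?_)
      simp only [Pi.mul_apply, Pi.neg_apply]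
      ring
    · filter_upwards [self_mem_ae_restrict measurableSet_Ioi] with s hs y hy
      have hs : 0 < s := hs
      rw [← mul_assoc, norm_mul, norm_rpow_mul_cexp _ _ hs, norm_neg, norm_real,
        Real.norm_of_nonneg hs.le, mul_right_comm, ← Real.rpow_add_one hs.ne', sub_add_cancel]
      have hy : w.re / 2 < y.re := hy
      gcongr
    · refine Eventually.of_forall fun s y _ => ?_
      have h1 : HasDerivAt (fun y : ℂ => -(y * s)) (-(s : ℂ)) y := by
        simpa using ((hasDerivAt_id y).mul_const (s : ℂ)).fun_neg
      exact h1.cexp.const_mul _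
  have hg : DifferentiableOn ℂ (fun w : ℂ => (Real.Gamma a : ℂ) * w ^ (-(a : ℂ))) U := by
    intro w hw
    refine (DifferentiableAt.const_mul (DifferentiableAt.cpow_const differentiableAt_id ?_)
      _).differentiableWithinAt
    exact Or.inl hw
  refine (hdiff.analyticOnNhd hU).eqOn_of_preconnected_of_frequently_eq (hg.analyticOnNhd hU)
    (convex_halfSpace_re_gt 0).isPreconnected (z₀ := 1) (by simp [U]) ?_ hz
  -- both sides agree on the real axis, which accumulates at `1`
  have ht : Tendsto (fun x : ℝ => (x : ℂ)) (𝓝[≠] 1) (𝓝[≠] 1) := by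
    refine tendsto_nhdsWithin_of_tendsto_nhds_of_eventually_within _ ?_ ?_
    · exact (continuous_ofReal.tendsto (1 : ℝ)).mono_left nhdsWithin_le_nhds
    · filter_upwards [self_mem_nhdsWithin] with x hx
      simpa using hx
  refine ht.frequently (Eventually.frequently ?_)
  filter_upwards [mem_nhdsWithin_of_mem_nhds (lt_mem_nhds (zero_lt_one' ℝ))] with x hx
  have h := Real.integral_rpow_mul_exp_neg_mul_Ioi ha hx
  have e : ∀ s : ℝ, ((s ^ (a - 1) : ℝ) : ℂ) * exp (-((x : ℂ) * s))
      = ((s ^ (a - 1) * Real.exp (-(x * s)) : ℝ) : ℂ) := fun s => by push_cast; rfl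
  simp only [e]
  rw [integral_complex_ofReal, h, one_div, Real.inv_rpow hx.le, ← Real.rpow_neg hx.le, mul_comm,
    ofReal_mul, ofReal_cpow hx.le, ofReal_neg]

/-- The vertical line on which Laplace transforms are inverted. -/
def vline (ω : ℝ) : ℂ := 1 + 2 * Real.pi * ω * I

@[simp] theorem vline_re (ω : ℝ) : (vline ω).re = 1 := by simp [vline]

theorem one_add_sq_le_norm_vline_sq (ω : ℝ) : 1 + ω ^ 2 ≤ ‖vline ω‖ ^ 2 := by
  rw [← normSq_eq_norm_sq, normSq_apply]
  have h1 : (vline ω).im = 2 * Real.pi * ω := by simp [vline]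
  rw [vline_re, h1]
  nlinarith [mul_le_mul_of_nonneg_right
    (show (1 : ℝ) ≤ (2 * Real.pi) ^ 2 by nlinarith [Real.pi_gt_three]) (sq_nonneg ω)]

theorem one_le_norm_vline (ω : ℝ) : 1 ≤ ‖vline ω‖ := by
  have := one_add_sq_le_norm_vline_sq ω
  nlinarith [norm_nonneg (vline ω), sq_nonneg ω]

theorem continuous_vline : Continuous vline := by unfold vline; fun_prop

/-- A compactly supported function of class `C⁷`, with its derivatives, is a superposition of
exponentials along a vertical line, with a density decaying like `‖z‖⁻⁷`. The density is the Fourier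
transform of `exp (-x) v(x)`. -/
theorem exists_bromwich {A B M : ℝ} (hAB : A ≤ B) (v : ℕ → ℝ → ℂ)
    (hd : ∀ k < 7, ∀ x, HasDerivAt (v k) (v (k + 1) x) x) (hc : Continuous (v 7))
    (hs : ∀ k ≤ 7, ∀ x, x ∉ Set.Icc A B → v k x = 0) (hM : ∀ x, ‖v 7 x‖ ≤ M) :
    ∃ V : ℝ → ℂ, Continuous V ∧
      (∀ ω, ‖V ω‖ ≤ (B - A) * Real.exp (-A) * M * ‖vline ω‖⁻¹ ^ 7) ∧
      ∀ k ≤ 2, ∀ x, v k x = ∫ ω, V ω * vline ω ^ k * exp (vline ω * x) := by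
  set f : ℕ → ℝ → ℂ := fun k x => exp (-(x : ℂ)) * v k x with hf
  have hM0 : 0 ≤ M := (norm_nonneg _).trans (hM 0)
  have hcont : ∀ k ≤ 7, Continuous (v k) := by
    intro k hk
    rcases Nat.lt_or_eq_of_le hk with h | rfl
    · exact continuous_iff_continuousAt.2 fun x => (hd k h x).continuousAt
    · exact hc
  have hfc : ∀ k ≤ 7, Continuous (f k) := fun k hk => by
    have := hcont k hk
    fun_prop
  have hfi : ∀ k ≤ 7, Integrable (f k) := fun k hk =>
    (hfc k hk).integrable_of_hasCompactSupport
      (HasCompactSupport.of_support_subset_isCompact (isCompact_Icc (a := A) (b := B)) fun x hx => by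
        by_contra h
        exact hx (by simp [hf, hs k hk x h]))
  have hfd : ∀ k < 7, ∀ x, HasDerivAt (f k) (f (k + 1) x - f k x) x := by
    intro k hk x
    have h1 : HasDerivAt (fun x : ℝ => exp (-(x : ℂ))) (exp (-(x : ℂ)) * -1) x :=
      (ofRealCLM.hasDerivAt (x := x)).neg.cexp
    refine (h1.mul (hd k hk x)).congr_deriv ?_
    simp only [hf]
    ring
  have hF : ∀ k ≤ 7, ∀ ω, 𝓕 (f k) ω = vline ω ^ k * 𝓕 (f 0) ω := by
    intro k
    induction k with
    | zero => intro _ ω; simp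
    | succ k ih =>
      intro hk ω
      have hder : deriv (f k) = fun x => f (k + 1) x - f k x :=
        funext fun x => (hfd k (by omega) x).deriv
      have hint : Integrable (deriv (f k)) := by
        rw [hder]; exact (hfi _ hk).sub (hfi k (by omega))
      have h := congrFun (Real.fourier_deriv (hfi k (by omega))
        (fun x => (hfd k (by omega) x).differentiableAt) hint) ω
      have h2 : 𝓕 (f (k + 1)) ω = 𝓕 (deriv (f k)) ω + 𝓕 (f k) ω := by
        rw [Real.fourier_eq', Real.fourier_eq', Real.fourier_eq', hder, ← integral_add]
        · refine integral_congr_ae (Eventually.of_forall fun x => ?_)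
          simp only [smul_eq_mul]
          ring
        · have := (hfi _ hk).sub (hfi k (by omega))
          refine this.bdd_mul (c := 1) (by fun_prop) (Eventually.of_forall fun x => ?_)
          rw [norm_exp_ofReal_mul_I]
        · refine (hfi k (by omega)).bdd_mul (c := 1) (by fun_prop) (Eventually.of_forall fun x => ?_)
          rw [norm_exp_ofReal_mul_I]
      rw [h2, h, smul_eq_mul, ih (by omega), vline]
      ring
  -- `z ^ 7` times the density is the transform for the seventh derivative, bounded by an `L¹` norm
  have hV7 : ∀ ω, ‖𝓕 (f 7) ω‖ ≤ (B - A) * Real.exp (-A) * M := by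
    intro ω
    rw [Real.fourier_eq']
    have hb : ∀ x, ‖exp (↑(-2 * Real.pi * inner ℝ x ω) * I) • f 7 x‖
        ≤ (Set.Icc A B).indicator (fun _ => Real.exp (-A) * M) x := by
      intro x
      rw [smul_eq_mul, norm_mul, norm_exp_ofReal_mul_I, one_mul]
      by_cases hx : x ∈ Set.Icc A B
      · rw [Set.indicator_of_mem hx]
        simp only [hf]
        rw [norm_mul, norm_exp]
        simp only [neg_re, ofReal_re]
        have := hx.1
        gcongr
        exact hM x
      · rw [Set.indicator_of_notMem hx]
        simp [hf, hs 7 le_rfl x hx]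
    refine (norm_integral_le_of_norm_le ?_ (Eventually.of_forall hb)).trans_eq ?_
    · exact (integrable_indicator_iff measurableSet_Icc).2 (integrableOn_const (by simp))
    · rw [integral_indicator measurableSet_Icc, setIntegral_const, smul_eq_mul, Real.volume_real_Icc,
        max_eq_left (by linarith)]
      ring
  have hVc : Continuous (𝓕 (f 0)) :=
    VectorFourier.fourierIntegral_continuous Real.continuous_fourierChar
      (by exact continuous_inner) (hfi 0 (by norm_num))
  have hVb : ∀ ω, ‖𝓕 (f 0) ω‖ ≤ (B - A) * Real.exp (-A) * M * ‖vline ω‖⁻¹ ^ 7 := by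
    intro ω
    have h := hV7 ω
    rw [hF 7 le_rfl, norm_mul, norm_pow] at h
    have hp : 0 < ‖vline ω‖ := zero_lt_one.trans_le (one_le_norm_vline ω)
    rw [inv_pow, ← div_eq_mul_inv, le_div_iff₀ (by positivity), mul_comm]
    exact h
  refine ⟨𝓕 (f 0), hVc, hVb, fun k hk x => ?_⟩
  have hFi : Integrable (𝓕 (f k)) := by
    rw [show 𝓕 (f k) = fun ω => vline ω ^ k * 𝓕 (f 0) ω from funext (hF k (by omega))]
    refine (integrable_inv_one_add_sq.const_mul ((B - A) * Real.exp (-A) * M)).mono'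
      (by have := continuous_vline; exact Continuous.aestronglyMeasurable (by fun_prop))
      (Eventually.of_forall fun ω => ?_)
    have h1 := one_le_norm_vline ω
    have hp : 0 < ‖vline ω‖ := zero_lt_one.trans_le h1
    rw [norm_mul, norm_pow]
    calc ‖vline ω‖ ^ k * ‖𝓕 (f 0) ω‖
        ≤ ‖vline ω‖ ^ k * ((B - A) * Real.exp (-A) * M * ‖vline ω‖⁻¹ ^ 7) := by
          gcongr; exact hVb ω
      _ ≤ ‖vline ω‖ ^ 5 * ((B - A) * Real.exp (-A) * M * ‖vline ω‖⁻¹ ^ 7) := by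
          have : 0 ≤ B - A := by linarith
          gcongr
          omega
      _ = (B - A) * Real.exp (-A) * M * (‖vline ω‖ ^ 2)⁻¹ := by
          field_simp
      _ ≤ (B - A) * Real.exp (-A) * M * (1 + ω ^ 2)⁻¹ := by
          have : 0 ≤ B - A := by linarith
          gcongr
          exact one_add_sq_le_norm_vline_sq ω
  have hinv := congrFun ((hfc k (by omega)).fourierInv_fourier_eq (hfi k (by omega)) hFi) x
  rw [Real.fourierInv_eq'] at hinv
  have hvx : v k x = exp (x : ℂ) * f k x := by
    simp only [hf]
    rw [← mul_assoc, ← exp_add, add_neg_cancel, exp_zero, one_mul]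
  rw [hvx, ← hinv, ← integral_const_mul]
  refine integral_congr_ae (Eventually.of_forall fun ω => ?_)
  simp only [smul_eq_mul]
  rw [hF k (by omega), ← mul_assoc, ← exp_add, mul_comm (vline ω ^ k), mul_comm (exp _)]
  congr 2
  simp only [vline, RCLike.inner_apply, conj_trivial]
  push_cast
  ring

end Laplace

/-! ### Consistency on the whole line -/

section Consistency

open Complex MeasureTheory Filter Topology

variable {V : ℝ → ℂ} {D : ℝ}

theorem integrable_density_mul (hV : Continuous V)
    (hVD : ∀ ω, ‖V ω‖ ≤ D * ‖vline ω‖⁻¹ ^ 7) {φ : ℝ → ℂ} (hφ : Continuous φ) {c : ℝ}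
    (hφc : ∀ ω, ‖φ ω‖ ≤ c * ‖vline ω‖ ^ 5) : Integrable fun ω => V ω * φ ω := by
  refine (integrable_inv_one_add_sq.const_mul (D * c)).mono' (hV.mul hφ).aestronglyMeasurable
    (Eventually.of_forall fun ω => ?_)
  have hp : 0 < ‖vline ω‖ := zero_lt_one.trans_le (one_le_norm_vline ω)
  have hD : 0 ≤ D := by
    have := (norm_nonneg _).trans (hVD ω)
    exact nonneg_of_mul_nonneg_left this (by positivity)
  have hc : 0 ≤ c := by
    have := (norm_nonneg _).trans (hφc ω)
    exact nonneg_of_mul_nonneg_left this (by positivity)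
  rw [norm_mul]
  calc ‖V ω‖ * ‖φ ω‖ ≤ (D * ‖vline ω‖⁻¹ ^ 7) * (c * ‖vline ω‖ ^ 5) := by
        gcongr
        · exact hVD ω
        · exact hφc ω
    _ = D * c * (‖vline ω‖ ^ 2)⁻¹ := by field_simp
    _ ≤ D * c * (1 + ω ^ 2)⁻¹ := by
        gcongr
        exact one_add_sq_le_norm_vline_sq ω

theorem norm_exp_vline_mul (ω x : ℝ) : ‖exp (vline ω * x)‖ = Real.exp x := by
  rw [norm_exp, mul_re, vline_re, ofReal_re, ofReal_im, mul_zero, sub_zero, one_mul]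

theorem norm_exp_vline_mul_le (ω x : ℝ) (k : ℕ) :
    ‖exp (vline ω * x)‖ ≤ Real.exp x * ‖vline ω‖ ^ k := by
  rw [norm_exp_vline_mul]
  exact le_mul_of_one_le_right (Real.exp_nonneg _) (one_le_pow₀ (one_le_norm_vline ω))

theorem re_vline_mul (ω h : ℝ) : (vline ω * h).re = h := by simp

/-- The difference operator acts on a superposition of exponentials through its symbol. -/
theorem hasSum_weight_bromwich (s : Shifts) (α : ℝ) (hV : Continuous V)
    (hVD : ∀ ω, ‖V ω‖ ≤ D * ‖vline ω‖⁻¹ ^ 7) {h : ℝ} (hh : 0 < h) (x : ℝ) :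
    HasSum (fun k : ℕ => (weight s α k : ℂ)
        * ∫ ω, V ω * exp (vline ω * ((x - ((k : ℝ) - 1) * h : ℝ) : ℂ)))
      (∫ ω, V ω * (exp (vline ω * x) * symbol s α (vline ω * h))) := by
  have hVi : ∀ y : ℝ, Integrable fun ω => V ω * exp (vline ω * y) := fun y =>
    integrable_density_mul hV hVD (by have := continuous_vline; fun_prop)
      (norm_exp_vline_mul_le · y 5)
  have hsum := hasSum_integral_of_summable_integral_norm (μ := volume)
    (F := fun (k : ℕ) ω => (weight s α k : ℂ)
      * (V ω * exp (vline ω * ((x - ((k : ℝ) - 1) * h : ℝ) : ℂ))))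
    (fun k => (hVi _).const_mul _) ?_
  · simp only [integral_const_mul] at hsum
    convert! hsum using 1
    refine integral_congr_ae (Eventually.of_forall fun ω => ?_)
    have hζ : ‖exp (-(vline ω * h))‖ < 1 := by
      rw [norm_exp, neg_re, re_vline_mul, Real.exp_lt_one_iff]; linarith
    have h1 := (hasSum_weight s α hζ).mul_left (V ω * (exp (vline ω * x) * exp (vline ω * h)))
    have e : ∀ k : ℕ, (weight s α k : ℂ)
        * (V ω * exp (vline ω * ((x - ((k : ℝ) - 1) * h : ℝ) : ℂ)))
        = V ω * (exp (vline ω * x) * exp (vline ω * h))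
          * (weight s α k * exp (-(vline ω * h)) ^ k) := by
      intro k
      have : exp (vline ω * ((x - ((k : ℝ) - 1) * h : ℝ) : ℂ))
          = exp (vline ω * x) * exp (vline ω * h) * exp (-(vline ω * h)) ^ k := by
        rw [← exp_nat_mul, ← exp_add, ← exp_add]
        congr 1
        push_cast
        ring
      rw [this]
      ring
    simp only [e]
    rw [h1.tsum_eq, symbol]
    ring
  · have hζ : ‖((Real.exp (-h) : ℝ) : ℂ)‖ < 1 := by
      rw [norm_real, Real.norm_of_nonneg (Real.exp_nonneg _), Real.exp_lt_one_iff]; linarith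
    have h1 := (hasSum_weight s α hζ).summable.norm.mul_right
      (Real.exp (x + h) * ∫ ω, ‖V ω‖)
    refine h1.congr fun k => ?_
    have e : ∀ ω, ‖(weight s α k : ℂ) * (V ω * exp (vline ω * ((x - ((k : ℝ) - 1) * h : ℝ) : ℂ)))‖
        = ‖(weight s α k : ℂ) * ((Real.exp (-h) : ℝ) : ℂ) ^ k‖ * Real.exp (x + h) * ‖V ω‖ := by
      intro ω
      rw [norm_mul, norm_mul, norm_mul, norm_exp_vline_mul, norm_pow, norm_real (Real.exp _),
        Real.norm_of_nonneg (Real.exp_nonneg _), ← Real.exp_nat_mul,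
        show x - ((k : ℝ) - 1) * h = k * -h + (x + h) by ring, Real.exp_add (k * -h)]
      ring
    simp only [e]
    rw [integral_const_mul, mul_assoc]

/-- The fractional integral of order `2 - α` acts on a superposition of exponentials as
multiplication by `z ^ (α - 2)`. -/
theorem integral_rpow_mul_bromwich {α : ℝ} (h2 : α < 2) (hV : Continuous V)
    (hVD : ∀ ω, ‖V ω‖ ≤ D * ‖vline ω‖⁻¹ ^ 7) (x : ℝ) :
    ∫ s in Set.Ioi (0 : ℝ), ((s ^ (1 - α) : ℝ) : ℂ)
        * ∫ ω, V ω * vline ω ^ 2 * exp (vline ω * ((x - s : ℝ) : ℂ))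
      = Real.Gamma (2 - α) * ∫ ω, V ω * (exp (vline ω * x) * vline ω ^ (α : ℂ)) := by
  have hvc := continuous_vline
  set g : ℝ → ℂ := fun ω => V ω * (vline ω ^ 2 * exp (vline ω * x)) with hg
  have hgi : Integrable g := by
    refine integrable_density_mul hV hVD (by fun_prop) (c := Real.exp x) fun ω => ?_
    rw [norm_mul, norm_pow, norm_exp_vline_mul, mul_comm]
    gcongr
    · exact one_le_norm_vline ω
    · norm_num
  have hF : Integrable (Function.uncurry fun (s : ℝ) (ω : ℝ) =>
      (((s ^ (1 - α) : ℝ) : ℂ) * exp (-(vline ω * s))) * g ω)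
      ((volume.restrict (Set.Ioi 0)).prod volume) := by
    have hprod := (integrableOn_rpow_mul_exp_neg (a := 1 - α) (by linarith) one_pos).mul_prod
      hgi.norm
    refine hprod.mono' ?_ ?_
    · refine AEStronglyMeasurable.mul (AEStronglyMeasurable.mul ?_ ?_) ?_
      · have : Measurable fun z : ℝ × ℝ => ((z.1 ^ (1 - α) : ℝ) : ℂ) := by fun_prop
        exact this.aestronglyMeasurable
      · exact Continuous.aestronglyMeasurable (by fun_prop)
      · exact hgi.aestronglyMeasurable.comp_snd
    · have : ∀ᵐ z ∂((volume.restrict (Set.Ioi (0 : ℝ))).prod (volume : Measure ℝ)), 0 < z.1 := by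
        have := self_mem_ae_restrict (μ := (volume : Measure ℝ)) (measurableSet_Ioi (a := (0 : ℝ)))
        exact Measure.quasiMeasurePreserving_fst.ae this
      filter_upwards [this] with z hz
      simp only [Function.uncurry]
      rw [norm_mul, norm_rpow_mul_cexp _ _ hz, vline_re]
  calc _ = ∫ s in Set.Ioi (0 : ℝ), ∫ ω, (((s ^ (1 - α) : ℝ) : ℂ) * exp (-(vline ω * s))) * g ω := by
        refine integral_congr_ae (Eventually.of_forall fun s => ?_)
        simp only
        rw [← integral_const_mul]
        refine integral_congr_ae (Eventually.of_forall fun ω => ?_)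
        have : exp (vline ω * ((x - s : ℝ) : ℂ)) = exp (vline ω * x) * exp (-(vline ω * s)) := by
          rw [← exp_add]; congr 1; push_cast; ring
        simp only [hg, this]
        ring
    _ = ∫ ω, ∫ s in Set.Ioi (0 : ℝ), (((s ^ (1 - α) : ℝ) : ℂ) * exp (-(vline ω * s))) * g ω :=
        integral_integral_swap hF
    _ = ∫ ω, Real.Gamma (2 - α) * (V ω * (exp (vline ω * x) * vline ω ^ (α : ℂ))) := by
        refine integral_congr_ae (Eventually.of_forall fun ω => ?_)
        have hz : 0 < (vline ω).re := by simp
        have hz0 : vline ω ≠ 0 := fun h => by simp [h] at hz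
        have h1 := integral_rpow_mul_cexp_neg (a := 2 - α) (by linarith) hz
        rw [show 2 - α - 1 = 1 - α by ring] at h1
        simp only
        rw [integral_mul_const, h1]
        have : vline ω ^ (-((2 - α : ℝ) : ℂ)) * vline ω ^ 2 = vline ω ^ (α : ℂ) := by
          rw [← cpow_natCast, ← cpow_add _ _ hz0]
          congr 1
          push_cast
          ring
        simp only [hg]
        rw [← this]
        ring
    _ = _ := integral_const_mul _ _

theorem cpow_vline_mul (α : ℝ) (ω : ℝ) {h : ℝ} (hh : 0 < h) :
    (vline ω * h) ^ (α : ℂ) = ((h ^ α : ℝ) : ℂ) * vline ω ^ (α : ℂ) := by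
  have hz0 : vline ω ≠ 0 := fun h => by simpa [h] using vline_re ω
  have hh0 : (h : ℂ) ≠ 0 := ofReal_ne_zero.2 hh.ne'
  rw [ofReal_cpow hh.le, mul_comm, cpow_def_of_ne_zero (mul_ne_zero hh0 hz0), log_ofReal_mul hh hz0,
    cpow_def_of_ne_zero hh0, cpow_def_of_ne_zero hz0, ← exp_add, ofReal_log hh.le]
  congr 1
  ring

/-- Third order consistency of the compact difference approximation for compactly supported
functions of class `C⁷` on the line, with the seventh derivative explicit in the bound. The sequence `v`
lists the function and its derivatives. -/
theorem exists_consistency_line (s : Shifts) {α : ℝ} (h1 : 1 ≤ α) (h2 : α < 2) {A B : ℝ}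
    (hAB : A ≤ B) (H : ℝ) :
    ∃ C, 0 ≤ C ∧ ∀ (M : ℝ) (v : ℕ → ℝ → ℂ),
      (∀ k < 7, ∀ x, HasDerivAt (v k) (v (k + 1) x) x) → Continuous (v 7) →
      (∀ k ≤ 7, ∀ x, x ∉ Set.Icc A B → v k x = 0) → (∀ x, ‖v 7 x‖ ≤ M) →
      ∀ J : ℝ → ℂ, (∀ x, J x = (Real.Gamma (2 - α) : ℂ)⁻¹
        * ∫ s in Set.Ioi (0 : ℝ), ((s ^ (1 - α) : ℝ) : ℂ) * v 2 (x - s)) →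
      ∀ h, 0 < h → h ≤ H → ∀ x ≤ B, ∀ S,
        HasSum (fun k : ℕ => (weight s α k : ℂ) * v 0 (x - ((k : ℝ) - 1) * h)) S →
        ‖((h ^ α : ℝ) : ℂ)⁻¹ * S
          - (J x + compactCoeff s α * (J (x - h) - 2 * J x + J (x + h)))‖ ≤ C * M * h ^ 3 := by
  obtain ⟨C, hC0, hC⟩ := exists_norm_symbol_sub_le s h1 h2.le H
  refine ⟨Real.exp B * C * ((B - A) * Real.exp (-A)) * ∫ ω : ℝ, (1 + ω ^ 2)⁻¹, ?_, ?_⟩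
  · have : 0 ≤ ∫ ω : ℝ, (1 + ω ^ 2)⁻¹ := integral_nonneg fun ω => by positivity
    have : 0 ≤ B - A := by linarith
    positivity
  intro M v hd hc hs hM J hJ h hh hhH x hx S hS
  obtain ⟨V, hV, hVD, hv⟩ := exists_bromwich hAB v hd hc hs hM
  have hvc := continuous_vline
  have hM0 : 0 ≤ M := (norm_nonneg _).trans (hM 0)
  have hBA : 0 ≤ B - A := by linarith
  have hΓ : (Real.Gamma (2 - α) : ℂ) ≠ 0 :=
    ofReal_ne_zero.2 (Real.Gamma_pos_of_pos (by linarith)).ne'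
  have hz : ∀ ω, 0 < (vline ω).re := fun ω => by simp
  have hJ' : ∀ y, J y = ∫ ω, V ω * (exp (vline ω * y) * vline ω ^ (α : ℂ)) := by
    intro y
    rw [hJ]
    simp only [hv 2 le_rfl]
    rw [integral_rpow_mul_bromwich h2 hV hVD, ← mul_assoc, inv_mul_cancel₀ hΓ, one_mul]
  have hS' : S = ∫ ω, V ω * (exp (vline ω * x) * symbol s α (vline ω * h)) := by
    have := hasSum_weight_bromwich s α hV hVD hh x
    refine hS.unique (this.congr_fun fun k => ?_)
    rw [hv 0 (by norm_num)]
    simp only [pow_zero, mul_one]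
  have hcpow : Continuous fun ω => vline ω ^ (α : ℂ) :=
    hvc.cpow continuous_const fun ω => Or.inl (hz ω)
  have hJi : ∀ y : ℝ, Integrable fun ω => V ω * (exp (vline ω * y) * vline ω ^ (α : ℂ)) := by
    intro y
    refine integrable_density_mul hV hVD (by fun_prop) (c := Real.exp y) fun ω => ?_
    rw [norm_mul, norm_exp_vline_mul, norm_cpow_real]
    gcongr
    calc ‖vline ω‖ ^ α ≤ ‖vline ω‖ ^ (5 : ℝ) :=
          Real.rpow_le_rpow_of_exponent_le (one_le_norm_vline ω) (by linarith)
      _ = ‖vline ω‖ ^ 5 := by exact_mod_cast Real.rpow_natCast _ 5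
  have hsym : ∀ ω, ‖symbol s α (vline ω * h)
      - (vline ω * h) ^ (α : ℂ) * compactSymbol s α (vline ω * h)‖
      ≤ C * ‖vline ω * h‖ ^ (α + 3) := fun ω =>
    hC _ (by rw [re_vline_mul]; exact hh) (by rw [re_vline_mul]; exact hhH)
  have hha : (0 : ℝ) < h ^ α := Real.rpow_pos_of_pos hh _
  have hhac : ((h ^ α : ℝ) : ℂ) ≠ 0 := ofReal_ne_zero.2 hha.ne'
  have hcs : J x + compactCoeff s α * (J (x - h) - 2 * J x + J (x + h))
      = ∫ ω, V ω * (exp (vline ω * x) * (vline ω ^ (α : ℂ) * compactSymbol s α (vline ω * h))) := by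
    set P : ℝ → ℝ → ℂ := fun y ω => V ω * (exp (vline ω * y) * vline ω ^ (α : ℂ)) with hP
    have i1 : Integrable fun ω => P (x - h) ω - 2 * P x ω := (hJi _).sub ((hJi _).const_mul _)
    have i2 : Integrable fun ω => P (x - h) ω - 2 * P x ω + P (x + h) ω := i1.add (hJi _)
    rw [hJ', hJ', hJ', ← integral_const_mul, ← integral_sub (hJi _) ((hJi _).const_mul _),
      ← integral_add i1 (hJi _), ← integral_const_mul, ← integral_add (hJi _) (i2.const_mul _)]
    refine integral_congr_ae (Eventually.of_forall fun ω => ?_)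
    have e1 : exp (vline ω * ((x - h : ℝ) : ℂ)) = exp (vline ω * x) * exp (-(vline ω * h)) := by
      rw [← exp_add]; congr 1; push_cast; ring
    have e2 : exp (vline ω * ((x + h : ℝ) : ℂ)) = exp (vline ω * x) * exp (vline ω * h) := by
      rw [← exp_add]; congr 1; push_cast; ring
    simp only [hP, e1, e2, compactSymbol]
    ring
  have hsymc : Continuous fun ω => symbol s α (vline ω * h) := by
    unfold symbol
    have : Continuous fun ω => (1 - exp (-(vline ω * h))) ^ (α : ℂ) := by
      refine Continuous.cpow (by fun_prop) continuous_const fun ω => Or.inl ?_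
      have h3 : ‖exp (-(vline ω * h))‖ < 1 := by
        rw [norm_exp, neg_re, re_vline_mul, Real.exp_lt_one_iff]; linarith
      have := (abs_le.1 (abs_re_le_norm (exp (-(vline ω * h))))).2
      simp only [sub_re, one_re]
      linarith
    fun_prop
  have hcsi : Integrable fun ω => V ω * (exp (vline ω * x)
      * (vline ω ^ (α : ℂ) * compactSymbol s α (vline ω * h))) := by
    have := (hJi x).add ((((hJi (x - h)).sub ((hJi x).const_mul 2)).add (hJi (x + h))).const_mul
      (compactCoeff s α : ℂ))
    refine this.congr (Eventually.of_forall fun ω => ?_)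
    have e1 : exp (vline ω * ((x - h : ℝ) : ℂ)) = exp (vline ω * x) * exp (-(vline ω * h)) := by
      rw [← exp_add]; congr 1; push_cast; ring
    have e2 : exp (vline ω * ((x + h : ℝ) : ℂ)) = exp (vline ω * x) * exp (vline ω * h) := by
      rw [← exp_add]; congr 1; push_cast; ring
    simp only [Pi.add_apply, Pi.sub_apply, e1, e2, compactSymbol]
    ring
  -- the seven powers of decay pay for `α + 3 ≤ 5` powers and leave an integrable `‖z‖⁻²`
  have hdiff : ∀ ω, ‖((h ^ α : ℝ) : ℂ)⁻¹ * (V ω * (exp (vline ω * x) * symbol s α (vline ω * h)))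
      - V ω * (exp (vline ω * x) * (vline ω ^ (α : ℂ) * compactSymbol s α (vline ω * h)))‖
      ≤ Real.exp B * C * ((B - A) * Real.exp (-A)) * M * h ^ 3 * (1 + ω ^ 2)⁻¹ := by
    intro ω
    have hp : 0 < ‖vline ω‖ := zero_lt_one.trans_le (one_le_norm_vline ω)
    have e : ((h ^ α : ℝ) : ℂ)⁻¹ * (V ω * (exp (vline ω * x) * symbol s α (vline ω * h)))
      - V ω * (exp (vline ω * x) * (vline ω ^ (α : ℂ) * compactSymbol s α (vline ω * h)))
      = ((h ^ α : ℝ) : ℂ)⁻¹ * V ω * exp (vline ω * x) * (symbol s α (vline ω * h)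
        - (vline ω * h) ^ (α : ℂ) * compactSymbol s α (vline ω * h)) := by
      rw [cpow_vline_mul α ω hh]
      field_simp
    rw [e, norm_mul, norm_mul, norm_mul, norm_exp_vline_mul, norm_inv, norm_real,
      Real.norm_of_nonneg hha.le]
    have hb := hsym ω
    rw [norm_mul, norm_real, Real.norm_of_nonneg hh.le, Real.mul_rpow hp.le hh.le,
      Real.rpow_add hh, show (3 : ℝ) = ((3 : ℕ) : ℝ) by norm_num, Real.rpow_natCast] at hb
    calc (h ^ α)⁻¹ * ‖V ω‖ * Real.exp x * _
        ≤ (h ^ α)⁻¹ * ((B - A) * Real.exp (-A) * M * ‖vline ω‖⁻¹ ^ 7) * Real.exp B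
          * (C * (‖vline ω‖ ^ (α + ((3 : ℕ) : ℝ)) * (h ^ α * h ^ 3))) := by
          gcongr
          exact hVD ω
      _ = Real.exp B * C * ((B - A) * Real.exp (-A)) * M * h ^ 3
          * (‖vline ω‖⁻¹ ^ 7 * ‖vline ω‖ ^ (α + ((3 : ℕ) : ℝ))) := by
          field_simp
      _ ≤ Real.exp B * C * ((B - A) * Real.exp (-A)) * M * h ^ 3
          * (‖vline ω‖⁻¹ ^ 7 * ‖vline ω‖ ^ ((5 : ℕ) : ℝ)) := by
          gcongr
          · exact one_le_norm_vline ω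
          · push_cast; linarith
      _ = Real.exp B * C * ((B - A) * Real.exp (-A)) * M * h ^ 3 * (‖vline ω‖ ^ 2)⁻¹ := by
          rw [Real.rpow_natCast]
          field_simp
      _ ≤ _ := by
          gcongr
          exact one_add_sq_le_norm_vline_sq ω
  have hSi : Integrable fun ω => ((h ^ α : ℝ) : ℂ)⁻¹
      * (V ω * (exp (vline ω * x) * symbol s α (vline ω * h))) := by
    -- the symbol differs from a function with integrable superposition by an integrable error
    have hmeas : Continuous fun ω => ((h ^ α : ℝ) : ℂ)⁻¹
      * (V ω * (exp (vline ω * x) * symbol s α (vline ω * h)))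
      - V ω * (exp (vline ω * x) * (vline ω ^ (α : ℂ) * compactSymbol s α (vline ω * h))) := by
      unfold compactSymbol
      fun_prop
    have := ((integrable_inv_one_add_sq.const_mul _).mono' hmeas.aestronglyMeasurable
      (Eventually.of_forall hdiff)).add hcsi
    refine this.congr (Eventually.of_forall fun ω => ?_)
    simp only [Pi.add_apply, sub_add_cancel]
  rw [hS', hcs, ← integral_const_mul, ← integral_sub hSi hcsi]
  refine (norm_integral_le_of_norm_le (integrable_inv_one_add_sq.const_mul _)
    (Eventually.of_forall hdiff)).trans_eq ?_
  rw [integral_const_mul]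
  ring

end Consistency

/-! ### Consistency and boundedness on an interval -/

section Interval

open MeasureTheory Filter Topology

/-- Fractional integral of order `2 - α` from the left, over the memory length `L`. Applied to the
second derivative of a function that vanishes to the left of the interval, it is the left
Riemann-Liouville derivative of order `α`; unlike that derivative, it makes sense (and is continuous)
at the end points of the interval. -/
def leftFrac (α L : ℝ) (w : ℝ → ℝ) (x : ℝ) : ℝ :=
  (Real.Gamma (2 - α))⁻¹ * ∫ s in Set.Ioc 0 L, s ^ (1 - α) * w (x - s)

/-- Fractional integral of order `2 - α` from the right, over the memory length `L`. -/
def rightFrac (α L : ℝ) (w : ℝ → ℝ) (x : ℝ) : ℝ :=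
  (Real.Gamma (2 - α))⁻¹ * ∫ s in Set.Ioc 0 L, s ^ (1 - α) * w (x + s)

/-- A cutoff equal to `1` up to `b + 1 / 2` and to `0` from `b + 1` on. -/
def cutoff (b x : ℝ) : ℝ := Real.smoothTransition (2 * (b + 1 - x))

theorem contDiff_cutoff (b : ℝ) {n : ℕ} : ContDiff ℝ n (cutoff b) :=
  Real.smoothTransition.contDiff.comp (by fun_prop)

theorem cutoff_eq_one {b x : ℝ} (hx : x ≤ b + 1 / 2) : cutoff b x = 1 :=
  Real.smoothTransition.one_of_one_le (by linarith)

theorem cutoff_eq_zero {b x : ℝ} (hx : b + 1 ≤ x) : cutoff b x = 0 :=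
  Real.smoothTransition.zero_of_nonpos (by linarith)

/-- Leibniz rule for the cutoff. -/
theorem exists_abs_iteratedDeriv_cutoff_mul_le (a b : ℝ) :
    ∃ C, 0 ≤ C ∧ ∀ (M : ℝ) (v : ℝ → ℝ), ContDiff ℝ 7 v →
      (∀ k ≤ 7, ∀ x ∈ Set.Icc a (b + 1), |iteratedDeriv k v x| ≤ M) →
      ∀ x ∈ Set.Icc a (b + 1), |iteratedDeriv 7 (fun x => cutoff b x * v x) x| ≤ C * M := by
  have hK : ∀ i : ℕ, ∃ K, ∀ x ∈ Set.Icc a (b + 1), ‖iteratedDeriv i (cutoff b) x‖ ≤ K := fun i =>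
    isCompact_Icc.exists_bound_of_continuousOn
      ((contDiff_cutoff b (n := i)).continuous_iteratedDeriv i le_rfl).continuousOn
  choose K hK using hK
  refine ⟨∑ i ∈ range 8, (Nat.choose 7 i : ℝ) * |K i|, by positivity, fun M v hv hM x hx => ?_⟩
  rw [← Real.norm_eq_abs, ← norm_iteratedFDeriv_eq_norm_iteratedDeriv]
  refine (norm_iteratedFDeriv_mul_le (N := 7) (contDiff_cutoff b (n := 7)) hv x le_rfl).trans ?_
  rw [sum_mul]
  refine sum_le_sum fun i hi => ?_
  rw [norm_iteratedFDeriv_eq_norm_iteratedDeriv, norm_iteratedFDeriv_eq_norm_iteratedDeriv]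
  gcongr
  · exact (hK i x hx).trans (le_abs_self _)
  · exact hM _ (Nat.sub_le _ _) x hx

theorem iteratedDeriv_eq_zero_of_eventuallyEq {f : ℝ → ℝ} {x : ℝ} (h : f =ᶠ[𝓝 x] fun _ => 0)
    (k : ℕ) : iteratedDeriv k f x = 0 := by
  rw [h.iteratedDeriv_eq]
  simp

theorem iteratedDeriv_eq_zero_of_lt {v : ℝ → ℝ} {a x : ℝ} (hv : ∀ x ≤ a, v x = 0) (hx : x < a)
    (k : ℕ) : iteratedDeriv k v x = 0 :=
  iteratedDeriv_eq_zero_of_eventuallyEq (by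
    filter_upwards [gt_mem_nhds hx] with y hy
    exact hv y hy.le) k

/-- Consistency of the left operator for smooth functions vanishing to the left of the interval. The
function is cut off to the right of the interval, where the operator does not see it. -/
theorem exists_left_consistency (s : Shifts) {α : ℝ} (h1 : 1 ≤ α) (h2 : α < 2) {a b : ℝ}
    (hab : a < b) :
    ∃ C, 0 ≤ C ∧ ∀ (M : ℝ) (v : ℝ → ℝ), ContDiff ℝ 7 v →
      (∀ k ≤ 7, ∀ x ∈ Set.Icc a (b + 1), |iteratedDeriv k v x| ≤ M) → (∀ x ≤ a, v x = 0) →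
      ∀ (N : ℕ) (h : ℝ), 0 < h → N * h = b - a → ∀ i, 1 ≤ i → i < N →
        |leftWSGD s α h (fun m => v (a + m * h)) i
          - compactOp s α h (fun m => leftFrac α (b - a) (iteratedDeriv 2 v) (a + m * h)) i|
          ≤ C * M * h ^ 3 := by
  obtain ⟨C₁, hC₁, hcut⟩ := exists_abs_iteratedDeriv_cutoff_mul_le a b
  obtain ⟨C₂, hC₂, hcons⟩ :=
    exists_consistency_line s h1 h2 (show a ≤ b + 1 by linarith) (b - a)
  refine ⟨C₂ * C₁, by positivity, fun M v hv hM hva N h hh hN i hi1 hiN => ?_⟩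
  set g : ℝ → ℝ := fun x => cutoff b x * v x with hg
  have hgc : ContDiff ℝ 7 g := (contDiff_cutoff b (n := 7)).mul hv
  have hga : ∀ x ≤ a, g x = 0 := fun x hx => by simp [hg, hva x hx]
  have hgz : ∀ k x, x ∉ Set.Icc a (b + 1) → iteratedDeriv k g x = 0 := by
    intro k x hx
    rw [Set.mem_Icc, not_and_or, not_le, not_le] at hx
    rcases hx with hx | hx
    · exact iteratedDeriv_eq_zero_of_lt hga hx k
    · refine iteratedDeriv_eq_zero_of_eventuallyEq ?_ k
      filter_upwards [lt_mem_nhds hx] with y hy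
      simp [hg, cutoff_eq_zero (le_of_lt hy)]
  have hgv : ∀ x ≤ b, g x = v x := fun x hx => by
    simp only [hg]
    rw [cutoff_eq_one (by linarith), one_mul]
  have hgv2 : ∀ x ≤ b, iteratedDeriv 2 g x = iteratedDeriv 2 v x := fun x hx => by
    refine Filter.EventuallyEq.iteratedDeriv_eq 2 ?_
    filter_upwards [gt_mem_nhds (show x < b + 1 / 2 by linarith)] with y hy
    simp only [hg]
    rw [cutoff_eq_one (le_of_lt hy), one_mul]
  have hM0 : 0 ≤ M := (abs_nonneg _).trans (hM 0 (by norm_num) a ⟨le_rfl, by linarith⟩)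
  have key := hcons (C₁ * M) (fun k x => ((iteratedDeriv k g x : ℝ) : ℂ)) ?_ ?_ ?_ ?_
    (fun x => (Real.Gamma (2 - α) : ℂ)⁻¹
      * ∫ s in Set.Ioi (0 : ℝ), ((s ^ (1 - α) : ℝ) : ℂ) * ((iteratedDeriv 2 g (x - s) : ℝ) : ℂ))
    (fun x => rfl) h hh ?_ (a + i * h) ?_
  rotate_left
  · intro k hk x
    rw [iteratedDeriv_succ]
    have hlt : (k : WithTop ℕ∞) < 7 := by exact_mod_cast hk
    exact ((hgc.differentiable_iteratedDeriv k hlt) x).hasDerivAt.ofReal_comp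
  · exact Complex.continuous_ofReal.comp (hgc.continuous_iteratedDeriv 7 le_rfl)
  · intro k _ x hx
    rw [hgz k x hx, Complex.ofReal_zero]
  · intro x
    rw [Complex.norm_real, Real.norm_eq_abs]
    by_cases hx : x ∈ Set.Icc a (b + 1)
    · exact hcut M v hv hM x hx
    · rw [hgz 7 x hx, abs_zero]; positivity
  · have : (1 : ℝ) ≤ N := by exact_mod_cast (by omega : 1 ≤ N)
    nlinarith
  · have : (i : ℝ) ≤ N := by exact_mod_cast hiN.le
    nlinarith
  -- the fractional integrals of the truncated function on the interval
  have hJ : ∀ x ∈ Set.Icc a b, (Real.Gamma (2 - α) : ℂ)⁻¹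
      * ∫ s in Set.Ioi (0 : ℝ), ((s ^ (1 - α) : ℝ) : ℂ) * ((iteratedDeriv 2 g (x - s) : ℝ) : ℂ)
      = ((leftFrac α (b - a) (iteratedDeriv 2 v) x : ℝ) : ℂ) := by
    intro x hx
    have e : ∀ s : ℝ, ((s ^ (1 - α) : ℝ) : ℂ) * ((iteratedDeriv 2 g (x - s) : ℝ) : ℂ)
        = ((s ^ (1 - α) * iteratedDeriv 2 g (x - s) : ℝ) : ℂ) := fun s => by push_cast; rfl
    simp only [e]
    rw [integral_complex_ofReal, leftFrac, Complex.ofReal_mul, Complex.ofReal_inv]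
    congr 2
    rw [setIntegral_eq_of_subset_of_forall_sdiff_eq_zero measurableSet_Ioi
      (show Set.Ioc 0 (b - a) ⊆ Set.Ioi (0 : ℝ) from Set.Ioc_subset_Ioi_self)]
    · refine setIntegral_congr_fun measurableSet_Ioc fun s hs => ?_
      rw [hgv2 _ (by linarith [hs.1, hx.2])]
    · intro s hs
      have h1 : 0 < s := hs.1
      have h2 : b - a < s := by
        by_contra h
        exact hs.2 ⟨h1, not_lt.1 h⟩
      rw [iteratedDeriv_eq_zero_of_lt hga (by linarith [hx.2]), mul_zero]
  have hgrid : ∀ m : ℕ, m ≤ N → a + m * h ∈ Set.Icc a b := fun m hm => by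
    have : (m : ℝ) ≤ N := by exact_mod_cast hm
    constructor <;> nlinarith [mul_nonneg m.cast_nonneg hh.le]
  have hsum : HasSum (fun k : ℕ => (weight s α k : ℂ)
      * ((iteratedDeriv 0 g (a + i * h - ((k : ℝ) - 1) * h) : ℝ) : ℂ))
      (((∑ k ∈ range (i + 2), weight s α k * v (a + ((i + 1 - k : ℕ) : ℝ) * h) : ℝ)) : ℂ) := by
    have e : ((∑ k ∈ range (i + 2), weight s α k * v (a + ((i + 1 - k : ℕ) : ℝ) * h) : ℝ) : ℂ)
        = ∑ k ∈ range (i + 2), (weight s α k : ℂ)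
          * ((iteratedDeriv 0 g (a + i * h - ((k : ℝ) - 1) * h) : ℝ) : ℂ) := by
      push_cast
      refine sum_congr rfl fun k hk => ?_
      rw [mem_range] at hk
      have e1 : a + i * h - ((k : ℝ) - 1) * h = a + ((i + 1 - k : ℕ) : ℝ) * h := by
        rw [Nat.cast_sub (by omega)]; push_cast; ring
      rw [e1, iteratedDeriv_zero, hgv _ (hgrid _ (by omega)).2]
    rw [e]
    refine hasSum_sum_of_ne_finset_zero fun k hk => ?_
    rw [mem_range, not_lt] at hk
    have : (i : ℝ) + 2 ≤ k := by exact_mod_cast hk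
    rw [iteratedDeriv_zero, hga _ (by nlinarith), Complex.ofReal_zero, mul_zero]
  have hfin := key _ hsum
  have ei1 : a + i * h - h = a + ((i - 1 : ℕ) : ℝ) * h := by
    rw [Nat.cast_sub hi1]; push_cast; ring
  have ei2 : a + i * h + h = a + ((i + 1 : ℕ) : ℝ) * h := by push_cast; ring
  rw [ei1, ei2, hJ _ (hgrid i hiN.le), hJ _ (hgrid (i - 1) (by omega)),
    hJ _ (hgrid (i + 1) hiN)] at hfin
  have e : |leftWSGD s α h (fun m => v (a + m * h)) i
      - compactOp s α h (fun m => leftFrac α (b - a) (iteratedDeriv 2 v) (a + m * h)) i|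
      = ‖((leftWSGD s α h (fun m => v (a + m * h)) i
      - compactOp s α h (fun m => leftFrac α (b - a) (iteratedDeriv 2 v) (a + m * h)) i : ℝ) : ℂ)‖ := by
    rw [Complex.norm_real, Real.norm_eq_abs]
  rw [e]
  refine le_of_eq_of_le ?_ (hfin.trans_eq (by ring))
  congr 1
  unfold leftWSGD compactOp centralDiff
  have hc : ∀ x : ℝ, compactCoeff s α * h ^ 2 * (x / h ^ 2) = compactCoeff s α * x := fun x => by
    field_simp
  rw [hc, one_div]
  push_cast
  ring

theorem leftFrac_reflect (α L c : ℝ) (w : ℝ → ℝ) (x : ℝ) :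
    leftFrac α L (fun y => w (c - y)) (c - x) = rightFrac α L w x := by
  unfold leftFrac rightFrac
  congr 2
  funext s
  simp only [show c - (c - x - s) = x + s by ring]

theorem compactOp_reflect (s : Shifts) (α h : ℝ) (v : ℕ → ℝ) {N i : ℕ} (hi1 : 1 ≤ i) (hi : i < N) :
    compactOp s α h (fun m => v (N - m)) (N - i) = compactOp s α h v i := by
  unfold compactOp centralDiff
  simp only [show N - (N - i) = i by omega, show N - (N - i - 1) = i + 1 by omega,
    show N - (N - i + 1) = i - 1 by omega]
  ring

theorem compactOp_congr (s : Shifts) (α h : ℝ) {v w : ℕ → ℝ} {i : ℕ} (h0 : v (i - 1) = w (i - 1))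
    (h1 : v i = w i) (h2 : v (i + 1) = w (i + 1)) : compactOp s α h v i = compactOp s α h w i := by
  unfold compactOp centralDiff
  rw [h0, h1, h2]

theorem leftWSGD_congr (s : Shifts) (α h : ℝ) {v w : ℕ → ℝ} {i : ℕ} (hvw : ∀ m ≤ i + 1, v m = w m) :
    leftWSGD s α h v i = leftWSGD s α h w i := by
  unfold leftWSGD
  congr 1
  exact sum_congr rfl fun k _ => by rw [hvw _ (by omega)]

theorem grid_reflect {a b h : ℝ} {N m : ℕ} (hN : N * h = b - a) (hm : m ≤ N) :
    a + b - (a + m * h) = a + ((N - m : ℕ) : ℝ) * h := by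
  rw [Nat.cast_sub hm]; linarith

theorem exists_right_consistency (s : Shifts) {α : ℝ} (h1 : 1 ≤ α) (h2 : α < 2) {a b : ℝ}
    (hab : a < b) :
    ∃ C, 0 ≤ C ∧ ∀ (M : ℝ) (v : ℝ → ℝ), ContDiff ℝ 7 v →
      (∀ k ≤ 7, ∀ x ∈ Set.Icc (a - 1) b, |iteratedDeriv k v x| ≤ M) → (∀ x ≥ b, v x = 0) →
      ∀ (N : ℕ) (h : ℝ), 0 < h → N * h = b - a → ∀ i, 1 ≤ i → i < N →
        |rightWSGD s α h N (fun m => v (a + m * h)) i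
          - compactOp s α h (fun m => rightFrac α (b - a) (iteratedDeriv 2 v) (a + m * h)) i|
          ≤ C * M * h ^ 3 := by
  obtain ⟨C, hC, hleft⟩ := exists_left_consistency s h1 h2 hab
  refine ⟨C, hC, fun M v hv hM hvb N h hh hN i hi1 hiN => ?_⟩
  have hk : ∀ k, iteratedDeriv k (fun x => v (a + b - x))
      = fun x => (-1 : ℝ) ^ k • iteratedDeriv k v (a + b - x) := fun k => by
    rw [iteratedDeriv_comp_const_sub]
  have key := hleft M (fun x => v (a + b - x)) (hv.comp (by fun_prop)) ?_ ?_ N h hh hN (N - i)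
    (by omega) (by omega)
  rotate_left
  · intro k hk7 x hx
    rw [hk]
    simp only [smul_eq_mul, abs_mul, abs_pow, abs_neg, abs_one, one_pow, one_mul]
    exact hM k hk7 _ ⟨by linarith [hx.2], by linarith [hx.1]⟩
  · exact fun x hx => hvb _ (by linarith)
  rw [rightWSGD_eq_leftWSGD s α h N _ i hi1 hiN,
    ← compactOp_reflect s α h (fun m => rightFrac α (b - a) (iteratedDeriv 2 v) (a + m * h)) hi1 hiN]
  have e1 : leftWSGD s α h (fun m : ℕ => v (a + b - (a + m * h))) (N - i)
      = leftWSGD s α h (fun m : ℕ => v (a + ((N - m : ℕ) : ℝ) * h)) (N - i) :=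
    leftWSGD_congr s α h fun m hm => by rw [grid_reflect hN (by omega)]
  have e2 : ∀ m ≤ N, leftFrac α (b - a) (iteratedDeriv 2 fun x => v (a + b - x)) (a + m * h)
      = rightFrac α (b - a) (iteratedDeriv 2 v) (a + ((N - m : ℕ) : ℝ) * h) := by
    intro m hm
    rw [← leftFrac_reflect α (b - a) (a + b), hk, ← grid_reflect hN hm, sub_sub_cancel]
    simp
  have e3 : compactOp s α h (fun m : ℕ => leftFrac α (b - a)
        (iteratedDeriv 2 fun x => v (a + b - x)) (a + m * h)) (N - i)
      = compactOp s α h (fun m : ℕ => rightFrac α (b - a) (iteratedDeriv 2 v)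
        (a + ((N - m : ℕ) : ℝ) * h)) (N - i) :=
    compactOp_congr s α h (e2 _ (by omega)) (e2 _ (by omega)) (e2 _ (by omega))
  rw [e1, e3] at key
  exact key

/-- The two-sided difference operator in one variable. -/
def twoSided (K₁ K₂ : ℝ) (s : Shifts) (α h : ℝ) (N : ℕ) (v : ℕ → ℝ) (i : ℕ) : ℝ :=
  K₁ * leftWSGD s α h v i + K₂ * rightWSGD s α h N v i

/-- The two-sided fractional integral of order `2 - α`, which gives the two-sided derivative of
order `α` when applied to a second derivative. -/
def twoSidedFrac (K₁ K₂ α L : ℝ) (w : ℝ → ℝ) (x : ℝ) : ℝ :=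
  K₁ * leftFrac α L w x + K₂ * rightFrac α L w x

theorem compactOp_linear (s : Shifts) (α h K₁ K₂ : ℝ) (v w : ℕ → ℝ) (i : ℕ) :
    compactOp s α h (fun m => K₁ * v m + K₂ * w m) i
      = K₁ * compactOp s α h v i + K₂ * compactOp s α h w i := by
  unfold compactOp centralDiff
  ring

/-- A function vanishing beyond each end from which an operator with nonzero coefficient starts. -/
def VanishesBeyond (K₁ K₂ a b : ℝ) (v : ℝ → ℝ) : Prop :=
  (K₁ ≠ 0 → ∀ x ≤ a, v x = 0) ∧ (K₂ ≠ 0 → ∀ x ≥ b, v x = 0)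

theorem exists_twoSided_consistency (s : Shifts) (K₁ K₂ : ℝ) {α : ℝ} (h1 : 1 ≤ α) (h2 : α < 2)
    {a b : ℝ} (hab : a < b) :
    ∃ C, 0 ≤ C ∧ ∀ (M : ℝ) (v : ℝ → ℝ), ContDiff ℝ 7 v →
      (∀ k ≤ 7, ∀ x ∈ Set.Icc (a - 1) (b + 1), |iteratedDeriv k v x| ≤ M) →
      VanishesBeyond K₁ K₂ a b v →
      ∀ (N : ℕ) (h : ℝ), 0 < h → N * h = b - a → ∀ i, 1 ≤ i → i < N →
        |twoSided K₁ K₂ s α h N (fun m => v (a + m * h)) i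
          - compactOp s α h
            (fun m => twoSidedFrac K₁ K₂ α (b - a) (iteratedDeriv 2 v) (a + m * h)) i|
          ≤ C * M * h ^ 3 := by
  obtain ⟨C₁, hC₁, hl⟩ := exists_left_consistency s h1 h2 hab
  obtain ⟨C₂, hC₂, hr⟩ := exists_right_consistency s h1 h2 hab
  refine ⟨|K₁| * C₁ + |K₂| * C₂, by positivity, fun M v hv hM hvan N h hh hN i hi1 hiN => ?_⟩
  have hM0 : 0 ≤ M :=
    (abs_nonneg _).trans (hM 0 (by norm_num) a ⟨by linarith, by linarith⟩)
  unfold twoSidedFrac twoSided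
  rw [compactOp_linear, add_sub_add_comm, ← mul_sub, ← mul_sub]
  refine (abs_add_le _ _).trans ?_
  rw [abs_mul, abs_mul, show (|K₁| * C₁ + |K₂| * C₂) * M * h ^ 3
    = |K₁| * (C₁ * M * h ^ 3) + |K₂| * (C₂ * M * h ^ 3) by ring]
  refine add_le_add ?_ ?_
  · rcases eq_or_ne K₁ 0 with h0 | h0
    · simp [h0]
    · gcongr
      exact hl M v hv (fun k hk x hx => hM k hk x ⟨by linarith [hx.1], hx.2⟩) (hvan.1 h0) N h hh hN
        i hi1 hiN
  · rcases eq_or_ne K₂ 0 with h0 | h0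
    · simp [h0]
    · gcongr
      exact hr M v hv (fun k hk x hx => hM k hk x ⟨hx.1, by linarith [hx.2]⟩) (hvan.2 h0) N h hh hN
        i hi1 hiN

theorem abs_sub_sub_deriv_mul_le {p p' p'' : ℝ → ℝ} (hp : ∀ x, HasDerivAt p (p' x) x)
    (hp' : ∀ x, HasDerivAt p' (p'' x) x) {a b B : ℝ} (hB : ∀ x ∈ Set.Icc a b, |p'' x| ≤ B)
    {x y : ℝ} (hx : x ∈ Set.Icc a b) (hy : y ∈ Set.Icc a b) :
    |p y - p x - p' x * (y - x)| ≤ B * (y - x) ^ 2 := by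
  have hsub : Set.uIcc x y ⊆ Set.Icc a b := Set.uIcc_subset_Icc hx hy
  have hB0 : 0 ≤ B := (abs_nonneg _).trans (hB x hx)
  have hlip : ∀ z ∈ Set.uIcc x y, |p' z - p' x| ≤ B * |y - x| := by
    intro z hz
    have h := (convex_uIcc x y).norm_image_sub_le_of_norm_hasDerivWithin_le
      (fun w _ => (hp' w).hasDerivWithinAt) (fun w hw => hB w (hsub hw)) Set.left_mem_uIcc hz
    rw [Real.norm_eq_abs, Real.norm_eq_abs] at h
    refine h.trans (mul_le_mul_of_nonneg_left ?_ hB0)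
    exact Set.abs_sub_left_of_mem_uIcc hz
  have h := (convex_uIcc x y).norm_image_sub_le_of_norm_hasDerivWithin_le
    (f := fun z => p z - p' x * z) (f' := fun z => p' z - p' x) (C := B * |y - x|)
    (fun w _ => ((hp w).sub (by simpa using (hasDerivAt_id w).const_mul (p' x))).hasDerivWithinAt)
    (fun w hw => hlip w hw) Set.left_mem_uIcc Set.right_mem_uIcc
  simp only [Real.norm_eq_abs] at h
  rw [mul_assoc, ← sq, sq_abs] at h
  convert! h using 2
  ring

theorem hasDerivAt_eq_zero_of_vanish_left {v : ℝ → ℝ} {a d : ℝ} (hd : HasDerivAt v d a)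
    (hv : ∀ x ≤ a, v x = 0) : d = 0 := by
  have h1 : HasDerivWithinAt v 0 (Set.Iic a) a :=
    (hasDerivWithinAt_const a (Set.Iic a) (0 : ℝ)).congr (fun x hx => hv x hx) (hv a le_rfl)
  exact (uniqueDiffOn_Iic a a Set.self_mem_Iic).eq_deriv _ hd.hasDerivWithinAt h1

/-- The discrete bound by second differences, for grid values of a function vanishing on the left: then
also the derivative vanishes at the left end, and so the first grid value is of second order. -/
theorem abs_leftWSGD_le_of_deriv (s : Shifts) {α : ℝ} (h1 : 1 ≤ α) (h2 : α ≤ 2) {a b B : ℝ}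
    {v v' v'' : ℝ → ℝ} (hv : ∀ x, HasDerivAt v (v' x) x) (hv' : ∀ x, HasDerivAt v' (v'' x) x)
    (hB : ∀ x ∈ Set.Icc a b, |v'' x| ≤ B) (hva : ∀ x ≤ a, v x = 0) {N : ℕ} {h : ℝ} (hh : 0 < h)
    (hN : N * h = b - a) {i : ℕ} (hi1 : 1 ≤ i) (hiN : i < N) :
    |leftWSGD s α h (fun m => v (a + m * h)) i| ≤ 4 * (b - a) ^ (2 - α) * B := by
  have hgrid : ∀ m : ℕ, m ≤ N → a + m * h ∈ Set.Icc a b := fun m hm => by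
    have : (m : ℝ) ≤ N := by exact_mod_cast hm
    constructor <;> nlinarith [mul_nonneg m.cast_nonneg hh.le]
  have hB0 : 0 ≤ B := (abs_nonneg _).trans (hB _ (hgrid 0 (by omega)))
  have key := abs_leftWSGD_le s (D := 2 * (B * h ^ 2)) h1 h2 hh (fun m : ℕ => v (a + m * h)) N
    ?_ ?_ ?_ i hi1 hiN
  rotate_left
  · simpa using hva a le_rfl
  · have hd0 := hasDerivAt_eq_zero_of_vanish_left (hv a) hva
    have h3 := abs_sub_sub_deriv_mul_le hv hv' hB (hgrid 0 (by omega)) (hgrid 1 (by omega))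
    simp only [Nat.cast_zero, zero_mul, add_zero, hd0, hva a le_rfl, Nat.cast_one, one_mul,
      sub_zero, add_sub_cancel_left] at h3 ⊢
    linarith [abs_nonneg (v (a + h))]
  · intro j hj
    have x1 := hgrid (j + 1) (by omega)
    have t1 := abs_sub_sub_deriv_mul_le hv hv' hB x1 (hgrid j (by omega))
    have t2 := abs_sub_sub_deriv_mul_le hv hv' hB x1 (hgrid (j + 2) hj)
    have d1 : a + (j : ℝ) * h - (a + ((j + 1 : ℕ) : ℝ) * h) = -h := by push_cast; ring
    have d2 : a + ((j + 2 : ℕ) : ℝ) * h - (a + ((j + 1 : ℕ) : ℝ) * h) = h := by push_cast; ring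
    rw [d1] at t1
    rw [d2] at t2
    rw [neg_sq] at t1
    rw [abs_le] at t1 t2 ⊢
    constructor <;> linarith [t1.1, t1.2, t2.1, t2.2]
  refine key.trans_eq ?_
  rw [hN]
  field_simp
  ring

/-- The two-sided operator is bounded by the second derivative alone. -/
theorem exists_abs_twoSided_le (s : Shifts) (K₁ K₂ : ℝ) {α : ℝ} (h1 : 1 ≤ α) (h2 : α ≤ 2)
    {a b : ℝ} (hab : a < b) :
    ∃ C, 0 ≤ C ∧ ∀ (B : ℝ) (v v' v'' : ℝ → ℝ), (∀ x, HasDerivAt v (v' x) x) →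
      (∀ x, HasDerivAt v' (v'' x) x) → (∀ x ∈ Set.Icc a b, |v'' x| ≤ B) →
      VanishesBeyond K₁ K₂ a b v →
      ∀ (N : ℕ) (h : ℝ), 0 < h → N * h = b - a → ∀ i, 1 ≤ i → i < N →
        |twoSided K₁ K₂ s α h N (fun m => v (a + m * h)) i| ≤ C * B := by
  have hba : 0 ≤ b - a := by linarith
  refine ⟨|K₁| * (4 * (b - a) ^ (2 - α)) + |K₂| * (4 * (b - a) ^ (2 - α)), by positivity,
    fun B v v' v'' hv hv' hB hvan N h hh hN i hi1 hiN => ?_⟩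
  unfold twoSided
  refine (abs_add_le _ _).trans ?_
  rw [abs_mul, abs_mul, add_mul, mul_assoc, mul_assoc |K₂|]
  refine add_le_add ?_ ?_
  · rcases eq_or_ne K₁ 0 with h0 | h0
    · simp [h0]
    · gcongr
      exact abs_leftWSGD_le_of_deriv s h1 h2 hv hv' hB (hvan.1 h0) hh hN hi1 hiN
  · rcases eq_or_ne K₂ 0 with h0 | h0
    · simp [h0]
    · gcongr
      rw [rightWSGD_eq_leftWSGD s α h N _ i hi1 hiN]
      have e1 : leftWSGD s α h (fun m : ℕ => v (a + ((N - m : ℕ) : ℝ) * h)) (N - i)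
          = leftWSGD s α h (fun m : ℕ => v (a + b - (a + m * h))) (N - i) :=
        leftWSGD_congr s α h fun m hm => by rw [grid_reflect hN (by omega)]
      rw [e1]
      refine abs_leftWSGD_le_of_deriv s (v := fun x => v (a + b - x))
        (v' := fun x => -v' (a + b - x)) (v'' := fun x => v'' (a + b - x)) h1 h2 (fun x => ?_)
        (fun x => ?_) (fun x hx => hB _ ⟨by linarith [hx.2], by linarith [hx.1]⟩)
        (fun x hx => hvan.2 h0 _ (by linarith)) hh hN (by omega) (by omega)
      · simpa using (hv (a + b - x)).comp_const_sub (a + b) x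
      · simpa using ((hv' (a + b - x)).comp_const_sub (a + b) x).fun_neg

end Interval

/-! ### Riemann-Liouville derivatives as fractional integrals of second derivatives -/

section RiemannLiouville

open MeasureTheory Filter Topology

theorem integrableOn_rpow_one_sub {α : ℝ} (h2 : α < 2) (L : ℝ) :
    IntegrableOn (fun s : ℝ => s ^ (1 - α)) (Set.Ioc 0 L) := by
  rcases le_or_gt 0 L with hL | hL
  · rw [← intervalIntegrable_iff_integrableOn_Ioc_of_le hL]
    exact intervalIntegral.intervalIntegrable_rpow' (by linarith)
  · rw [Set.Ioc_eq_empty (by linarith)]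
    exact integrableOn_empty

theorem abs_rpow_one_sub_mul_le {α L s p B : ℝ} (hs : s ∈ Set.Ioc 0 L) (hp : |p| ≤ B) :
    |s ^ (1 - α) * p| ≤ s ^ (1 - α) * B := by
  rw [abs_mul, abs_of_nonneg (Real.rpow_nonneg hs.1.le _)]
  exact mul_le_mul_of_nonneg_left hp (Real.rpow_nonneg hs.1.le _)

theorem aestronglyMeasurable_rpow_mul (α L : ℝ) {φ : ℝ → ℝ} (hφ : Continuous φ) :
    AEStronglyMeasurable (fun s : ℝ => s ^ (1 - α) * φ s) (volume.restrict (Set.Ioc 0 L)) :=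
  ((measurable_id.pow_const (1 - α)).mul hφ.measurable).aestronglyMeasurable

theorem integrableOn_rpow_mul {α : ℝ} (h2 : α < 2) (L : ℝ) {φ : ℝ → ℝ} (hφ : Continuous φ) :
    IntegrableOn (fun s : ℝ => s ^ (1 - α) * φ s) (Set.Ioc 0 L) := by
  obtain ⟨B, hB⟩ := isCompact_Icc.exists_bound_of_continuousOn (s := Set.Icc 0 L) hφ.continuousOn
  refine ((integrableOn_rpow_one_sub h2 L).mul_const B).mono' (aestronglyMeasurable_rpow_mul α L hφ) ?_
  filter_upwards [ae_restrict_mem measurableSet_Ioc] with s hs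
  exact abs_rpow_one_sub_mul_le hs (hB s (Set.Ioc_subset_Icc_self hs))

theorem abs_integral_rpow_mul_le {α : ℝ} (h2 : α < 2) {L B : ℝ} {φ : ℝ → ℝ}
    (hB : ∀ s ∈ Set.Ioc 0 L, |φ s| ≤ B) :
    |∫ s in Set.Ioc 0 L, s ^ (1 - α) * φ s| ≤ (∫ s in Set.Ioc 0 L, s ^ (1 - α)) * B := by
  rw [← integral_mul_const, ← Real.norm_eq_abs]
  refine norm_integral_le_of_norm_le ((integrableOn_rpow_one_sub h2 L).mul_const B) ?_
  filter_upwards [ae_restrict_mem measurableSet_Ioc] with s hs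
  exact abs_rpow_one_sub_mul_le hs (hB s hs)

theorem continuous_integral_rpow_mul {X : Type*} [TopologicalSpace X] [FirstCountableTopology X]
    [LocallyCompactSpace X] {α : ℝ} (h2 : α < 2) (L : ℝ) {φ : X → ℝ → ℝ}
    (hφ : Continuous (Function.uncurry φ)) :
    Continuous fun x => ∫ s in Set.Ioc 0 L, s ^ (1 - α) * φ x s := by
  rw [continuous_iff_continuousAt]
  intro x₀
  obtain ⟨K, hK, hKx⟩ := exists_compact_mem_nhds x₀
  obtain ⟨B, hB⟩ := (hK.prod (isCompact_Icc (a := 0) (b := L))).exists_bound_of_continuousOn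
    hφ.continuousOn
  have hφx : ∀ x, Continuous (φ x) := fun x => hφ.comp (by fun_prop : Continuous fun s => (x, s))
  refine continuousAt_of_dominated (bound := fun s => s ^ (1 - α) * B)
    (.of_forall fun x => aestronglyMeasurable_rpow_mul α L (hφx x)) ?_
    ((integrableOn_rpow_one_sub h2 L).mul_const B) ?_
  · filter_upwards [hKx] with x hx
    filter_upwards [ae_restrict_mem measurableSet_Ioc] with s hs
    exact abs_rpow_one_sub_mul_le hs (hB (x, s) ⟨hx, Set.Ioc_subset_Icc_self hs⟩)
  · refine .of_forall fun s => ?_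
    have : Continuous fun x => φ x s := hφ.comp (by fun_prop : Continuous fun x => (x, s))
    exact (this.const_mul _).continuousAt

theorem hasDerivAt_integral_rpow_mul {α : ℝ} (h2 : α < 2) (L : ℝ) {v v' : ℝ → ℝ}
    (hv : ∀ x, HasDerivAt v (v' x) x) (hv' : Continuous v') (x : ℝ) :
    HasDerivAt (fun x => ∫ s in Set.Ioc 0 L, s ^ (1 - α) * v (x - s))
      (∫ s in Set.Ioc 0 L, s ^ (1 - α) * v' (x - s)) x := by
  have hvc : Continuous v := continuous_iff_continuousAt.2 fun x => (hv x).continuousAt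
  obtain ⟨B, hB⟩ := ((isCompact_closedBall x 1).prod
    (isCompact_Icc (a := 0) (b := L))).exists_bound_of_continuousOn
      (f := fun p : ℝ × ℝ => v' (p.1 - p.2)) (by fun_prop)
  refine (hasDerivAt_integral_of_dominated_loc_of_deriv_le
    (F := fun x s => s ^ (1 - α) * v (x - s)) (F' := fun x s => s ^ (1 - α) * v' (x - s))
    (bound := fun s => s ^ (1 - α) * B) (Metric.ball_mem_nhds x one_pos)
    (.of_forall fun x => aestronglyMeasurable_rpow_mul α L (by fun_prop))
    (integrableOn_rpow_mul h2 L (by fun_prop)) (aestronglyMeasurable_rpow_mul α L (by fun_prop)) ?_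
    ((integrableOn_rpow_one_sub h2 L).mul_const B) ?_).2
  · filter_upwards [ae_restrict_mem measurableSet_Ioc] with s hs z hz
    exact abs_rpow_one_sub_mul_le hs
      (hB (z, s) ⟨Metric.ball_subset_closedBall hz, Set.Ioc_subset_Icc_self hs⟩)
  · refine .of_forall fun s z _ => ?_
    exact ((hv (z - s)).comp_sub_const z s).const_mul _

/-- Differentiating the Riemann-Liouville integral twice under the integral sign, with the singular
kernel kept fixed, moves both derivatives onto the function. -/
theorem leftRL_eq_leftFrac {α : ℝ} (h1 : 1 < α) (h2 : α < 2) {a b : ℝ} {u v : ℝ → ℝ}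
    (hv : ContDiff ℝ 2 v) (hva : ∀ x ≤ a, v x = 0) (huv : ∀ x ∈ Set.Icc a b, u x = v x) {x : ℝ}
    (hx : x ∈ Set.Ioo a b) :
    leftRL a α u x = leftFrac α (b - a) (iteratedDeriv 2 v) x := by
  have hceil : ⌈α⌉₊ = 2 := by
    rw [Nat.ceil_eq_iff (by norm_num)]
    exact ⟨by push_cast; linarith, by push_cast; linarith⟩
  have hne : α ≠ ((2 : ℕ) : ℝ) := by push_cast; exact h2.ne
  unfold leftRL leftFrac
  rw [hceil, if_neg hne, one_div]
  push_cast
  congr 1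
  have hloc : (fun z => ∫ ξ in a..z, u ξ / (z - ξ) ^ (α - 2 + 1)) =ᶠ[𝓝 x]
      fun z => ∫ s in Set.Ioc 0 (b - a), s ^ (1 - α) * v (z - s) := by
    filter_upwards [Ioo_mem_nhds hx.1 hx.2] with z hz
    have e1 : ∫ ξ in a..z, u ξ / (z - ξ) ^ (α - 2 + 1)
        = ∫ ξ in a..z, (fun s => s ^ (1 - α) * v (z - s)) (z - ξ) := by
      refine intervalIntegral.integral_congr fun ξ hξ => ?_
      rw [Set.uIcc_of_le hz.1.le] at hξ
      simp only [sub_sub_cancel]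
      rw [huv ξ ⟨hξ.1, hξ.2.trans hz.2.le⟩, show 1 - α = -(α - 2 + 1) by ring,
        Real.rpow_neg (by linarith [hξ.2])]
      ring
    -- the memory may be extended to the fixed length `b - a`, as `v` vanishes there
    rw [e1, intervalIntegral.integral_comp_sub_left (fun s => s ^ (1 - α) * v (z - s)), sub_self,
      intervalIntegral.integral_of_le (by linarith [hz.1]), eq_comm]
    refine setIntegral_eq_of_subset_of_forall_sdiff_eq_zero measurableSet_Ioc
      (Set.Ioc_subset_Ioc_right (by linarith [hz.2])) fun s hs => ?_
    have : z - a < s := by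
      by_contra h
      exact hs.2 ⟨hs.1.1, not_lt.1 h⟩
    rw [hva _ (by linarith), mul_zero]
  rw [hloc.iteratedDeriv_eq]
  have hd : ∀ y, HasDerivAt v (deriv v y) y := fun y =>
    (hv.differentiable (by norm_num) y).hasDerivAt
  have hv1 : ContDiff ℝ 1 (deriv v) := by
    have := (contDiff_succ_iff_deriv (n := 1) (f := v)).1 (by simpa [one_add_one_eq_two] using hv)
    exact this.2.2
  have hd' : ∀ y, HasDerivAt (deriv v) (iteratedDeriv 2 v y) y := fun y => by
    rw [iteratedDeriv_succ, iteratedDeriv_one]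
    exact (hv1.differentiable (by norm_num) y).hasDerivAt
  rw [iteratedDeriv_succ, iteratedDeriv_one,
    funext fun y => (hasDerivAt_integral_rpow_mul h2 (b - a) hd hv1.continuous y).deriv]
  exact (hasDerivAt_integral_rpow_mul h2 (b - a) hd' (hv.continuous_iteratedDeriv 2 le_rfl) x).deriv

theorem rightRL_eq_leftRL_reflect {α : ℝ} (a b : ℝ) (u : ℝ → ℝ) (x : ℝ) :
    rightRL b α u x = leftRL a α (fun y => u (a + b - y)) (a + b - x) := by
  unfold rightRL leftRL
  have e : (fun z => ∫ ξ in z..b, u ξ / (ξ - z) ^ (α - (⌈α⌉₊ : ℝ) + 1))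
      = fun z => (fun w => ∫ ξ in a..w, u (a + b - ξ) / (w - ξ) ^ (α - (⌈α⌉₊ : ℝ) + 1))
        (a + b - z) := by
    funext z
    have := intervalIntegral.integral_comp_sub_left
      (fun ξ => u ξ / (ξ - z) ^ (α - (⌈α⌉₊ : ℝ) + 1)) (a := a) (b := a + b - z) (a + b)
    rw [sub_sub_cancel, add_sub_cancel_left] at this
    rw [← this]
    refine intervalIntegral.integral_congr fun ξ _ => ?_
    congr 2
    ring
  have hk : ∀ (k : ℕ) (g : ℝ → ℝ) (y : ℝ), iteratedDeriv k (fun x => g (a + b - x)) y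
      = (-1 : ℝ) ^ k * iteratedDeriv k g (a + b - y) := fun k g y => by
    rw [iteratedDeriv_comp_const_sub]
    rfl
  have hsq : ((-1 : ℝ) ^ ⌈α⌉₊) * (-1) ^ ⌈α⌉₊ = 1 := by
    rw [← mul_pow]; norm_num
  split_ifs
  · rw [hk, sub_sub_cancel]
  · rw [e, hk _ (fun w => ∫ ξ in a..w, u (a + b - ξ) / (w - ξ) ^ (α - (⌈α⌉₊ : ℝ) + 1)), div_mul_eq_mul_div, ← mul_assoc, hsq, one_mul, one_div, div_eq_inv_mul]

/-- The term of the equation in one space variable, for a function `u` that is extended smoothly by `v`.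
A side with coefficient zero imposes no condition on `v`. -/
theorem twoSided_riemannLiouville (K₁ K₂ : ℝ) {α : ℝ} (h1 : 1 < α) (h2 : α < 2) {a b : ℝ}
    {u v : ℝ → ℝ} (hv : ContDiff ℝ 2 v) (hvan : VanishesBeyond K₁ K₂ a b v)
    (huv : ∀ x ∈ Set.Icc a b, u x = v x) {x : ℝ} (hx : x ∈ Set.Ioo a b) :
    K₁ * leftRL a α u x + K₂ * rightRL b α u x
      = twoSidedFrac K₁ K₂ α (b - a) (iteratedDeriv 2 v) x := by
  unfold twoSidedFrac
  congr 1
  · rcases eq_or_ne K₁ 0 with h0 | h0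
    · rw [h0, zero_mul, zero_mul]
    · rw [leftRL_eq_leftFrac h1 h2 hv (hvan.1 h0) huv hx]
  · rcases eq_or_ne K₂ 0 with h0 | h0
    · rw [h0, zero_mul, zero_mul]
    · rw [rightRL_eq_leftRL_reflect a b, leftRL_eq_leftFrac (b := b) (v := fun y => v (a + b - y)) h1 h2
        (hv.comp (by fun_prop)) (fun y hy => hvan.2 h0 _ (by linarith))
        (fun y hy => huv _ ⟨by linarith [hy.2], by linarith [hy.1]⟩)
        ⟨by linarith [hx.2], by linarith [hx.1]⟩, ← leftFrac_reflect α (b - a) (a + b),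
        iteratedDeriv_comp_const_sub]
      simp

/-- Fractional integrals of a jointly continuous function are jointly continuous, up to the end points
of the interval. -/
theorem continuous_twoSidedFrac (K₁ K₂ : ℝ) {α : ℝ} (h2 : α < 2) (L : ℝ) {X : Type*}
    [TopologicalSpace X] [FirstCountableTopology X] [LocallyCompactSpace X] {w : X → ℝ → ℝ}
    (hw : Continuous (Function.uncurry w)) {x : X → ℝ} (hx : Continuous x) :
    Continuous fun p => twoSidedFrac K₁ K₂ α L (w p) (x p) := by
  unfold twoSidedFrac leftFrac rightFrac
  refine ((Continuous.const_mul ?_ _).const_mul _).add ((Continuous.const_mul ?_ _).const_mul _)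
  · exact continuous_integral_rpow_mul h2 L (φ := fun p s => w p (x p - s))
      (hw.comp (by fun_prop : Continuous fun q : X × ℝ => (q.1, x q.1 - q.2)))
  · exact continuous_integral_rpow_mul h2 L (φ := fun p s => w p (x p + s))
      (hw.comp (by fun_prop : Continuous fun q : X × ℝ => (q.1, x q.1 + q.2)))

theorem exists_abs_twoSidedFrac_le (K₁ K₂ : ℝ) {α : ℝ} (h2 : α < 2) (L : ℝ) :
    ∃ C, 0 ≤ C ∧ ∀ (B : ℝ) (w : ℝ → ℝ) (x : ℝ),
      (∀ ξ ∈ Set.Icc (x - L) (x + L), |w ξ| ≤ B) → 0 ≤ B → |twoSidedFrac K₁ K₂ α L w x| ≤ C * B := by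
  have hI : 0 ≤ ∫ s in Set.Ioc 0 L, s ^ (1 - α) :=
    setIntegral_nonneg measurableSet_Ioc fun s hs => Real.rpow_nonneg hs.1.le _
  refine ⟨(|K₁| + |K₂|) * (|(Real.Gamma (2 - α))⁻¹| * ∫ s in Set.Ioc 0 L, s ^ (1 - α)),
    by positivity, fun B w x hw hB => ?_⟩
  unfold twoSidedFrac leftFrac rightFrac
  have t1 := abs_integral_rpow_mul_le h2 (L := L) (φ := fun s => w (x - s)) (B := B) fun s hs =>
    hw _ ⟨by linarith [hs.2], by linarith [hs.1, hs.2]⟩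
  have t2 := abs_integral_rpow_mul_le h2 (L := L) (φ := fun s => w (x + s)) (B := B) fun s hs =>
    hw _ ⟨by linarith [hs.1, hs.2], by linarith [hs.2]⟩
  refine (abs_add_le _ _).trans ?_
  simp only [abs_mul, add_mul, mul_assoc]
  gcongr

theorem twoSidedFrac_second_difference (K₁ K₂ : ℝ) {α : ℝ} (h2 : α < 2) (L : ℝ) {w₀ w₁ w₂ : ℝ → ℝ}
    (h₀ : Continuous w₀) (h₁ : Continuous w₁) (h₂ : Continuous w₂) (x : ℝ) :
    twoSidedFrac K₁ K₂ α L w₀ x - 2 * twoSidedFrac K₁ K₂ α L w₁ x + twoSidedFrac K₁ K₂ α L w₂ x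
      = twoSidedFrac K₁ K₂ α L (fun ξ => w₀ ξ - 2 * w₁ ξ + w₂ ξ) x := by
  have key : ∀ φ₀ φ₁ φ₂ : ℝ → ℝ, Continuous φ₀ → Continuous φ₁ → Continuous φ₂ →
      ∫ s in Set.Ioc 0 L, s ^ (1 - α) * (φ₀ s - 2 * φ₁ s + φ₂ s)
      = (∫ s in Set.Ioc 0 L, s ^ (1 - α) * φ₀ s) - 2 * (∫ s in Set.Ioc 0 L, s ^ (1 - α) * φ₁ s)
        + ∫ s in Set.Ioc 0 L, s ^ (1 - α) * φ₂ s := by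
    intro φ₀ φ₁ φ₂ c₀ c₁ c₂
    have i₀ := integrableOn_rpow_mul h2 L c₀
    have i₁ := integrableOn_rpow_mul h2 L c₁
    have i₂ := integrableOn_rpow_mul h2 L c₂
    rw [← integral_const_mul, ← integral_sub i₀ (i₁.const_mul 2), ← integral_add
      (f := fun s => s ^ (1 - α) * φ₀ s - 2 * (s ^ (1 - α) * φ₁ s)) (i₀.sub (i₁.const_mul 2)) i₂]
    refine integral_congr_ae (.of_forall fun s => ?_)
    simp only
    ring
  unfold twoSidedFrac leftFrac rightFrac
  rw [key (fun s => w₀ (x - s)) (fun s => w₁ (x - s)) (fun s => w₂ (x - s)) (by fun_prop) (by fun_prop)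
    (by fun_prop), key (fun s => w₀ (x + s)) (fun s => w₁ (x + s)) (fun s => w₂ (x + s)) (by fun_prop)
    (by fun_prop) (by fun_prop)]
  ring

end RiemannLiouville

/-! ### Grid operators as finite linear combinations of grid values -/

section GridFunctional

/-- Functionals on grid functions that are linear combinations of the values at the indices
`0, …, N`. -/
def IsGridFunctional (N : ℕ) (l : (ℕ → ℝ) → ℝ) : Prop :=
  ∃ κ : ℕ → ℝ, ∀ v, l v = ∑ m ∈ range (N + 1), κ m * v m

namespace IsGridFunctional

variable {N N' : ℕ} {l l' : (ℕ → ℝ) → ℝ}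

theorem eval {m : ℕ} (hm : m ≤ N) : IsGridFunctional N fun v => v m :=
  ⟨fun k => if k = m then 1 else 0, fun v => by
    simp [show m < N + 1 by omega]⟩

theorem add (h : IsGridFunctional N l) (h' : IsGridFunctional N l') :
    IsGridFunctional N fun v => l v + l' v := by
  obtain ⟨κ, hκ⟩ := h
  obtain ⟨κ', hκ'⟩ := h'
  exact ⟨κ + κ', fun v => by simp [hκ, hκ', add_mul, sum_add_distrib]⟩

theorem const_mul (c : ℝ) (h : IsGridFunctional N l) : IsGridFunctional N fun v => c * l v := by
  obtain ⟨κ, hκ⟩ := h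
  exact ⟨fun m => c * κ m, fun v => by simp [hκ, mul_sum, mul_assoc]⟩

theorem sum {n : ℕ} {L : ℕ → (ℕ → ℝ) → ℝ} (h : ∀ k < n, IsGridFunctional N (L k)) :
    IsGridFunctional N fun v => ∑ k ∈ range n, L k v := by
  induction n with
  | zero => exact ⟨0, fun v => by simp⟩
  | succ n ih =>
    simp only [sum_range_succ]
    exact (ih fun k hk => h k (by omega)).add (h n (by omega))

theorem congr_grid (h : IsGridFunctional N l) {v w : ℕ → ℝ} (hvw : ∀ m ≤ N, v m = w m) :
    l v = l w := by
  obtain ⟨κ, hκ⟩ := h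
  rw [hκ, hκ]
  exact sum_congr rfl fun m hm => by rw [hvw m (by rw [mem_range] at hm; omega)]

theorem map_combination (h : IsGridFunctional N l) (p q : ℝ) (v w : ℕ → ℝ) :
    l (fun m => p * v m + q * w m) = p * l v + q * l w := by
  obtain ⟨κ, hκ⟩ := h
  rw [hκ, hκ, hκ, mul_sum, mul_sum, ← sum_add_distrib]
  exact sum_congr rfl fun m _ => by ring

theorem map_sub (h : IsGridFunctional N l) (v w : ℕ → ℝ) :
    l (fun m => v m - w m) = l v - l w := by
  have := h.map_combination 1 (-1) v w
  simp only [one_mul, neg_one_mul, ← sub_eq_add_neg] at this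
  exact this

theorem map_zero (h : IsGridFunctional N l) : l (fun _ => 0) = 0 := by
  obtain ⟨κ, hκ⟩ := h
  rw [hκ]
  simp

theorem hasDerivAt (h : IsGridFunctional N l) {F F' : ℝ → ℕ → ℝ} {x : ℝ}
    (hF : ∀ m, HasDerivAt (fun z => F z m) (F' x m) x) : HasDerivAt (fun z => l (F z)) (l (F' x)) x := by
  obtain ⟨κ, hκ⟩ := h
  simp only [hκ]
  exact HasDerivAt.fun_sum fun m _ => (hF m).const_mul _

/-- Functionals acting on different indices commute. -/
theorem comm (h : IsGridFunctional N l) (h' : IsGridFunctional N' l') (v : Grid) :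
    l (fun m => l' (v m)) = l' (fun k => l fun m => v m k) := by
  obtain ⟨κ, hκ⟩ := h
  obtain ⟨κ', hκ'⟩ := h'
  simp only [hκ, hκ', mul_sum]
  rw [sum_comm]
  exact sum_congr rfl fun _ _ => sum_congr rfl fun _ _ => by ring

/-- A functional is determined by its values on unit vectors; only the interior ones matter for
functions vanishing at the end points. -/
theorem eq_sum_single (h : IsGridFunctional N l) {v : ℕ → ℝ} (h0 : v 0 = 0) (hN : v N = 0) :
    l v = ∑ m : Fin (N - 1), l (Pi.single ((m : ℕ) + 1) 1) * v (m + 1) := by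
  obtain ⟨κ, hκ⟩ := h
  have hs : ∀ m ≤ N, l (Pi.single m 1) = κ m := fun m hm => by
    rw [hκ, sum_eq_single_of_mem m (mem_range.2 (by omega)) fun k _ hk => by
      rw [Pi.single_eq_of_ne hk, mul_zero], Pi.single_eq_same, mul_one]
  rw [hκ]
  rcases Nat.eq_zero_or_pos N with rfl | hpos
  · simp [h0]
  obtain ⟨n, rfl⟩ : ∃ n, N = n + 1 := ⟨N - 1, by omega⟩
  rw [sum_range_succ, hN, mul_zero, add_zero, sum_range_succ', h0, mul_zero, add_zero,
    Nat.add_sub_cancel, ← Fin.sum_univ_eq_sum_range (fun k => κ (k + 1) * v (k + 1))]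
  exact sum_congr rfl fun m _ => by rw [hs _ (by omega)]

end IsGridFunctional

theorem isGridFunctional_leftWSGD (s : Shifts) (α h : ℝ) {N i : ℕ} (hi : i < N) :
    IsGridFunctional N fun v => leftWSGD s α h v i :=
  (IsGridFunctional.sum fun k _ => (IsGridFunctional.eval (by omega)).const_mul _).const_mul _

theorem isGridFunctional_rightWSGD (s : Shifts) (α h : ℝ) {N i : ℕ} (hi1 : 1 ≤ i) (hi : i < N) :
    IsGridFunctional N fun v => rightWSGD s α h N v i :=
  (IsGridFunctional.sum fun k _ => (IsGridFunctional.eval (by omega)).const_mul _).const_mul _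

theorem isGridFunctional_twoSided (K₁ K₂ : ℝ) (s : Shifts) (α h : ℝ) {N i : ℕ} (hi1 : 1 ≤ i)
    (hi : i < N) : IsGridFunctional N fun v => twoSided K₁ K₂ s α h N v i :=
  ((isGridFunctional_leftWSGD s α h hi).const_mul _).add
    ((isGridFunctional_rightWSGD s α h hi1 hi).const_mul _)

theorem isGridFunctional_compactOp (s : Shifts) (α h : ℝ) {N i : ℕ} (hi : i < N) :
    IsGridFunctional N fun v => compactOp s α h v i := by
  have := (IsGridFunctional.eval (N := N) (m := i) (by omega)).add
    (((((IsGridFunctional.eval (N := N) (m := i - 1) (by omega)).add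
      ((IsGridFunctional.eval (N := N) (m := i) (by omega)).const_mul (-2))).add
      (IsGridFunctional.eval (N := N) (m := i + 1) (by omega))).const_mul (1 / h ^ 2)).const_mul
        (compactCoeff s α * h ^ 2))
  convert this using 2 with v
  unfold compactOp centralDiff
  ring

theorem abs_compactOp_le (s : Shifts) {α h B : ℝ} (hc0 : 0 ≤ compactCoeff s α)
    (hc : compactCoeff s α ≤ 1 / 2) (hh : h ≠ 0) {v : ℕ → ℝ} {i : ℕ} (h0 : |v (i - 1)| ≤ B)
    (h1 : |v i| ≤ B) (h2 : |v (i + 1)| ≤ B) : |compactOp s α h v i| ≤ B := by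
  have e : compactOp s α h v i = (1 - 2 * compactCoeff s α) * v i
      + compactCoeff s α * v (i - 1) + compactCoeff s α * v (i + 1) := by
    unfold compactOp centralDiff
    field_simp
    ring
  have hc' : 0 ≤ 1 - 2 * compactCoeff s α := by linarith
  rw [e]
  calc _ ≤ |(1 - 2 * compactCoeff s α) * v i| + |compactCoeff s α * v (i - 1)|
        + |compactCoeff s α * v (i + 1)| := abs_add_three _ _ _
    _ = (1 - 2 * compactCoeff s α) * |v i| + compactCoeff s α * |v (i - 1)|
        + compactCoeff s α * |v (i + 1)| := by
      rw [abs_mul, abs_mul, abs_mul, abs_of_nonneg hc', abs_of_nonneg hc0]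
    _ ≤ (1 - 2 * compactCoeff s α) * B + compactCoeff s α * B + compactCoeff s α * B := by gcongr
    _ = B := by ring

end GridFunctional

/-! ### Operators on interior grid functions as matrices -/

section InteriorMatrix

open Matrix

/-- The matrix on the interior indices `1, …, N - 1` (shifted to start from `0`) of an operator on grid
functions. -/
def interiorMatrix (N : ℕ) (op : (ℕ → ℝ) → ℕ → ℝ) : Matrix (Fin (N - 1)) (Fin (N - 1)) ℝ :=
  Matrix.of fun i m => op (Pi.single ((m : ℕ) + 1) 1) (i + 1)

/-- Extension by zero of a vector of interior values. -/
def extendInterior (N : ℕ) (x : Fin (N - 1) → ℝ) (k : ℕ) : ℝ :=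
  if hk : 1 ≤ k ∧ k < N then x ⟨k - 1, by omega⟩ else 0

theorem extendInterior_zero (N : ℕ) (x : Fin (N - 1) → ℝ) : extendInterior N x 0 = 0 := by
  simp [extendInterior]

theorem extendInterior_of_le {N : ℕ} (x : Fin (N - 1) → ℝ) {k : ℕ} (hk : N ≤ k) :
    extendInterior N x k = 0 := by
  simp [extendInterior, hk]

theorem extendInterior_succ {N : ℕ} (x : Fin (N - 1) → ℝ) (i : Fin (N - 1)) :
    extendInterior N x (i + 1) = x i := by
  simp [extendInterior, show (i : ℕ) + 1 < N by omega]

theorem sum_Ico_one (N : ℕ) (f : ℕ → ℝ) : ∑ i ∈ Ico 1 N, f i = ∑ i : Fin (N - 1), f (i + 1) := by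
  rw [sum_Ico_eq_sum_range, Fin.sum_univ_eq_sum_range fun k => f (k + 1)]
  exact sum_congr rfl fun k _ => by rw [add_comm]

theorem dotProduct_interiorMatrix {N : ℕ} {op : (ℕ → ℝ) → ℕ → ℝ}
    (hop : ∀ i, 1 ≤ i → i < N → IsGridFunctional N fun v => op v i) (x : Fin (N - 1) → ℝ) :
    x ⬝ᵥ (interiorMatrix N op *ᵥ x)
      = ∑ i ∈ Ico 1 N, extendInterior N x i * op (extendInterior N x) i := by
  rw [sum_Ico_one]
  refine sum_congr rfl fun i _ => ?_
  rw [extendInterior_succ, (hop (i + 1) (by omega) (by omega)).eq_sum_single (extendInterior_zero N x)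
    (extendInterior_of_le x le_rfl)]
  simp only [extendInterior_succ, interiorMatrix, mulVec, dotProduct, Matrix.of_apply]

theorem dotProduct_self_eq (N : ℕ) (x : Fin (N - 1) → ℝ) :
    x ⬝ᵥ x = ∑ i ∈ Ico 1 N, extendInterior N x i ^ 2 := by
  rw [sum_Ico_one]
  exact sum_congr rfl fun i _ => by rw [extendInterior_succ, sq]

theorem interiorMatrix_twoSided_dissipative {K₁ K₂ : ℝ} (hK₁ : 0 ≤ K₁) (hK₂ : 0 ≤ K₂) (s : Shifts)
    {α h : ℝ} (h1 : 1 ≤ α) (h2 : α ≤ 2) (hh : 0 < h) (N : ℕ) (x : Fin (N - 1) → ℝ) :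
    x ⬝ᵥ (interiorMatrix N (twoSided K₁ K₂ s α h N) *ᵥ x) ≤ 0 := by
  rw [dotProduct_interiorMatrix fun i hi1 hi => isGridFunctional_twoSided K₁ K₂ s α h hi1 hi]
  set v := extendInterior N x with hv
  have v0 : v 0 = 0 := extendInterior_zero N x
  have vN : ∀ i, N ≤ i → v i = 0 := fun i hi => extendInterior_of_le x hi
  have hl := sum_mul_leftWSGD_nonpos s h1 h2 hh v0 vN
  have hr : ∑ i ∈ Ico 1 N, v i * rightWSGD s α h N v i ≤ 0 := by
    set w : ℕ → ℝ := fun m => v (N - m) with hw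
    have w0 : w 0 = 0 := vN _ (by omega)
    have wN : ∀ i, N ≤ i → w i = 0 := fun i hi => by
      simp only [hw, Nat.sub_eq_zero_of_le hi, v0]
    refine le_of_eq_of_le ?_ (sum_mul_leftWSGD_nonpos s h1 h2 hh w0 wN)
    refine sum_nbij' (fun i => N - i) (fun i => N - i) ?_ ?_ ?_ ?_ ?_
    · intro i hi; simp only [mem_Ico] at hi ⊢; omega
    · intro i hi; simp only [mem_Ico] at hi ⊢; omega
    · intro i hi; simp only [mem_Ico] at hi; omega
    · intro i hi; simp only [mem_Ico] at hi; omega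
    · intro i hi
      simp only [mem_Ico] at hi
      rw [rightWSGD_eq_leftWSGD s α h N v i hi.1 hi.2]
      simp only [hw, show N - (N - i) = i by omega]
  calc ∑ i ∈ Ico 1 N, v i * twoSided K₁ K₂ s α h N v i
      = K₁ * ∑ i ∈ Ico 1 N, v i * leftWSGD s α h v i
        + K₂ * ∑ i ∈ Ico 1 N, v i * rightWSGD s α h N v i := by
        rw [mul_sum, mul_sum, ← sum_add_distrib]
        exact sum_congr rfl fun i _ => by unfold twoSided; ring
    _ ≤ 0 := by nlinarith [mul_nonneg hK₁ (neg_nonneg.2 hl), mul_nonneg hK₂ (neg_nonneg.2 hr)]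

theorem interiorMatrix_compactOp_coercive (s : Shifts) {α h : ℝ} (hc : 0 ≤ compactCoeff s α)
    (hh : 0 < h) (N : ℕ) (x : Fin (N - 1) → ℝ) :
    (1 - 4 * compactCoeff s α) * (x ⬝ᵥ x) ≤ x ⬝ᵥ (interiorMatrix N (compactOp s α h) *ᵥ x) := by
  rw [dotProduct_interiorMatrix fun i _ hi => isGridFunctional_compactOp s α h hi, dotProduct_self_eq]
  exact sum_mul_compactOp_ge s hc hh (extendInterior_zero N x) fun i hi => extendInterior_of_le x hi

theorem interiorMatrix_compactOp_transpose (s : Shifts) (α h : ℝ) (N : ℕ) :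
    (interiorMatrix N (compactOp s α h))ᵀ = interiorMatrix N (compactOp s α h) := by
  ext i m
  simp only [interiorMatrix, Matrix.transpose_apply, Matrix.of_apply, compactOp, centralDiff,
    Nat.add_sub_cancel, Pi.single_apply]
  have e1 : ((m : ℕ) + 1 = i + 1) = ((i : ℕ) + 1 = m + 1) := propext eq_comm
  have e2 : ((m : ℕ) = i + 1) = ((i : ℕ) + 1 + 1 = m + 1) := by
    rw [Nat.add_right_cancel_iff]; exact propext eq_comm
  have e3 : ((m : ℕ) + 1 + 1 = i + 1) = ((i : ℕ) = m + 1) := by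
    rw [Nat.add_right_cancel_iff]; exact propext eq_comm
  simp only [e1, e2, e3]
  ring

/-- Matrix of interior values of a grid function. -/
def interiorValues (Nx Ny : ℕ) (v : Grid) : Matrix (Fin (Nx - 1)) (Fin (Ny - 1)) ℝ :=
  Matrix.of fun i j => v (i + 1) (j + 1)

theorem interiorValues_comp {Nx Ny : ℕ} {opx opy : (ℕ → ℝ) → ℕ → ℝ}
    (hx : ∀ i, 1 ≤ i → i < Nx → IsGridFunctional Nx fun v => opx v i)
    (hy : ∀ j, 1 ≤ j → j < Ny → IsGridFunctional Ny fun v => opy v j) {v : Grid}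
    (hv : ∀ i ≤ Nx, ∀ j ≤ Ny, (i = 0 ∨ i = Nx ∨ j = 0 ∨ j = Ny) → v i j = 0) :
    interiorValues Nx Ny (fun i j => opx (fun i' => opy (v i') j) i)
      = interiorMatrix Nx opx * interiorValues Nx Ny v * (interiorMatrix Ny opy)ᵀ := by
  ext i j
  have hj := hy (j + 1) (by omega) (by omega)
  have hz : ∀ i' ≤ Nx, (i' = 0 ∨ i' = Nx) → opy (v i') (j + 1) = 0 := fun i' hi' hi0 => by
    rw [hj.congr_grid (w := fun _ => 0) fun m hm => hv i' hi' m hm (by tauto)]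
    exact hj.map_zero
  rw [Matrix.mul_assoc, Matrix.mul_apply]
  simp only [interiorValues, Matrix.of_apply]
  rw [(hx (i + 1) (by omega) (by omega)).eq_sum_single (hz 0 (Nat.zero_le _) (.inl rfl))
    (hz Nx le_rfl (.inr rfl))]
  refine sum_congr rfl fun m _ => ?_
  rw [Matrix.mul_apply, hj.eq_sum_single (hv _ (by omega) 0 (by omega) (by tauto))
    (hv _ (by omega) Ny le_rfl (by tauto))]
  congr 1
  exact sum_congr rfl fun l _ => by
    simp only [interiorMatrix, Matrix.transpose_apply, Matrix.of_apply]; ring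

end InteriorMatrix

/-! ### Partial derivatives of space-time functions -/

section Calculus

open Filter Topology

/-- Directional derivative of a function of `(x, y, t)`. -/
def partialDeriv (e : ℝ × ℝ × ℝ) (G : ℝ × ℝ × ℝ → ℝ) (p : ℝ × ℝ × ℝ) : ℝ := fderiv ℝ G p e

/-- Partial derivative in `x`. -/
def dX (G : ℝ × ℝ × ℝ → ℝ) : ℝ × ℝ × ℝ → ℝ := partialDeriv (1, 0, 0) G

/-- Partial derivative in `y`. -/
def dY (G : ℝ × ℝ × ℝ → ℝ) : ℝ × ℝ × ℝ → ℝ := partialDeriv (0, 1, 0) G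

/-- Partial derivative in `t`. -/
def dT (G : ℝ × ℝ × ℝ → ℝ) : ℝ × ℝ × ℝ → ℝ := partialDeriv (0, 0, 1) G

theorem contDiff_partialDeriv (e : ℝ × ℝ × ℝ) {n : ℕ} {G : ℝ × ℝ × ℝ → ℝ}
    (hG : ContDiff ℝ (n + 1 : ℕ) G) : ContDiff ℝ n (partialDeriv e G) :=
  (hG.fderiv_right (m := (n : WithTop ℕ∞)) (by norm_cast)).clm_apply contDiff_const

variable {G : ℝ × ℝ × ℝ → ℝ}

theorem contDiff_dX {n : ℕ} (hG : ContDiff ℝ (n + 1 : ℕ) G) : ContDiff ℝ n (dX G) :=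
  contDiff_partialDeriv _ hG

theorem contDiff_dY {n : ℕ} (hG : ContDiff ℝ (n + 1 : ℕ) G) : ContDiff ℝ n (dY G) :=
  contDiff_partialDeriv _ hG

theorem contDiff_dT {n : ℕ} (hG : ContDiff ℝ (n + 1 : ℕ) G) : ContDiff ℝ n (dT G) :=
  contDiff_partialDeriv _ hG

theorem hasDerivAt_dX {n : ℕ} (hG : ContDiff ℝ (n + 1 : ℕ) G) (x y t : ℝ) :
    HasDerivAt (fun ξ => G (ξ, y, t)) (dX G (x, y, t)) x :=
  ((hG.differentiable (by norm_cast)) (x, y, t)).hasFDerivAt.comp_hasDerivAt x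
    ((hasDerivAt_id x).prodMk ((hasDerivAt_const x y).prodMk (hasDerivAt_const x t)))

theorem hasDerivAt_dY {n : ℕ} (hG : ContDiff ℝ (n + 1 : ℕ) G) (x y t : ℝ) :
    HasDerivAt (fun η => G (x, η, t)) (dY G (x, y, t)) y :=
  ((hG.differentiable (by norm_cast)) (x, y, t)).hasFDerivAt.comp_hasDerivAt y
    ((hasDerivAt_const y x).prodMk ((hasDerivAt_id y).prodMk (hasDerivAt_const y t)))

theorem hasDerivAt_dT {n : ℕ} (hG : ContDiff ℝ (n + 1 : ℕ) G) (x y t : ℝ) :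
    HasDerivAt (fun r => G (x, y, r)) (dT G (x, y, t)) t :=
  ((hG.differentiable (by norm_cast)) (x, y, t)).hasFDerivAt.comp_hasDerivAt t
    ((hasDerivAt_const t x).prodMk ((hasDerivAt_const t y).prodMk (hasDerivAt_id t)))

theorem contDiff_iterate {D : (ℝ × ℝ × ℝ → ℝ) → ℝ × ℝ × ℝ → ℝ}
    (hD : ∀ (n : ℕ) (H : ℝ × ℝ × ℝ → ℝ), ContDiff ℝ (n + 1 : ℕ) H → ContDiff ℝ n (D H)) {n : ℕ} :
    ∀ k ≤ n, ∀ {H : ℝ × ℝ × ℝ → ℝ}, ContDiff ℝ n H → ContDiff ℝ (n - k : ℕ) (D^[k] H) := by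
  intro k
  induction k with
  | zero => intro _ H hH; simpa using hH
  | succ k ih =>
    intro hk H hH
    rw [Function.iterate_succ_apply']
    refine hD _ _ ?_
    rw [show n - (k + 1) + 1 = n - k by omega]
    exact ih (by omega) hH

theorem iteratedDeriv_line_dX {n : ℕ} (hG : ContDiff ℝ n G) (y t : ℝ) :
    ∀ k ≤ n, iteratedDeriv k (fun ξ => G (ξ, y, t)) = fun x => dX^[k] G (x, y, t) := by
  intro k
  induction k with
  | zero => intro _; simp
  | succ k ih =>
    intro hk
    funext x
    rw [iteratedDeriv_succ, ih (by omega), Function.iterate_succ_apply']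
    have := contDiff_iterate (fun _ _ => contDiff_dX) k (by omega) hG
    rw [show n - k = n - (k + 1) + 1 by omega] at this
    exact (hasDerivAt_dX this x y t).deriv

theorem iteratedDeriv_line_dY {n : ℕ} (hG : ContDiff ℝ n G) (x t : ℝ) :
    ∀ k ≤ n, iteratedDeriv k (fun η => G (x, η, t)) = fun y => dY^[k] G (x, y, t) := by
  intro k
  induction k with
  | zero => intro _; simp
  | succ k ih =>
    intro hk
    funext y
    rw [iteratedDeriv_succ, ih (by omega), Function.iterate_succ_apply']
    have := contDiff_iterate (fun _ _ => contDiff_dY) k (by omega) hG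
    rw [show n - k = n - (k + 1) + 1 by omega] at this
    exact (hasDerivAt_dY this x y t).deriv

theorem eq_zero_of_hasDerivAt_of_vanish {v : ℝ → ℝ} {a b x d : ℝ} (hab : a < b)
    (hd : HasDerivAt v d x) (hv : ∀ x ∈ Set.Icc a b, v x = 0) (hx : x ∈ Set.Icc a b) : d = 0 :=
  (uniqueDiffOn_Icc hab x hx).eq_deriv _ hd.hasDerivWithinAt
    ((hasDerivWithinAt_const x (Set.Icc a b) (0 : ℝ)).congr hv (hv x hx))

/-! ### Finite differences of functions of one variable -/

theorem abs_sub_le_of_deriv {p p' : ℝ → ℝ} (hp : ∀ x, HasDerivAt p (p' x) x) {a b B : ℝ}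
    (hB : ∀ x ∈ Set.Icc a b, |p' x| ≤ B) {x y : ℝ} (hx : x ∈ Set.Icc a b) (hy : y ∈ Set.Icc a b) :
    |p y - p x| ≤ B * |y - x| :=
  (convex_Icc a b).norm_image_sub_le_of_norm_hasDerivWithin_le
    (fun z _ => (hp z).hasDerivWithinAt) hB hx hy

theorem abs_second_difference_le {p p' p'' : ℝ → ℝ} (hp : ∀ x, HasDerivAt p (p' x) x)
    (hp' : ∀ x, HasDerivAt p' (p'' x) x) {a b B : ℝ} (hB : ∀ x ∈ Set.Icc a b, |p'' x| ≤ B)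
    {m r : ℝ} (hr : 0 ≤ r) (h0 : a ≤ m - r) (h1 : m + r ≤ b) :
    |p (m - r) - 2 * p m + p (m + r)| ≤ 2 * B * r ^ 2 := by
  have t1 := abs_sub_sub_deriv_mul_le hp hp' hB (x := m) (y := m - r) ⟨by linarith, by linarith⟩
    ⟨h0, by linarith⟩
  have t2 := abs_sub_sub_deriv_mul_le hp hp' hB (x := m) (y := m + r) ⟨by linarith, by linarith⟩
    ⟨by linarith, h1⟩
  rw [show m - r - m = -r by ring, neg_sq] at t1
  rw [show m + r - m = r by ring] at t2
  rw [abs_le] at *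
  constructor <;> linarith [t1.1, t1.2, t2.1, t2.2]

theorem abs_central_difference_le {p p' p'' p''' : ℝ → ℝ} (hp : ∀ x, HasDerivAt p (p' x) x)
    (hp' : ∀ x, HasDerivAt p' (p'' x) x) (hp'' : ∀ x, HasDerivAt p'' (p''' x) x) {a b B : ℝ}
    (hB : ∀ x ∈ Set.Icc a b, |p''' x| ≤ B) {m r : ℝ} (hr : 0 ≤ r) (h0 : a ≤ m - r) (h1 : m + r ≤ b) :
    |p (m + r) - p (m - r) - 2 * r * p' m| ≤ 2 * B * r ^ 3 := by
  have hB0 : 0 ≤ B := (abs_nonneg _).trans (hB m ⟨by linarith, by linarith⟩)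
  have hder : ∀ s : ℝ, HasDerivAt (fun s => p (m + s) - p (m - s) - 2 * s * p' m)
      (p' (m - s) - 2 * p' m + p' (m + s)) s := fun s => by
    have e1 := (hp (m + s)).comp_const_add m s
    have e2 := (hp (m - s)).comp_const_sub m s
    have e3 := ((hasDerivAt_id s).const_mul 2).mul_const (p' m)
    convert! (e1.sub e2).sub e3 using 1
    ring
  have h := abs_sub_le_of_deriv hder (a := 0) (b := r) (B := 2 * B * r ^ 2) (fun s hs => by
    refine (abs_second_difference_le hp' hp'' hB hs.1 (by linarith [hs.2]) (by linarith [hs.2])).trans ?_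
    have := hs.1
    have := hs.2
    gcongr) ⟨le_rfl, hr⟩ ⟨hr, le_rfl⟩
  simp only [add_zero, sub_zero, sub_self, mul_zero, zero_mul, abs_of_nonneg hr] at h
  refine h.trans_eq (by ring)

end Calculus

/-! ### Truncation errors on the space-time cylinder -/

namespace Problem

variable (P : Problem)

/-- A space-time box containing the cylinder and the memory of the fractional integrals. -/
def box : Set (ℝ × ℝ × ℝ) :=
  Set.Icc (P.a - (P.b - P.a) - 1) (P.b + (P.b - P.a) + 1)
    ×ˢ Set.Icc (P.c - (P.d - P.c) - 1) (P.d + (P.d - P.c) + 1) ×ˢ Set.Icc 0 P.T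

theorem exists_bound_box {H : ℝ × ℝ × ℝ → ℝ} (hH : Continuous H) :
    ∃ B, 0 ≤ B ∧ ∀ p ∈ P.box, |H p| ≤ B := by
  obtain ⟨B, hB⟩ := (isCompact_Icc.prod (isCompact_Icc.prod isCompact_Icc) :
    IsCompact P.box).exists_bound_of_continuousOn hH.continuousOn
  exact ⟨|B|, abs_nonneg B, fun p hp => (hB p hp).trans (le_abs_self B)⟩

/-- `G` vanishes beyond each side from which a derivative with nonzero coefficient starts. -/
def VanishesAcross (G : ℝ × ℝ × ℝ → ℝ) : Prop :=
  (∀ y ∈ Set.Icc P.c P.d, ∀ t ∈ Set.Icc 0 P.T,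
    VanishesBeyond P.K1x P.K2x P.a P.b fun x => G (x, y, t)) ∧
  (∀ x ∈ Set.Icc P.a P.b, ∀ t ∈ Set.Icc 0 P.T,
    VanishesBeyond P.K1y P.K2y P.c P.d fun y => G (x, y, t))

/-- The fractional derivative term in `x` of the equation, as a function on the closed cylinder. -/
def fracX (G : ℝ × ℝ × ℝ → ℝ) (x y t : ℝ) : ℝ :=
  twoSidedFrac P.K1x P.K2x P.α (P.b - P.a) (fun ξ => dX (dX G) (ξ, y, t)) x

/-- The fractional derivative term in `y` of the equation, as a function on the closed cylinder. -/
def fracY (G : ℝ × ℝ × ℝ → ℝ) (x y t : ℝ) : ℝ :=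
  twoSidedFrac P.K1y P.K2y P.β (P.d - P.c) (fun η => dY (dY G) (x, η, t)) y

variable {P} {G : ℝ × ℝ × ℝ → ℝ}

theorem mem_box {x y t : ℝ} (hx : x ∈ Set.Icc (P.a - (P.b - P.a)) (P.b + (P.b - P.a)))
    (hy : y ∈ Set.Icc (P.c - (P.d - P.c)) (P.d + (P.d - P.c))) (ht : t ∈ Set.Icc 0 P.T) :
    (x, y, t) ∈ P.box :=
  ⟨⟨by linarith [hx.1], by linarith [hx.2]⟩, ⟨by linarith [hy.1], by linarith [hy.2]⟩, ht⟩

theorem exists_spatial_consistency_x (s : Shifts) (hα : P.α < 2) (hG : ContDiff ℝ (7 : ℕ) G)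
    (hvan : P.VanishesAcross G) :
    ∃ C, 0 ≤ C ∧ ∀ y ∈ Set.Icc P.c P.d, ∀ t ∈ Set.Icc 0 P.T, ∀ (N : ℕ) (h : ℝ), 0 < h →
      N * h = P.b - P.a → ∀ i, 1 ≤ i → i < N →
        |twoSided P.K1x P.K2x s P.α h N (fun m => G (P.a + m * h, y, t)) i
          - compactOp s P.α h (fun m => P.fracX G (P.a + m * h) y t) i| ≤ C * h ^ 3 := by
  obtain ⟨C, hC, hcons⟩ := exists_twoSided_consistency s P.K1x P.K2x P.hα.1.le hα P.hab
  have hb : ∀ k : ℕ, ∃ B, k ≤ 7 → ∀ p ∈ P.box, |dX^[k] G p| ≤ B := fun k => by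
    by_cases hk : k ≤ 7
    · obtain ⟨B, -, hB⟩ := P.exists_bound_box
        (contDiff_iterate (fun _ _ => contDiff_dX) k hk hG).continuous
      exact ⟨B, fun _ => hB⟩
    · exact ⟨0, fun h => absurd h hk⟩
  choose B hB using hb
  refine ⟨C * ∑ k ∈ range 8, |B k|, by positivity, fun y hy t ht N h hh hN i hi1 hi => ?_⟩
  have key := hcons (∑ k ∈ range 8, |B k|) (fun ξ => G (ξ, y, t)) (by exact hG.comp (by fun_prop)) ?_
    (hvan.1 y hy t ht) N h hh hN i hi1 hi
  · rw [iteratedDeriv_line_dX hG y t 2 (by norm_num)] at key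
    exact key
  · intro k hk x hx
    rw [iteratedDeriv_line_dX hG y t k hk]
    have hab := P.hab
    have hcd := P.hcd
    refine (hB k hk (x, y, t) ⟨⟨by linarith [hx.1], by linarith [hx.2]⟩,
      ⟨by linarith [hy.1], by linarith [hy.2]⟩, ht⟩).trans ((le_abs_self _).trans ?_)
    exact single_le_sum (f := fun k => |B k|) (fun _ _ => abs_nonneg _) (mem_range.2 (by omega))

theorem exists_spatial_consistency_y (s : Shifts) (hβ : P.β < 2) (hG : ContDiff ℝ (7 : ℕ) G)
    (hvan : P.VanishesAcross G) :
    ∃ C, 0 ≤ C ∧ ∀ x ∈ Set.Icc P.a P.b, ∀ t ∈ Set.Icc 0 P.T, ∀ (N : ℕ) (h : ℝ), 0 < h →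
      N * h = P.d - P.c → ∀ j, 1 ≤ j → j < N →
        |twoSided P.K1y P.K2y s P.β h N (fun m => G (x, P.c + m * h, t)) j
          - compactOp s P.β h (fun m => P.fracY G x (P.c + m * h) t) j| ≤ C * h ^ 3 := by
  obtain ⟨C, hC, hcons⟩ := exists_twoSided_consistency s P.K1y P.K2y P.hβ.1.le hβ P.hcd
  have hb : ∀ k : ℕ, ∃ B, k ≤ 7 → ∀ p ∈ P.box, |dY^[k] G p| ≤ B := fun k => by
    by_cases hk : k ≤ 7
    · obtain ⟨B, -, hB⟩ := P.exists_bound_box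
        (contDiff_iterate (fun _ _ => contDiff_dY) k hk hG).continuous
      exact ⟨B, fun _ => hB⟩
    · exact ⟨0, fun h => absurd h hk⟩
  choose B hB using hb
  refine ⟨C * ∑ k ∈ range 8, |B k|, by positivity, fun x hx t ht N h hh hN i hi1 hi => ?_⟩
  have key := hcons (∑ k ∈ range 8, |B k|) (fun η => G (x, η, t)) (by exact hG.comp (by fun_prop)) ?_
    (hvan.2 x hx t ht) N h hh hN i hi1 hi
  · rw [iteratedDeriv_line_dY hG x t 2 (by norm_num)] at key
    exact key
  · intro k hk y hy
    rw [iteratedDeriv_line_dY hG x t k hk]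
    have hab := P.hab
    have hcd := P.hcd
    refine (hB k hk (x, y, t) ⟨⟨by linarith [hx.1], by linarith [hx.2]⟩,
      ⟨by linarith [hy.1], by linarith [hy.2]⟩, ht⟩).trans ((le_abs_self _).trans ?_)
    exact single_le_sum (f := fun k => |B k|) (fun _ _ => abs_nonneg _) (mem_range.2 (by omega))

/-- The differential equation extends by continuity to the closed cylinder, where the scheme samples
the source. -/
theorem equation_on_closed_cylinder (hα : P.α < 2) (hβ : P.β < 2) {u : ℝ → ℝ → ℝ → ℝ}
    (hu : P.IsSolution u) (hG : ContDiff ℝ (7 : ℕ) G) (hvan : P.VanishesAcross G)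
    (hGu : ∀ x ∈ Set.Icc P.a P.b, ∀ y ∈ Set.Icc P.c P.d, ∀ t ∈ Set.Icc 0 P.T,
      G (x, y, t) = u x y t) {x y t : ℝ} (hx : x ∈ Set.Icc P.a P.b) (hy : y ∈ Set.Icc P.c P.d)
    (ht : t ∈ Set.Icc 0 P.T) :
    dT G (x, y, t) = P.fracX G x y t + P.fracY G x y t + P.f x y t := by
  have hXX : ContDiff ℝ (5 : ℕ) (dX (dX G)) := contDiff_dX (contDiff_dX hG)
  have hYY : ContDiff ℝ (5 : ℕ) (dY (dY G)) := contDiff_dY (contDiff_dY hG)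
  have hint : Set.EqOn (dT G)
      (fun p => P.fracX G p.1 p.2.1 p.2.2 + P.fracY G p.1 p.2.1 p.2.2 + P.f p.1 p.2.1 p.2.2)
      (Set.Ioo P.a P.b ×ˢ Set.Ioo P.c P.d ×ˢ Set.Ioo 0 P.T) := by
    rintro ⟨x, y, t⟩ ⟨hx, hy, ht⟩
    simp only at hx hy ht ⊢
    have hxc := Set.Ioo_subset_Icc_self hx
    have hyc := Set.Ioo_subset_Icc_self hy
    have htc := Set.Ioo_subset_Icc_self ht
    have heq := hu.equation x hx y hy t ⟨ht.1, ht.2.le⟩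
    have hd : HasDerivWithinAt (fun r => u x y r) (dT G (x, y, t)) (Set.Icc 0 P.T) t :=
      (hasDerivAt_dT hG x y t).hasDerivWithinAt.congr (fun r hr => (hGu x hxc y hyc r hr).symm)
        (hGu x hxc y hyc t htc).symm
    rw [(uniqueDiffOn_Icc P.hT t htc).eq_deriv _ hd heq,
      twoSided_riemannLiouville P.K1x P.K2x P.hα.1 hα (v := fun ξ => G (ξ, y, t))
        (by exact (hG.of_le (by norm_cast)).comp (by fun_prop)) (hvan.1 y hyc t htc)
        (fun ξ hξ => (hGu ξ hξ y hyc t htc).symm) hx,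
      twoSided_riemannLiouville P.K1y P.K2y P.hβ.1 hβ (v := fun η => G (x, η, t))
        (by exact (hG.of_le (by norm_cast)).comp (by fun_prop)) (hvan.2 x hxc t htc)
        (fun η hη => (hGu x hxc η hη t htc).symm) hy,
      iteratedDeriv_line_dX hG y t 2 (by norm_num), iteratedDeriv_line_dY hG x t 2 (by norm_num)]
    rfl
  have hcX : Continuous fun p : ℝ × ℝ × ℝ => P.fracX G p.1 p.2.1 p.2.2 :=
    continuous_twoSidedFrac P.K1x P.K2x hα (P.b - P.a)
      (w := fun (p : ℝ × ℝ × ℝ) ξ => dX (dX G) (ξ, p.2.1, p.2.2))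
      (hXX.continuous.comp (by fun_prop : Continuous fun q : (ℝ × ℝ × ℝ) × ℝ =>
        (q.2, q.1.2.1, q.1.2.2))) continuous_fst
  have hcY : Continuous fun p : ℝ × ℝ × ℝ => P.fracY G p.1 p.2.1 p.2.2 :=
    continuous_twoSidedFrac P.K1y P.K2y hβ (P.d - P.c)
      (w := fun (p : ℝ × ℝ × ℝ) η => dY (dY G) (p.1, η, p.2.2))
      (hYY.continuous.comp (by fun_prop : Continuous fun q : (ℝ × ℝ × ℝ) × ℝ =>
        (q.1.1, q.2, q.1.2.2))) (by fun_prop)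
  refine hint.of_subset_closure (t := Set.Icc P.a P.b ×ˢ Set.Icc P.c P.d ×ˢ Set.Icc 0 P.T)
    (contDiff_dT hG).continuous.continuousOn ((hcX.add hcY).continuousOn.add P.hf)
    (Set.prod_mono Set.Ioo_subset_Icc_self
      (Set.prod_mono Set.Ioo_subset_Icc_self Set.Ioo_subset_Icc_self)) ?_ (x := (x, y, t)) ⟨hx, hy, ht⟩
  rw [closure_prod_eq, closure_prod_eq, closure_Ioo P.hab.ne, closure_Ioo P.hcd.ne, closure_Ioo P.hT.ne]

theorem exists_fracX_second_difference_le (hα : P.α < 2) (hG : ContDiff ℝ (7 : ℕ) G) :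
    ∃ C, 0 ≤ C ∧ ∀ x ∈ Set.Icc P.a P.b, ∀ y ∈ Set.Icc P.c P.d, ∀ m r : ℝ, 0 ≤ r → 0 ≤ m - r →
      m + r ≤ P.T →
        |P.fracX G x y (m - r) - 2 * P.fracX G x y m + P.fracX G x y (m + r)| ≤ C * r ^ 2 := by
  have h5 : ContDiff ℝ (5 : ℕ) (dX (dX G)) := contDiff_dX (contDiff_dX hG)
  have h4 : ContDiff ℝ (4 : ℕ) (dT (dX (dX G))) := contDiff_dT h5
  obtain ⟨B, hB0, hB⟩ := P.exists_bound_box (contDiff_dT h4).continuous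
  obtain ⟨C, hC, hle⟩ := exists_abs_twoSidedFrac_le P.K1x P.K2x hα (P.b - P.a)
  refine ⟨C * (2 * B), by positivity, fun x hx y hy m r hr h0 h1 => ?_⟩
  have hc : ∀ t, Continuous fun ξ => dX (dX G) (ξ, y, t) := fun t =>
    h5.continuous.comp (by fun_prop)
  have hcd := P.hcd
  unfold fracX
  rw [twoSidedFrac_second_difference _ _ hα _ (hc _) (hc _) (hc _)]
  refine (hle (2 * B * r ^ 2) _ x (fun ξ hξ => ?_) (by positivity)).trans_eq (by ring)
  exact abs_second_difference_le (fun t => hasDerivAt_dT h5 ξ y t) (fun t => hasDerivAt_dT h4 ξ y t)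
    (fun t ht => hB _ (mem_box ⟨by linarith [hξ.1, hx.1], by linarith [hξ.2, hx.2]⟩
      ⟨by linarith [hy.1], by linarith [hy.2]⟩ ht)) hr h0 h1

theorem exists_fracY_second_difference_le (hβ : P.β < 2) (hG : ContDiff ℝ (7 : ℕ) G) :
    ∃ C, 0 ≤ C ∧ ∀ x ∈ Set.Icc P.a P.b, ∀ y ∈ Set.Icc P.c P.d, ∀ m r : ℝ, 0 ≤ r → 0 ≤ m - r →
      m + r ≤ P.T →
        |P.fracY G x y (m - r) - 2 * P.fracY G x y m + P.fracY G x y (m + r)| ≤ C * r ^ 2 := by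
  have h5 : ContDiff ℝ (5 : ℕ) (dY (dY G)) := contDiff_dY (contDiff_dY hG)
  have h4 : ContDiff ℝ (4 : ℕ) (dT (dY (dY G))) := contDiff_dT h5
  obtain ⟨B, hB0, hB⟩ := P.exists_bound_box (contDiff_dT h4).continuous
  obtain ⟨C, hC, hle⟩ := exists_abs_twoSidedFrac_le P.K1y P.K2y hβ (P.d - P.c)
  refine ⟨C * (2 * B), by positivity, fun x hx y hy m r hr h0 h1 => ?_⟩
  have hc : ∀ t, Continuous fun η => dY (dY G) (x, η, t) := fun t =>
    h5.continuous.comp (by fun_prop)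
  have hab := P.hab
  unfold fracY
  rw [twoSidedFrac_second_difference _ _ hβ _ (hc _) (hc _) (hc _)]
  refine (hle (2 * B * r ^ 2) _ y (fun η hη => ?_) (by positivity)).trans_eq (by ring)
  exact abs_second_difference_le (fun t => hasDerivAt_dT h5 x η t) (fun t => hasDerivAt_dT h4 x η t)
    (fun t ht => hB _ (mem_box ⟨by linarith [hx.1], by linarith [hx.2]⟩
      ⟨by linarith [hη.1, hy.1], by linarith [hη.2, hy.2]⟩ ht)) hr h0 h1

/-- Third order accuracy of the central time difference over a step of length `2 r`. -/
theorem exists_time_difference_le (hG : ContDiff ℝ (7 : ℕ) G) :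
    ∃ C, 0 ≤ C ∧ ∀ x ∈ Set.Icc P.a P.b, ∀ y ∈ Set.Icc P.c P.d, ∀ m r : ℝ, 0 ≤ r → 0 ≤ m - r →
      m + r ≤ P.T →
        |G (x, y, m + r) - G (x, y, m - r) - 2 * r * dT G (x, y, m)| ≤ C * r ^ 3 := by
  have h6 : ContDiff ℝ (6 : ℕ) (dT G) := contDiff_dT hG
  have h5 : ContDiff ℝ (5 : ℕ) (dT (dT G)) := contDiff_dT h6
  obtain ⟨B, hB0, hB⟩ := P.exists_bound_box (contDiff_dT h5).continuous
  refine ⟨2 * B, by positivity, fun x hx y hy m r hr h0 h1 => ?_⟩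
  have hab := P.hab
  have hcd := P.hcd
  exact abs_central_difference_le (fun t => hasDerivAt_dT hG x y t) (fun t => hasDerivAt_dT h6 x y t)
    (fun t => hasDerivAt_dT h5 x y t) (fun t ht => hB _ (mem_box
      ⟨by linarith [hx.1], by linarith [hx.2]⟩ ⟨by linarith [hy.1], by linarith [hy.2]⟩ ht)) hr h0 h1

/-- The mixed operator is bounded by the mixed fourth derivative alone. The second derivatives in `x` of
the grid operator in `y` are that operator applied to second derivatives in `x`. -/
theorem exists_abs_mixed_le (P : Problem) (s : Shifts) :
    ∃ C, 0 ≤ C ∧ ∀ (B : ℝ) (E Ex Exx Exxy Exxyy : ℝ → ℝ → ℝ),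
      (∀ x y, HasDerivAt (fun ξ => E ξ y) (Ex x y) x) →
      (∀ x y, HasDerivAt (fun ξ => Ex ξ y) (Exx x y) x) →
      (∀ x y, HasDerivAt (Exx x) (Exxy x y) y) →
      (∀ x y, HasDerivAt (Exxy x) (Exxyy x y) y) →
      (∀ x ∈ Set.Icc P.a P.b, ∀ y ∈ Set.Icc P.c P.d, |Exxyy x y| ≤ B) →
      (∀ y ∈ Set.Icc P.c P.d, VanishesBeyond P.K1x P.K2x P.a P.b fun x => E x y) →
      (∀ x ∈ Set.Icc P.a P.b, VanishesBeyond P.K1y P.K2y P.c P.d (E x)) →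
      ∀ (Nx Ny : ℕ) (h : ℝ), 0 < h → Nx * h = P.b - P.a → Ny * h = P.d - P.c →
      ∀ i j, 1 ≤ i → i < Nx → 1 ≤ j → j < Ny →
        |P.δx s h Nx (P.δy s h Ny fun i j => E (P.gridX h i) (P.gridY h j)) i j| ≤ C * B := by
  obtain ⟨Cx, hCx, hx⟩ := exists_abs_twoSided_le s P.K1x P.K2x P.hα.1.le P.hα.2 P.hab
  obtain ⟨Cy, hCy, hy⟩ := exists_abs_twoSided_le s P.K1y P.K2y P.hβ.1.le P.hβ.2 P.hcd
  refine ⟨Cx * Cy, by positivity, fun B E Ex Exx Exxy Exxyy d1 d2 d3 d4 hB vx vy Nx Ny h hh hNx hNy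
    i j hi1 hi hj1 hj => ?_⟩
  have hloc := isGridFunctional_twoSided P.K1y P.K2y s P.β h hj1 hj
  have hgrid : ∀ m ≤ Ny, P.c + m * h ∈ Set.Icc P.c P.d := fun m hm => by
    have : (m : ℝ) ≤ Ny := by exact_mod_cast hm
    constructor <;> nlinarith [mul_nonneg m.cast_nonneg hh.le]
  -- the derivatives in `x` also vanish beyond the sides in `y`
  have vy2 : ∀ x ∈ Set.Icc P.a P.b, VanishesBeyond P.K1y P.K2y P.c P.d (Exx x) := by
    have step : ∀ y, (∀ x ∈ Set.Icc P.a P.b, E x y = 0) → ∀ x ∈ Set.Icc P.a P.b, Exx x y = 0 := by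
      intro y h0 x hx
      exact eq_zero_of_hasDerivAt_of_vanish P.hab (d2 x y)
        (fun z hz => eq_zero_of_hasDerivAt_of_vanish P.hab (d1 z y) h0 hz) hx
    exact fun x hx => ⟨fun h0 y hy => step y (fun z hz => (vy z hz).1 h0 y hy) x hx,
      fun h0 y hy => step y (fun z hz => (vy z hz).2 h0 y hy) x hx⟩
  have vgrid : ∀ x, (∀ y ∈ Set.Icc P.c P.d, E x y = 0) →
      twoSided P.K1y P.K2y s P.β h Ny (fun m => E x (P.c + m * h)) j = 0 := fun x h0 => by
    rw [hloc.congr_grid (w := fun _ => 0) fun m hm => h0 _ (hgrid m hm)]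
    exact hloc.map_zero
  have key := hx (Cy * B)
    (fun x => twoSided P.K1y P.K2y s P.β h Ny (fun m => E x (P.c + m * h)) j)
    (fun x => twoSided P.K1y P.K2y s P.β h Ny (fun m => Ex x (P.c + m * h)) j)
    (fun x => twoSided P.K1y P.K2y s P.β h Ny (fun m => Exx x (P.c + m * h)) j)
    (fun x => hloc.hasDerivAt (F := fun z m => E z (P.c + m * h))
      (F' := fun z m => Ex z (P.c + m * h)) fun m => d1 x _)
    (fun x => hloc.hasDerivAt (F := fun z m => Ex z (P.c + m * h))
      (F' := fun z m => Exx z (P.c + m * h)) fun m => d2 x _)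
    (fun x hx => hy B (Exx x) (Exxy x) (Exxyy x) (d3 x) (d4 x) (hB x hx) (vy2 x hx) Ny h hh hNy j
      hj1 hj)
    ⟨fun h0 x hx => vgrid x fun y hy => (vx y hy).1 h0 x hx,
      fun h0 x hx => vgrid x fun y hy => (vx y hy).2 h0 x hx⟩ Nx h hh hNx i hi1 hi
  rw [mul_assoc]
  exact key

end Problem

/-! ### Residual of the scheme -/

theorem VanishesBeyond.sub {K₁ K₂ a b : ℝ} {v w : ℝ → ℝ} (hv : VanishesBeyond K₁ K₂ a b v)
    (hw : VanishesBeyond K₁ K₂ a b w) : VanishesBeyond K₁ K₂ a b fun x => v x - w x :=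
  ⟨fun k x hx => sub_eq_zero.2 ((hv.1 k x hx).trans (hw.1 k x hx).symm),
    fun k x hx => sub_eq_zero.2 ((hv.2 k x hx).trans (hw.2 k x hx).symm)⟩

namespace Problem

variable {P : Problem} {G : ℝ × ℝ × ℝ → ℝ}

/-- Values on the grid of a function of `(x, y, t)` at time `t`. -/
def gridValues (P : Problem) (h : ℝ) (G : ℝ × ℝ × ℝ → ℝ) (t : ℝ) : Grid := fun i j =>
  G (P.gridX h i, P.gridY h j, t)

theorem gridX_mem {h : ℝ} (hh : 0 < h) {N : ℕ} (hN : N * h = P.b - P.a) {i : ℕ} (hi : i ≤ N) :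
    P.gridX h i ∈ Set.Icc P.a P.b := by
  have : (i : ℝ) ≤ N := by exact_mod_cast hi
  unfold gridX
  constructor <;> nlinarith [mul_nonneg i.cast_nonneg hh.le]

theorem gridY_mem {h : ℝ} (hh : 0 < h) {N : ℕ} (hN : N * h = P.d - P.c) {j : ℕ} (hj : j ≤ N) :
    P.gridY h j ∈ Set.Icc P.c P.d := by
  have : (j : ℝ) ≤ N := by exact_mod_cast hj
  unfold gridY
  constructor <;> nlinarith [mul_nonneg j.cast_nonneg hh.le]

theorem gridX_mem_Ioo {h : ℝ} (hh : 0 < h) {N : ℕ} (hN : N * h = P.b - P.a) {i : ℕ} (h0 : 0 < i)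
    (hi : i < N) : P.gridX h i ∈ Set.Ioo P.a P.b := by
  have h1 : (i : ℝ) < N := by exact_mod_cast hi
  have h2 : (0 : ℝ) < i := by exact_mod_cast h0
  unfold gridX
  constructor <;> nlinarith [mul_pos h2 hh]

theorem gridY_mem_Ioo {h : ℝ} (hh : 0 < h) {N : ℕ} (hN : N * h = P.d - P.c) {j : ℕ} (h0 : 0 < j)
    (hj : j < N) : P.gridY h j ∈ Set.Ioo P.c P.d := by
  have h1 : (j : ℝ) < N := by exact_mod_cast hj
  have h2 : (0 : ℝ) < j := by exact_mod_cast h0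
  unfold gridY
  constructor <;> nlinarith [mul_pos h2 hh]

/-- The mixed operator applied to an increment in time of the solution is of the order of the time
step. -/
theorem exists_abs_mixed_increment_le (s : Shifts) (hG : ContDiff ℝ (7 : ℕ) G)
    (hvan : P.VanishesAcross G) :
    ∃ C, 0 ≤ C ∧ ∀ (Nx Ny : ℕ) (h : ℝ), 0 < h → Nx * h = P.b - P.a → Ny * h = P.d - P.c →
      ∀ i j, 1 ≤ i → i < Nx → 1 ≤ j → j < Ny → ∀ m r : ℝ, 0 ≤ r → 0 ≤ m - r → m + r ≤ P.T →
        |P.δx s h Nx (P.δy s h Ny fun i j =>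
          P.gridValues h G (m + r) i j - P.gridValues h G (m - r) i j) i j| ≤ C * r := by
  obtain ⟨C, hC, hmix⟩ := exists_abs_mixed_le P s
  have h6 : ContDiff ℝ (6 : ℕ) (dX G) := contDiff_dX hG
  have h5 : ContDiff ℝ (5 : ℕ) (dX (dX G)) := contDiff_dX h6
  have h4 : ContDiff ℝ (4 : ℕ) (dY (dX (dX G))) := contDiff_dY h5
  have h3 : ContDiff ℝ (3 : ℕ) (dY (dY (dX (dX G)))) := contDiff_dY h4
  obtain ⟨B, hB0, hB⟩ := P.exists_bound_box (contDiff_dT h3).continuous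
  refine ⟨C * (2 * B), by positivity, fun Nx Ny h hh hNx hNy i j hi1 hi hj1 hj m r hr h0 h1 => ?_⟩
  have hab := P.hab
  have hcd := P.hcd
  have m0 : m - r ∈ Set.Icc 0 P.T := ⟨h0, by linarith⟩
  have m1 : m + r ∈ Set.Icc 0 P.T := ⟨by linarith, h1⟩
  have key := hmix (2 * B * r) (fun x y => G (x, y, m + r) - G (x, y, m - r))
    (fun x y => dX G (x, y, m + r) - dX G (x, y, m - r))
    (fun x y => dX (dX G) (x, y, m + r) - dX (dX G) (x, y, m - r))
    (fun x y => dY (dX (dX G)) (x, y, m + r) - dY (dX (dX G)) (x, y, m - r))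
    (fun x y => dY (dY (dX (dX G))) (x, y, m + r) - dY (dY (dX (dX G))) (x, y, m - r))
    (fun x y => (hasDerivAt_dX hG x y _).sub (hasDerivAt_dX hG x y _))
    (fun x y => (hasDerivAt_dX h6 x y _).sub (hasDerivAt_dX h6 x y _))
    (fun x y => (hasDerivAt_dY h5 x y _).sub (hasDerivAt_dY h5 x y _))
    (fun x y => (hasDerivAt_dY h4 x y _).sub (hasDerivAt_dY h4 x y _)) ?_ ?_ ?_
    Nx Ny h hh hNx hNy i j hi1 hi hj1 hj
  · exact key.trans_eq (by ring)
  · intro x hx y hy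
    refine (abs_sub_le_of_deriv (fun t => hasDerivAt_dT h3 x y t) (fun t ht => hB _ (mem_box
      ⟨by linarith [hx.1], by linarith [hx.2]⟩ ⟨by linarith [hy.1], by linarith [hy.2]⟩ ht))
      m0 m1).trans_eq ?_
    rw [show m + r - (m - r) = 2 * r by ring, abs_of_nonneg (by positivity)]
    ring
  · intro y hy
    exact (hvan.1 y hy _ m1).sub (hvan.1 y hy _ m0)
  · intro x hx
    exact (hvan.2 x hx _ m1).sub (hvan.2 x hx _ m0)

theorem exists_abs_mixed_gridValues_le (s : Shifts) (hG : ContDiff ℝ (4 : ℕ) G)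
    (hvan : P.VanishesAcross G) :
    ∃ C, 0 ≤ C ∧ ∀ (Nx Ny : ℕ) (h : ℝ), 0 < h → Nx * h = P.b - P.a → Ny * h = P.d - P.c →
      ∀ i j, 1 ≤ i → i < Nx → 1 ≤ j → j < Ny → ∀ t ∈ Set.Icc 0 P.T,
        |P.δx s h Nx (P.δy s h Ny (P.gridValues h G t)) i j| ≤ C := by
  obtain ⟨C, hC, hmix⟩ := exists_abs_mixed_le P s
  have h3 : ContDiff ℝ (3 : ℕ) (dX G) := contDiff_dX hG
  have h2 : ContDiff ℝ (2 : ℕ) (dX (dX G)) := contDiff_dX h3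
  have h1 : ContDiff ℝ (1 : ℕ) (dY (dX (dX G))) := contDiff_dY h2
  have h0 : ContDiff ℝ (0 : ℕ) (dY (dY (dX (dX G)))) := contDiff_dY h1
  obtain ⟨B, hB0, hB⟩ := P.exists_bound_box h0.continuous
  refine ⟨C * B, by positivity, fun Nx Ny h hh hNx hNy i j hi1 hi hj1 hj t ht => ?_⟩
  have hab := P.hab
  have hcd := P.hcd
  exact hmix B (fun x y => G (x, y, t)) (fun x y => dX G (x, y, t)) (fun x y => dX (dX G) (x, y, t))
    (fun x y => dY (dX (dX G)) (x, y, t)) (fun x y => dY (dY (dX (dX G))) (x, y, t))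
    (fun x y => hasDerivAt_dX hG x y _) (fun x y => hasDerivAt_dX h3 x y _)
    (fun x y => hasDerivAt_dY h2 x y _) (fun x y => hasDerivAt_dY h1 x y _)
    (fun x hx y hy => hB _ (mem_box ⟨by linarith [hx.1], by linarith [hx.2]⟩
      ⟨by linarith [hy.1], by linarith [hy.2]⟩ ht))
    (fun y hy => hvan.1 y hy t ht) (fun x hx => hvan.2 x hx t ht) Nx Ny h hh hNx hNy i j hi1 hi hj1 hj

/-- The factorized operator multiplied out. -/
theorem factorOp_eq (s : Shifts) (h r : ℝ) {Nx Ny : ℕ} (v : Grid) {i j : ℕ} (hi1 : 1 ≤ i)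
    (hi : i < Nx) :
    P.factorOp s h r Nx Ny v i j = P.Cx s h (P.Cy s h v) i j + r * P.Cx s h (P.δy s h Ny v) i j
      + r * P.δx s h Nx (P.Cy s h v) i j + r ^ 2 * P.δx s h Nx (P.δy s h Ny v) i j := by
  have e1 := (isGridFunctional_compactOp s P.α h hi).map_combination 1 r
    (fun i' => P.Cy s h v i' j) (fun i' => P.δy s h Ny v i' j)
  have e2 := (isGridFunctional_twoSided P.K1x P.K2x s P.α h hi1 hi).map_combination 1 r
    (fun i' => P.Cy s h v i' j) (fun i' => P.δy s h Ny v i' j)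
  simp only [one_mul] at e1 e2
  change compactOp s P.α h (fun i' => P.Cy s h v i' j + r * P.δy s h Ny v i' j) i
    + r * twoSided P.K1x P.K2x s P.α h Nx (fun i' => P.Cy s h v i' j + r * P.δy s h Ny v i' j) i = _
  rw [e1, e2]
  change _ = compactOp s P.α h (fun i' => P.Cy s h v i' j) i
    + r * compactOp s P.α h (fun i' => P.δy s h Ny v i' j) i
    + r * twoSided P.K1x P.K2x s P.α h Nx (fun i' => P.Cy s h v i' j) i
    + r ^ 2 * twoSided P.K1x P.K2x s P.α h Nx (fun i' => P.δy s h Ny v i' j) i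
  ring

theorem δx_δy_sub (s : Shifts) (h : ℝ) {Nx Ny : ℕ} (v w : Grid) {i j : ℕ} (hi1 : 1 ≤ i)
    (hi : i < Nx) (hj1 : 1 ≤ j) (hj : j < Ny) :
    P.δx s h Nx (P.δy s h Ny fun i j => v i j - w i j) i j
      = P.δx s h Nx (P.δy s h Ny v) i j - P.δx s h Nx (P.δy s h Ny w) i j := by
  change twoSided P.K1x P.K2x s P.α h Nx
    (fun i' => twoSided P.K1y P.K2y s P.β h Ny (fun j' => v i' j' - w i' j') j) i = _
  simp only [(isGridFunctional_twoSided P.K1y P.K2y s P.β h hj1 hj).map_sub]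
  exact (isGridFunctional_twoSided P.K1x P.K2x s P.α h hi1 hi).map_sub _ _

theorem abs_Cx_Cy_le (s : Shifts) {h B : ℝ} (hα0 : 0 ≤ compactCoeff s P.α)
    (hα : compactCoeff s P.α ≤ 1 / 2) (hβ0 : 0 ≤ compactCoeff s P.β)
    (hβ : compactCoeff s P.β ≤ 1 / 2) (hh : h ≠ 0) {v : Grid} {Nx Ny i j : ℕ} (hi : i < Nx)
    (hj : j < Ny) (hv : ∀ i ≤ Nx, ∀ j ≤ Ny, |v i j| ≤ B) : |P.Cx s h (P.Cy s h v) i j| ≤ B := by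
  have hy : ∀ i ≤ Nx, |P.Cy s h v i j| ≤ B := fun i hi =>
    abs_compactOp_le s hβ0 hβ hh (hv i hi _ (by omega)) (hv i hi _ (by omega)) (hv i hi _ (by omega))
  exact abs_compactOp_le s hα0 hα hh (hy _ (by omega)) (hy _ (by omega)) (hy _ (by omega))

/-- Residual of the solution over a step of length `2 r` centred at `m`: the Crank-Nicolson error, the
errors in space of the four mixed products, and the splitting error `r² δx δy`. -/
theorem exists_residual_le (s : Shifts) (hα : P.α < 2) (hβ : P.β < 2)
    (hα0 : 0 ≤ compactCoeff s P.α) (hα1 : compactCoeff s P.α ≤ 1 / 2) (hβ0 : 0 ≤ compactCoeff s P.β)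
    (hβ1 : compactCoeff s P.β ≤ 1 / 2) {u : ℝ → ℝ → ℝ → ℝ}
    (hu : P.IsSolution u) (hG : ContDiff ℝ (7 : ℕ) G) (hvan : P.VanishesAcross G)
    (hGu : ∀ x ∈ Set.Icc P.a P.b, ∀ y ∈ Set.Icc P.c P.d, ∀ t ∈ Set.Icc 0 P.T,
      G (x, y, t) = u x y t) :
    ∃ C, 0 ≤ C ∧ ∀ (Nx Ny : ℕ) (h : ℝ), 0 < h → Nx * h = P.b - P.a → Ny * h = P.d - P.c →
      ∀ i j, 1 ≤ i → i < Nx → 1 ≤ j → j < Ny → ∀ m r : ℝ, 0 ≤ r → 0 ≤ m - r → m + r ≤ P.T →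
        |P.factorOp s h (-r) Nx Ny (P.gridValues h G (m + r)) i j
          - P.factorOp s h r Nx Ny (P.gridValues h G (m - r)) i j
          - 2 * r * P.Cx s h (P.Cy s h (P.sample h P.f m)) i j| ≤ C * r * (r ^ 2 + h ^ 3) := by
  obtain ⟨C₁, hC₁, hX⟩ := exists_spatial_consistency_x s hα hG hvan
  obtain ⟨C₂, hC₂, hY⟩ := exists_spatial_consistency_y s hβ hG hvan
  obtain ⟨C₃, hC₃, hXt⟩ := exists_fracX_second_difference_le (P := P) hα hG
  obtain ⟨C₄, hC₄, hYt⟩ := exists_fracY_second_difference_le (P := P) hβ hG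
  obtain ⟨C₅, hC₅, ht⟩ := exists_time_difference_le (P := P) hG
  obtain ⟨C₆, hC₆, hmix⟩ := exists_abs_mixed_increment_le s hG hvan
  refine ⟨2 * C₁ + 2 * C₂ + C₃ + C₄ + C₅ + C₆, by positivity,
    fun Nx Ny h hh hNx hNy i j hi1 hi hj1 hj m r hr h0 h1 => ?_⟩
  have mm : m ∈ Set.Icc 0 P.T := ⟨by linarith, by linarith⟩
  have m0 : m - r ∈ Set.Icc 0 P.T := ⟨h0, by linarith⟩
  have m1 : m + r ∈ Set.Icc 0 P.T := ⟨by linarith, h1⟩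
  set X : ℝ → Grid := fun t i j => P.fracX G (P.gridX h i) (P.gridY h j) t with hXdef
  set Y : ℝ → Grid := fun t i j => P.fracY G (P.gridX h i) (P.gridY h j) t with hYdef
  -- consistency of the mixed products of compact and difference operators
  have cY : ∀ t ∈ Set.Icc 0 P.T, |P.Cx s h (P.δy s h Ny (P.gridValues h G t)) i j
      - P.Cx s h (P.Cy s h (Y t)) i j| ≤ C₂ * h ^ 3 := by
    intro t ht
    have := (isGridFunctional_compactOp s P.α h hi).map_sub
      (fun i' => P.δy s h Ny (P.gridValues h G t) i' j) (fun i' => P.Cy s h (Y t) i' j)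
    refine (congrArg abs this).symm.trans_le ?_
    have b : ∀ i' ≤ Nx, |P.δy s h Ny (P.gridValues h G t) i' j - P.Cy s h (Y t) i' j| ≤ C₂ * h ^ 3 :=
      fun i' hi' => hY _ (gridX_mem hh hNx hi') t ht Ny h hh hNy j hj1 hj
    exact abs_compactOp_le s hα0 hα1 hh.ne' (b _ (by omega)) (b _ (by omega)) (b _ (by omega))
  have cX : ∀ t ∈ Set.Icc 0 P.T, |P.δx s h Nx (P.Cy s h (P.gridValues h G t)) i j
      - P.Cx s h (P.Cy s h (X t)) i j| ≤ C₁ * h ^ 3 := by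
    intro t ht
    have e1 : P.δx s h Nx (P.Cy s h (P.gridValues h G t)) i j
        = P.Cy s h (P.δx s h Nx (P.gridValues h G t)) i j :=
      (isGridFunctional_twoSided P.K1x P.K2x s P.α h hi1 hi).comm
        (isGridFunctional_compactOp s P.β h hj) _
    have e2 : P.Cx s h (P.Cy s h (X t)) i j = P.Cy s h (P.Cx s h (X t)) i j :=
      (isGridFunctional_compactOp s P.α h hi).comm (isGridFunctional_compactOp s P.β h hj) _
    have := (isGridFunctional_compactOp s P.β h hj).map_sub
      (fun j' => P.δx s h Nx (P.gridValues h G t) i j') (fun j' => P.Cx s h (X t) i j')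
    rw [e1, e2]
    refine (congrArg abs this).symm.trans_le ?_
    have b : ∀ j' ≤ Ny, |P.δx s h Nx (P.gridValues h G t) i j' - P.Cx s h (X t) i j'| ≤ C₁ * h ^ 3 :=
      fun j' hj' => hX _ (gridY_mem hh hNy hj') t ht Nx h hh hNx i hi1 hi
    exact abs_compactOp_le s hβ0 hβ1 hh.ne' (b _ (by omega)) (b _ (by omega)) (b _ (by omega))
  -- truncation error of the Crank-Nicolson discretization in time
  set Z : Grid := fun i j => P.gridValues h G (m + r) i j - P.gridValues h G (m - r) i j
    - r * (X (m + r) i j + X (m - r) i j + Y (m + r) i j + Y (m - r) i j)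
    - 2 * r * P.sample h P.f m i j with hZ
  have hZb : ∀ i ≤ Nx, ∀ j ≤ Ny, |Z i j| ≤ (C₃ + C₄ + C₅) * r ^ 3 := by
    intro i hi j hj
    have gx := gridX_mem hh hNx hi
    have gy := gridY_mem hh hNy hj
    have b1 := ht _ gx _ gy m r hr h0 h1
    have b2 := hXt _ gx _ gy m r hr h0 h1
    have b3 := hYt _ gx _ gy m r hr h0 h1
    have heq := equation_on_closed_cylinder hα hβ hu hG hvan hGu gx gy mm
    have e : Z i j = (G (P.gridX h i, P.gridY h j, m + r) - G (P.gridX h i, P.gridY h j, m - r)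
          - 2 * r * dT G (P.gridX h i, P.gridY h j, m))
        - r * (X (m - r) i j - 2 * X m i j + X (m + r) i j)
        - r * (Y (m - r) i j - 2 * Y m i j + Y (m + r) i j) := by
      rw [heq]
      simp only [hZ, hXdef, hYdef, gridValues, sample]
      ring
    rw [e]
    refine (abs_sub _ _).trans ((add_le_add_left (abs_sub _ _) _).trans ?_)
    rw [abs_mul, abs_mul, abs_of_nonneg hr]
    calc _ ≤ C₅ * r ^ 3 + r * (C₃ * r ^ 2) + r * (C₄ * r ^ 2) := by gcongr
      _ = _ := by ring
  have hCZ := abs_Cx_Cy_le (P := P) s hα0 hα1 hβ0 hβ1 hh.ne' hi hj hZb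
  have hlin : P.Cx s h (P.Cy s h Z) i j = P.Cx s h (P.Cy s h (P.gridValues h G (m + r))) i j
      - P.Cx s h (P.Cy s h (P.gridValues h G (m - r))) i j
      - r * (P.Cx s h (P.Cy s h (X (m + r))) i j + P.Cx s h (P.Cy s h (X (m - r))) i j
        + P.Cx s h (P.Cy s h (Y (m + r))) i j + P.Cx s h (P.Cy s h (Y (m - r))) i j)
      - 2 * r * P.Cx s h (P.Cy s h (P.sample h P.f m)) i j := by
    simp only [hZ, Cx, Cy, compactOp, centralDiff]
    ring
  have hD := hmix Nx Ny h hh hNx hNy i j hi1 hi hj1 hj m r hr h0 h1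
  rw [δx_δy_sub s h _ _ hi1 hi hj1 hj] at hD
  rw [factorOp_eq s h (-r) _ hi1 hi, factorOp_eq s h r _ hi1 hi]
  have y0 := cY _ m0
  have y1 := cY _ m1
  have x0 := cX _ m0
  have x1 := cX _ m1
  have key : ∀ {z c1 c2 c3 c4 d B1 B2 B3 B4 : ℝ}, |z| ≤ B1 → |c1| ≤ B2 → |c2| ≤ B2 → |c3| ≤ B3 →
      |c4| ≤ B3 → |d| ≤ B4 → |z - r * (c1 + c2 + c3 + c4) + r ^ 2 * d|
        ≤ B1 + r * (B2 + B2 + B3 + B3) + r ^ 2 * B4 := by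
    intro z c1 c2 c3 c4 d B1 B2 B3 B4 hz h1 h2 h3 h4 hd
    refine (abs_add_le _ _).trans (add_le_add ((abs_sub _ _).trans (add_le_add hz ?_)) ?_)
    · rw [abs_mul, abs_of_nonneg hr]
      gcongr
      rw [abs_le] at *
      constructor <;> linarith
    · rw [abs_mul, abs_of_nonneg (sq_nonneg r)]
      gcongr
  have fin := key hCZ y0 y1 x0 x1 hD
  rw [hlin] at fin
  refine le_of_eq_of_le (congrArg abs ?_) (fin.trans ?_)
  · ring
  · have p1 : 0 ≤ r * h ^ 3 := by positivity
    have p2 : 0 ≤ r ^ 3 := by positivity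
    nlinarith [mul_nonneg hC₁ p1, mul_nonneg hC₂ p1, mul_nonneg hC₃ p1, mul_nonneg hC₄ p1,
      mul_nonneg hC₅ p1, mul_nonneg hC₆ p1, mul_nonneg hC₁ p2, mul_nonneg hC₂ p2]

end Problem

/-! ### Stability and convergence of the scheme -/

section Convergence

theorem Shifts.Admissible.lt_two {s : Shifts} {α : ℝ} (h : s.Admissible α) : α < 2 := by
  cases s <;> exact h.2

theorem Shifts.Admissible.compactCoeff_nonneg {s : Shifts} {α : ℝ} (h : s.Admissible α) (h1 : 1 < α) :
    0 ≤ compactCoeff s α := by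
  have h2 := h.lt_two
  cases s
  · unfold compactCoeff
    nlinarith
  · unfold compactCoeff
    nlinarith

/-- The lower bound on the order for the shifts `(1, -1)` is the one that makes the compact operator
coercive. -/
theorem Shifts.Admissible.compactCoeff_lt {s : Shifts} {α : ℝ} (h : s.Admissible α) :
    compactCoeff s α < 1 / 4 := by
  cases s
  · unfold compactCoeff
    nlinarith [sq_nonneg (α - 7 / 6)]
  · have h1 : Real.sqrt 73 < 6 * α - 1 := by
      have := h.1
      linarith
    have h2 := Real.sq_sqrt (show (0 : ℝ) ≤ 73 by norm_num)
    have h3 := Real.sqrt_nonneg (73 : ℝ)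
    unfold compactCoeff
    nlinarith

namespace Problem

variable {P : Problem}

theorem isGridFunctional_factorX (P : Problem) (s : Shifts) (h r : ℝ) {N i : ℕ} (hi1 : 1 ≤ i)
    (hi : i < N) : IsGridFunctional N fun v =>
      compactOp s P.α h v i + r * twoSided P.K1x P.K2x s P.α h N v i :=
  (isGridFunctional_compactOp s P.α h hi).add
    ((isGridFunctional_twoSided P.K1x P.K2x s P.α h hi1 hi).const_mul r)

theorem isGridFunctional_factorY (P : Problem) (s : Shifts) (h r : ℝ) {N j : ℕ} (hj1 : 1 ≤ j)
    (hj : j < N) : IsGridFunctional N fun v =>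
      compactOp s P.β h v j + r * twoSided P.K1y P.K2y s P.β h N v j :=
  (isGridFunctional_compactOp s P.β h hj).add
    ((isGridFunctional_twoSided P.K1y P.K2y s P.β h hj1 hj).const_mul r)

theorem factorOp_congr (s : Shifts) (h r : ℝ) {Nx Ny : ℕ} {v w : Grid} {i j : ℕ} (hi1 : 1 ≤ i)
    (hi : i < Nx) (hj1 : 1 ≤ j) (hj : j < Ny) (hvw : ∀ i ≤ Nx, ∀ j ≤ Ny, v i j = w i j) :
    P.factorOp s h r Nx Ny v i j = P.factorOp s h r Nx Ny w i j :=
  (P.isGridFunctional_factorX s h r hi1 hi).congr_grid fun m hm =>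
    (P.isGridFunctional_factorY s h r hj1 hj).congr_grid fun k hk => hvw m hm k hk

theorem δx_δy_congr (s : Shifts) (h : ℝ) {Nx Ny : ℕ} {v w : Grid} {i j : ℕ} (hi1 : 1 ≤ i)
    (hi : i < Nx) (hj1 : 1 ≤ j) (hj : j < Ny) (hvw : ∀ i ≤ Nx, ∀ j ≤ Ny, v i j = w i j) :
    P.δx s h Nx (P.δy s h Ny v) i j = P.δx s h Nx (P.δy s h Ny w) i j :=
  (isGridFunctional_twoSided P.K1x P.K2x s P.α h hi1 hi).congr_grid fun m hm =>
    (isGridFunctional_twoSided P.K1y P.K2y s P.β h hj1 hj).congr_grid fun k hk => hvw m hm k hk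

theorem factorOp_sub (s : Shifts) (h r : ℝ) {Nx Ny : ℕ} (v w : Grid) {i j : ℕ} (hi1 : 1 ≤ i)
    (hi : i < Nx) (hj1 : 1 ≤ j) (hj : j < Ny) :
    P.factorOp s h r Nx Ny (v - w) i j
      = P.factorOp s h r Nx Ny v i j - P.factorOp s h r Nx Ny w i j := by
  have hy := fun m : ℕ => (P.isGridFunctional_factorY s h r hj1 hj).map_sub (v m) (w m)
  have hx := (P.isGridFunctional_factorX s h r hi1 hi).map_sub
    (fun m => compactOp s P.β h (v m) j + r * twoSided P.K1y P.K2y s P.β h Ny (v m) j)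
    (fun m => compactOp s P.β h (w m) j + r * twoSided P.K1y P.K2y s P.β h Ny (w m) j)
  simp only [← hy] at hx
  exact hx

section Norms

attribute [local instance] Matrix.frobeniusNormedAddCommGroup

theorem interiorValues_factorOp (s : Shifts) (h r : ℝ) {Nx Ny : ℕ} {v : Grid}
    (hv : ∀ i ≤ Nx, ∀ j ≤ Ny, (i = 0 ∨ i = Nx ∨ j = 0 ∨ j = Ny) → v i j = 0) :
    interiorValues Nx Ny (P.factorOp s h r Nx Ny v)
      = (interiorMatrix Nx (compactOp s P.α h)
          + r • interiorMatrix Nx (twoSided P.K1x P.K2x s P.α h Nx)) * interiorValues Nx Ny v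
        * (interiorMatrix Ny (compactOp s P.β h)
          + r • interiorMatrix Ny (twoSided P.K1y P.K2y s P.β h Ny)).transpose :=
  interiorValues_comp (opx := fun v i => compactOp s P.α h v i + r * twoSided P.K1x P.K2x s P.α h Nx v i)
    (opy := fun v j => compactOp s P.β h v j + r * twoSided P.K1y P.K2y s P.β h Ny v j)
    (fun _ hi1 hi => P.isGridFunctional_factorX s h r hi1 hi)
    (fun _ hj1 hj => P.isGridFunctional_factorY s h r hj1 hj) hv

theorem gridNorm_eq {h : ℝ} (hh : 0 ≤ h) (Nx Ny : ℕ) (v : Grid) :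
    gridNorm h Nx Ny v = h * ‖interiorValues Nx Ny v‖ := by
  have e : ∑ i ∈ Ico 1 Nx, ∑ j ∈ Ico 1 Ny, v i j ^ 2 = ‖interiorValues Nx Ny v‖ ^ 2 := by
    rw [frobenius_norm_sq, sum_Ico_one]
    exact sum_congr rfl fun i _ => sum_Ico_one _ _
  rw [gridNorm, e, ← mul_pow, Real.sqrt_sq (by positivity)]

theorem norm_interiorValues_le {Nx Ny : ℕ} {v : Grid} {ρ : ℝ} (hρ : 0 ≤ ρ)
    (hv : ∀ i j, 1 ≤ i → i < Nx → 1 ≤ j → j < Ny → |v i j| ≤ ρ) :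
    ‖interiorValues Nx Ny v‖ ≤ Real.sqrt (Nx * Ny) * ρ := by
  refine (sq_le_sq₀ (norm_nonneg _) (by positivity)).1 ?_
  rw [frobenius_norm_sq, mul_pow, Real.sq_sqrt (by positivity)]
  calc ∑ i, ∑ j, interiorValues Nx Ny v i j ^ 2
      ≤ ∑ _i : Fin (Nx - 1), ∑ _j : Fin (Ny - 1), ρ ^ 2 := by
        refine sum_le_sum fun i _ => sum_le_sum fun j _ => ?_
        have := hv (i + 1) (j + 1) (by omega) (by omega) (by omega) (by omega)
        exact sq_le_sq' (abs_le.1 this).1 (abs_le.1 this).2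
    _ = ((Nx - 1 : ℕ) : ℝ) * ((Ny - 1 : ℕ) : ℝ) * ρ ^ 2 := by simp [mul_assoc]
    _ ≤ Nx * Ny * ρ ^ 2 := by
        gcongr <;> exact Nat.sub_le _ _

/-- Stability: the error is controlled by the residual left by the exact solution in the scheme. -/
theorem gridNorm_error_le {S : Scheme} {s : Shifts} (hα : s.Admissible P.α) (hβ : s.Admissible P.β)
    {u : ℝ → ℝ → ℝ → ℝ} (hu : P.IsSolution u) {h τ : ℝ} {Nx Ny M : ℕ} (hh : 0 < h) (hτ : 0 < τ)
    (hNx : Nx * h = P.b - P.a) (hNy : Ny * h = P.d - P.c) (hM : M * τ = P.T) {U : ℕ → Grid}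
    (hU : P.IsSchemeSolution S s h τ Nx Ny M U) {ρ : ℝ} (hρ : 0 ≤ ρ)
    (hres : ∀ n < M, ∀ i j, 1 ≤ i → i < Nx → 1 ≤ j → j < Ny →
      |P.factorOp s h (-(τ / 2)) Nx Ny (P.sample h u (((n + 1 : ℕ) : ℝ) * τ)) i j
        - P.factorOp s h (τ / 2) Nx Ny (P.sample h u ((n : ℝ) * τ)) i j
        - P.schemeSource S s h τ Nx Ny n i j| ≤ ρ) {n : ℕ} (hn : n ≤ M) :
    gridNorm h Nx Ny (P.sample h u ((n : ℝ) * τ) - U n)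
      ≤ ((1 - 4 * compactCoeff s P.α) * (1 - 4 * compactCoeff s P.β))⁻¹
        * Real.sqrt ((P.b - P.a) * (P.d - P.c)) * (n * ρ) := by
  have hcα := hα.compactCoeff_lt
  have hcβ := hβ.compactCoeff_lt
  -- the error, which vanishes on the boundary of the grid
  set e : ℕ → Grid := fun n => P.sample h u ((n : ℝ) * τ) - U n with he
  have hbd : ∀ n ≤ M, ∀ i ≤ Nx, ∀ j ≤ Ny, (i = 0 ∨ i = Nx ∨ j = 0 ∨ j = Ny) → e n i j = 0 := by
    intro n hn i hi j hj hij
    have hnM : (n : ℝ) ≤ M := by exact_mod_cast hn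
    have hb : P.gridX h i = P.a ∨ P.gridX h i = P.b ∨ P.gridY h j = P.c ∨ P.gridY h j = P.d := by
      unfold gridX gridY
      rcases hij with rfl | rfl | rfl | rfl
      · left; simp
      · right; left; linarith
      · right; right; left; simp
      · right; right; right; linarith
    change P.sample h u ((n : ℝ) * τ) i j - U n i j = 0
    rw [hU.boundary n hn i hi j hj hij]
    exact sub_eq_zero.2 (hu.boundary _ (gridX_mem hh hNx hi) _ (gridY_mem hh hNy hj) _
      ⟨by positivity, by nlinarith⟩ hb)
  set R : ℕ → Grid := fun n => P.factorOp s h (-(τ / 2)) Nx Ny (e (n + 1))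
    - P.factorOp s h (τ / 2) Nx Ny (e n) with hR
  have hV0 : interiorValues Nx Ny (e 0) = 0 := by
    ext i j
    have := hU.initial (i + 1) ⟨by omega, by omega⟩ (j + 1) ⟨by omega, by omega⟩
    change P.sample h u (((0 : ℕ) : ℝ) * τ) (i + 1) (j + 1) - U 0 (i + 1) (j + 1) = 0
    rw [this, Nat.cast_zero, zero_mul]
    exact sub_eq_zero.2 (hu.initial _ (gridX_mem_Ioo hh hNx (by omega) (by omega)) _
      (gridY_mem_Ioo hh hNy (by omega) (by omega)))
  have hRb : ∀ n < M, ‖interiorValues Nx Ny (R n)‖ ≤ Real.sqrt (Nx * Ny) * ρ := by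
    intro n hn
    refine norm_interiorValues_le hρ fun i j hi1 hi hj1 hj => ?_
    refine le_of_eq_of_le (congrArg abs ?_) (hres n hn i j hi1 hi hj1 hj)
    change P.factorOp s h (-(τ / 2)) Nx Ny (e (n + 1)) i j - P.factorOp s h (τ / 2) Nx Ny (e n) i j = _
    rw [he, factorOp_sub s h _ _ _ hi1 hi hj1 hj, factorOp_sub s h _ _ _ hi1 hi hj1 hj,
      hU.step n hn i ⟨hi1, hi⟩ j ⟨hj1, hj⟩]
    ring
  have hstep : ∀ n < M,
      (interiorMatrix Nx (compactOp s P.α h)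
        - (τ / 2) • interiorMatrix Nx (twoSided P.K1x P.K2x s P.α h Nx))
        * interiorValues Nx Ny (e (n + 1))
        * (interiorMatrix Ny (compactOp s P.β h)
          - (τ / 2) • interiorMatrix Ny (twoSided P.K1y P.K2y s P.β h Ny)).transpose
      = (interiorMatrix Nx (compactOp s P.α h)
        + (τ / 2) • interiorMatrix Nx (twoSided P.K1x P.K2x s P.α h Nx))
        * interiorValues Nx Ny (e n)
        * (interiorMatrix Ny (compactOp s P.β h)
          + (τ / 2) • interiorMatrix Ny (twoSided P.K1y P.K2y s P.β h Ny)).transpose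
        + interiorValues Nx Ny (R n) := by
    intro n hn
    have e1 := interiorValues_factorOp (P := P) s h (-(τ / 2)) (hbd (n + 1) hn)
    have e2 := interiorValues_factorOp (P := P) s h (τ / 2) (hbd n hn.le)
    rw [neg_smul, neg_smul, ← sub_eq_add_neg, ← sub_eq_add_neg] at e1
    rw [← e1, ← e2, hR]
    ext i j
    simp only [interiorValues, Matrix.add_apply, Matrix.of_apply, Pi.sub_apply]
    ring
  have key := factorized_stability (by linarith : 0 < 1 - 4 * compactCoeff s P.α)
    (by linarith : 0 < 1 - 4 * compactCoeff s P.β) (by positivity : 0 ≤ τ / 2)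
    (interiorMatrix_compactOp_transpose s P.α h Nx) (interiorMatrix_compactOp_transpose s P.β h Ny)
    (interiorMatrix_compactOp_coercive s (hα.compactCoeff_nonneg P.hα.1) hh Nx)
    (interiorMatrix_compactOp_coercive s (hβ.compactCoeff_nonneg P.hβ.1) hh Ny)
    (interiorMatrix_twoSided_dissipative P.hK1x P.hK2x s P.hα.1.le P.hα.2 hh Nx)
    (interiorMatrix_twoSided_dissipative P.hK1y P.hK2y s P.hβ.1.le P.hβ.2 hh Ny) M
    (fun n => interiorValues Nx Ny (e n)) (fun n => interiorValues Nx Ny (R n)) hV0 hRb hstep n hn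
  have hs : h * Real.sqrt (Nx * Ny) = Real.sqrt ((P.b - P.a) * (P.d - P.c)) := by
    rw [← hNx, ← hNy, show (Nx : ℝ) * h * (Ny * h) = h ^ 2 * (Nx * Ny) by ring,
      Real.sqrt_mul (sq_nonneg h), Real.sqrt_sq hh.le]
  rw [gridNorm_eq hh.le, ← hs]
  refine (mul_le_mul_of_nonneg_left key hh.le).trans_eq (by ring)

end Norms

/-- Convergence from a bound of the residual of order two in time and three in space, per unit of
time. -/
theorem convergesTwoThree_of_residual {S : Scheme} {s : Shifts} (hα : s.Admissible P.α)
    (hβ : s.Admissible P.β) {u : ℝ → ℝ → ℝ → ℝ} (hu : P.IsSolution u) {C : ℝ} (hC : 0 ≤ C)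
    (hres : ∀ (Nx Ny : ℕ) (h τ : ℝ), 0 < h → 0 < τ → Nx * h = P.b - P.a → Ny * h = P.d - P.c →
      ∀ n : ℕ, ((n : ℝ) + 1) * τ ≤ P.T → ∀ i j, 1 ≤ i → i < Nx → 1 ≤ j → j < Ny →
      |P.factorOp s h (-(τ / 2)) Nx Ny (P.sample h u (((n + 1 : ℕ) : ℝ) * τ)) i j
        - P.factorOp s h (τ / 2) Nx Ny (P.sample h u ((n : ℝ) * τ)) i j
        - P.schemeSource S s h τ Nx Ny n i j| ≤ C * τ * (τ ^ 2 + h ^ 3)) :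
    P.ConvergesTwoThree S s u := by
  have hcα := hα.compactCoeff_lt
  have hcβ := hβ.compactCoeff_lt
  set K := ((1 - 4 * compactCoeff s P.α) * (1 - 4 * compactCoeff s P.β))⁻¹
    * Real.sqrt ((P.b - P.a) * (P.d - P.c)) with hK
  have hK0 : 0 ≤ K := mul_nonneg
    (inv_nonneg.2 (mul_nonneg (by linarith) (by linarith))) (Real.sqrt_nonneg _)
  have hT := P.hT
  refine ⟨K * (P.T * C) + 1, by positivity, fun Nx Ny M hNx hNy hM h τ hx hy ht U hU n hn1 hn => ?_⟩
  have hNx' : (0 : ℝ) < Nx := by exact_mod_cast hNx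
  have hNy' : (0 : ℝ) < Ny := by exact_mod_cast hNy
  have hM' : (0 : ℝ) < M := by exact_mod_cast hM
  have hh : 0 < h := by rw [hx]; exact div_pos (sub_pos.2 P.hab) hNx'
  have hτ : 0 < τ := by rw [ht]; exact div_pos hT hM'
  have hMτ : M * τ = P.T := by rw [ht]; field_simp
  have key := gridNorm_error_le hα hβ hu hh hτ (by rw [hx]; field_simp) (by rw [hy]; field_simp) hMτ hU
    (ρ := C * τ * (τ ^ 2 + h ^ 3)) (by positivity) (fun n hn i j hi1 hi hj1 hj => ?_) hn
  · have hnT : n * τ ≤ P.T := by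
      rw [← hMτ]
      gcongr
    refine key.trans ?_
    have : K * (n * (C * τ * (τ ^ 2 + h ^ 3))) = K * ((n * τ) * C) * (τ ^ 2 + h ^ 3) := by ring
    rw [this]
    have hpos : 0 ≤ τ ^ 2 + h ^ 3 := by positivity
    refine mul_le_mul_of_nonneg_right ?_ hpos
    have : K * (n * τ * C) ≤ K * (P.T * C) := by gcongr
    linarith
  · refine hres Nx Ny h τ hh hτ (by rw [hx]; field_simp) (by rw [hy]; field_simp) n ?_ i j hi1 hi hj1 hj
    rw [← hMτ]
    have : (n : ℝ) + 1 ≤ M := by exact_mod_cast hn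
    gcongr

theorem SmoothOfOrder.exists_extension {k : ℕ} {g : ℝ → ℝ → ℝ → ℝ} (hg : P.SmoothOfOrder k g) :
    ∃ G : ℝ × ℝ × ℝ → ℝ, ContDiff ℝ k G ∧ P.VanishesAcross G ∧
      ∀ x ∈ Set.Icc P.a P.b, ∀ y ∈ Set.Icc P.c P.d, ∀ t ∈ Set.Icc 0 P.T, G (x, y, t) = g x y t := by
  obtain ⟨G, hG, heq, ha, hb, hc, hd⟩ := hg
  exact ⟨G, hG, ⟨fun y hy t ht => ⟨fun k x hx => ha k x hx y hy t ht, fun k x hx => hb k x hx y hy t ht⟩,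
    fun x hx t ht => ⟨fun k y hy => hc k x hx y hy t ht, fun k y hy => hd k x hx y hy t ht⟩⟩, heq⟩

theorem sample_eq_gridValues {g : ℝ → ℝ → ℝ → ℝ} {G : ℝ × ℝ × ℝ → ℝ}
    (hG : ∀ x ∈ Set.Icc P.a P.b, ∀ y ∈ Set.Icc P.c P.d, ∀ t ∈ Set.Icc 0 P.T, G (x, y, t) = g x y t)
    {Nx Ny : ℕ} {h : ℝ} (hh : 0 < h) (hNx : Nx * h = P.b - P.a) (hNy : Ny * h = P.d - P.c) {t : ℝ}
    (ht : t ∈ Set.Icc 0 P.T) (i : ℕ) (hi : i ≤ Nx) (j : ℕ) (hj : j ≤ Ny) :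
    P.sample h g t i j = P.gridValues h G t i j :=
  (hG _ (gridX_mem hh hNx hi) _ (gridY_mem hh hNy hj) t ht).symm

/-- The residual of the solution in the scheme without additional term. -/
theorem exists_factorized_residual_le {s : Shifts} (hα : s.Admissible P.α) (hβ : s.Admissible P.β)
    {u : ℝ → ℝ → ℝ → ℝ} (hu : P.IsSolution u) (hsmooth : P.SmoothOfOrder 7 u) :
    ∃ C, 0 ≤ C ∧ ∀ (Nx Ny : ℕ) (h τ : ℝ), 0 < h → 0 < τ → Nx * h = P.b - P.a →
      Ny * h = P.d - P.c → ∀ n : ℕ, ((n : ℝ) + 1) * τ ≤ P.T →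
      ∀ i j, 1 ≤ i → i < Nx → 1 ≤ j → j < Ny →
      |P.factorOp s h (-(τ / 2)) Nx Ny (P.sample h u (((n + 1 : ℕ) : ℝ) * τ)) i j
        - P.factorOp s h (τ / 2) Nx Ny (P.sample h u ((n : ℝ) * τ)) i j
        - P.schemeSource .factorized s h τ Nx Ny n i j| ≤ C * τ * (τ ^ 2 + h ^ 3) := by
  obtain ⟨G, hG, hvan, hGu⟩ := hsmooth.exists_extension
  obtain ⟨C, hC, hres⟩ := exists_residual_le s hα.lt_two hβ.lt_two (hα.compactCoeff_nonneg P.hα.1)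
    (hα.compactCoeff_lt.le.trans (by norm_num)) (hβ.compactCoeff_nonneg P.hβ.1)
    (hβ.compactCoeff_lt.le.trans (by norm_num)) hu hG hvan hGu
  refine ⟨C, hC, fun Nx Ny h τ hh hτ hNx hNy n hn i j hi1 hi hj1 hj => ?_⟩
  set m : ℝ := ((n : ℝ) * τ + ((n : ℝ) + 1) * τ) / 2 with hm
  have e0 : (n : ℝ) * τ = m - τ / 2 := by rw [hm]; ring
  have e1 : ((n + 1 : ℕ) : ℝ) * τ = m + τ / 2 := by rw [hm]; push_cast; ring
  have h0 : 0 ≤ m - τ / 2 := by rw [← e0]; positivity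
  have h1 : m + τ / 2 ≤ P.T := by rw [← e1]; push_cast; exact hn
  have key := hres Nx Ny h hh hNx hNy i j hi1 hi hj1 hj m (τ / 2) (by positivity) h0 h1
  rw [e0, e1, factorOp_congr s h _ hi1 hi hj1 hj
      (sample_eq_gridValues hGu hh hNx hNy ⟨by linarith, h1⟩),
    factorOp_congr s h _ hi1 hi hj1 hj (sample_eq_gridValues hGu hh hNx hNy ⟨h0, by linarith⟩)]
  have es : P.schemeSource .factorized s h τ Nx Ny n i j
      = 2 * (τ / 2) * P.Cx s h (P.Cy s h (P.sample h P.f m)) i j := by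
    change τ * P.Cx s h (P.Cy s h (P.sample h P.f m)) i j = _
    ring
  rw [es]
  refine key.trans ?_
  have p1 : 0 ≤ C * τ := by positivity
  have p2 : 0 ≤ h ^ 3 := by positivity
  nlinarith [mul_nonneg p1 p2, mul_nonneg p1 (sq_nonneg τ)]

/-- The additional term of the corrected scheme is `O(τ³)`, hence within the residual. -/
theorem exists_corrected_residual_le {s : Shifts} (hα : s.Admissible P.α) (hβ : s.Admissible P.β)
    {u : ℝ → ℝ → ℝ → ℝ} (hu : P.IsSolution u) (hsmooth : P.SmoothOfOrder 7 u)
    (hf : P.SmoothOfOrder 4 P.f) :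
    ∃ C, 0 ≤ C ∧ ∀ (Nx Ny : ℕ) (h τ : ℝ), 0 < h → 0 < τ → Nx * h = P.b - P.a →
      Ny * h = P.d - P.c → ∀ n : ℕ, ((n : ℝ) + 1) * τ ≤ P.T →
      ∀ i j, 1 ≤ i → i < Nx → 1 ≤ j → j < Ny →
      |P.factorOp s h (-(τ / 2)) Nx Ny (P.sample h u (((n + 1 : ℕ) : ℝ) * τ)) i j
        - P.factorOp s h (τ / 2) Nx Ny (P.sample h u ((n : ℝ) * τ)) i j
        - P.schemeSource .corrected s h τ Nx Ny n i j| ≤ C * τ * (τ ^ 2 + h ^ 3) := by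
  obtain ⟨C₁, hC₁, hres⟩ := exists_factorized_residual_le hα hβ hu hsmooth
  obtain ⟨F, hF, hvan, hFf⟩ := hf.exists_extension
  obtain ⟨C₂, hC₂, hmix⟩ := exists_abs_mixed_gridValues_le s hF hvan
  refine ⟨C₁ + C₂, by positivity, fun Nx Ny h τ hh hτ hNx hNy n hn i j hi1 hi hj1 hj => ?_⟩
  have key := hres Nx Ny h τ hh hτ hNx hNy n hn i j hi1 hi hj1 hj
  set m : ℝ := ((n : ℝ) * τ + ((n : ℝ) + 1) * τ) / 2 with hm
  have hn0 : (0 : ℝ) ≤ n * τ := by positivity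
  have hmT : m ∈ Set.Icc 0 P.T := by
    constructor <;> rw [hm] <;> nlinarith
  have hfb := hmix Nx Ny h hh hNx hNy i j hi1 hi hj1 hj m hmT
  rw [← δx_δy_congr s h hi1 hi hj1 hj (sample_eq_gridValues hFf hh hNx hNy hmT)] at hfb
  have es : P.schemeSource .corrected s h τ Nx Ny n i j
      = P.schemeSource .factorized s h τ Nx Ny n i j
        + τ ^ 3 / 4 * P.δx s h Nx (P.δy s h Ny (P.sample h P.f m)) i j := rfl
  rw [es, ← sub_sub]
  refine (abs_sub _ _).trans ((add_le_add_left key _).trans ?_)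
  rw [abs_mul, abs_of_nonneg (by positivity : 0 ≤ τ ^ 3 / 4)]
  have p1 : 0 ≤ C₂ * τ * h ^ 3 := by positivity
  have p2 : 0 ≤ C₂ * τ ^ 3 := by positivity
  have p3 := mul_le_mul_of_nonneg_left hfb (by positivity : 0 ≤ τ ^ 3 / 4)
  nlinarith

end Problem

end Convergence

end FracDiff
end

theorem theorem4 (P : FracDiff.Problem) (s : FracDiff.Shifts)
    (hα : s.Admissible P.α) (hβ : s.Admissible P.β)
    (u : ℝ → ℝ → ℝ → ℝ) (hu : P.IsSolution u) (hsmooth : P.SmoothOfOrder 7 u) :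
    P.ConvergesTwoThree FracDiff.Scheme.factorized s u ∧
      (P.SmoothOfOrder 4 P.f → P.ConvergesTwoThree FracDiff.Scheme.corrected s u) := by
  constructor
  · obtain ⟨C, hC, hres⟩ := FracDiff.Problem.exists_factorized_residual_le hα hβ hu hsmooth
    exact FracDiff.Problem.convergesTwoThree_of_residual hα hβ hu hC hres
  · intro hf
    obtain ⟨C, hC, hres⟩ := FracDiff.Problem.exists_corrected_residual_le hα hβ hu hsmooth hf
    exact FracDiff.Problem.convergesTwoThree_of_residual hα hβ hu hC hres
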